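/- Let $\mathcal H$ be a real separable infinite-dimensional Hilbert space with orthonormal basis $\{\phi_j\}_{j\ge1}$, and write $x_j=\langle x,\phi_j\rangle$. Let $\mathcal C$ be a bounded linear operator on $\mathcal H$ with $\mathcal C\phi_j=\lambda_j^2\phi_j$, $\lambda_j>0$. For $s\ge 0$ let $\mathcal H^s=\{x\in\mathcal H:\ \|x\|_s^2:=\sum_j j^{2s}x_j^2<\infty\}$, a Hilbert space with norm $\|\cdot\|_s$; $\|\cdot\|_{-s}$ denotes the norm of its dual. *Assumption 1.* (i) There are $\kappa>\frac12$ and constants $0<c_1\le c_2$ with $c_1j^{-\kappa}\le\lambda_j\le c_2j^{-\kappa}$ for all $j$. (ii) $0\le s<\kappa-\frac12$ and $\Psi:\mathcal H^s\to\mathbb R$ is defined everywhere. (iii) $\Psi$ is Fréchet differentiable, and there is a constant $K$ with $\|\nabla\Psi(x)\|_{-s}\le K$ and $\|\nabla\Psi(x)-\nabla\Psi(y)\|_{-s}\le K\|x-y\|_s$ for all $x,y\in\mathcal H^s$. Let $\mathcal P^N$ be the orthogonal projection onto $X^N=\mathrm{span}\{\phi_1,\dots,\phi_N\}$, $\Psi^N=\Psi\circ\mathcal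 P^N$, $\mathcal C_N=\mathcal P^N\mathcal C\mathcal P^N$, and $\|x\|_{\mathcal C_N}^2=\sum_{j\le N}x_j^2/\lambda_j^2$. Let $\pi^N$ be the probability measure on $X^N\cong\mathbb R^N$ with Lebesgue density proportional to $\exp(-\Psi^N(x)-\frac12\|x\|_{\mathcal C_N}^2)$. Fix $\ell>0$ and put $\delta=\ell/\sqrt N$. Given $x^0\in\mathcal H^s$, the MALA chain $\{x^{k,N}\}_{k\ge0}\subset X^N$ starts at $x^{0,N}=\mathcal P^N(x^0)$. At step $k$ it proposes $$y^{k,N}=x^{k,N}-\delta\bigl(x^{k,N}+\mathcal C_N\nabla\Psi^N(x^{k,N})\bigr)+\sqrt{2\delta}\,\mathcal C_N^{1/2}\xi^{k,N},\qquad \xi^{k,N}=\sum_{j\le N}\xi^{k,N}_j\phi_j,$$ and sets $x^{k+1,N}=y^{k,N}$ if $U^{k,N}\le\alpha^N(x^{k,N},y^{k,N})$ and $x^{k+1,N}=x^{k,N}$ otherwise. Here, for each $N$, the $\xi^{k,N}_j\sim\mathcal N(0,1)$ and the $U^{k,N}\sim\mathrm{Uniform}[0,1]$ ($k\ge0$,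 $j\le N$) are all independent, and $$\alpha^N(x,y)=1\wedge\frac{\pi^N(y)\,q^N(y,x)}{\pi^N(x)\,q^N(x,y)},\qquad q^N(x,y)\propto\exp\Bigl(-\tfrac1{4\delta}\bigl\|y-x+\delta\bigl(x+\mathcal C_N\nabla\Psi^N(x)\bigr)\bigr\|_{\mathcal C_N}^2\Bigr).$$ Let $S^{k,N}=\frac1N\sum_{i=1}^N|x_i^{k,N}|^2/\lambda_i^2$, and let $S^{(N)}$ be its continuous interpolant $$S^{(N)}(t)=(\sqrt N\,t-k)S^{k+1,N}+(k+1-\sqrt N\,t)S^{k,N},\qquad \tfrac{k}{\sqrt N}\le t<\tfrac{k+1}{\sqrt N}.$$ **Theorem.** Let Assumption 1 hold, let $\delta=\ell/\sqrt N$ and $T>0$, and let $x^0\in\mathcal H^s_\cap$, that is, $x^0\in\mathcal H^s$ and the limit $S^0:=\lim_{N\to\infty}\frac1N\sum_{i=1}^N|x^0_i|^2/\lambda_i^2$ exists and is finite. Then the ODE $$dS(t)=b_\ell(S(t))\,dt,\qquad S(0)=S^0,\qquad b_\ell(r)=2\ell(1-r)\bigl(1\wedge e^{\ell^2(r-1)/2}\bigr),$$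 has exactly one solution $S$ on $[0,T]$, and $S^{(N)}\to S$ in probability in $C([0,T];\mathbb R)$ (with the uniform topology) as $N\to\infty$. -/

import Mathlib

open Filter Topology MeasureTheory ProbabilityTheory

namespace MALA

noncomputable section

section Space

variable {H : Type*} [NormedAddCommGroup H] [InnerProductSpace ℝ H]

/-- The underlying set of `H^s` (for `s ≥ 0`): those `x ∈ H` with `∑_j j^{2s} x_j² < ∞`, where
`x_j = ⟨φ_j, x⟩`. The basis is indexed by `j = 0, 1, 2, …`, so the weight of index `j` is
`(j + 1)^{2s}`. -/
def sobolevSubmodule (φ : HilbertBasis ℕ ℝ H) (s : ℝ) : Submodule ℝ H where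
  carrier := {x | Summable fun j : ℕ => ((j : ℝ) + 1) ^ (2 * s) * (inner ℝ (φ j) x) ^ 2}
  zero_mem' := by simp [summable_zero]
  add_mem' := by
    intro x y hx hy
    refine Summable.of_nonneg_of_le (fun j => by positivity) (fun j => ?_)
      ((hx.add hy).mul_left 2)
    have hw : (0 : ℝ) ≤ ((j : ℝ) + 1) ^ (2 * s) := by positivity
    have h2 : (inner ℝ (φ j) (x + y)) ^ 2
        ≤ 2 * ((inner ℝ (φ j) x) ^ 2 + (inner ℝ (φ j) y) ^ 2) := by
      rw [inner_add_right]
      nlinarith [sq_nonneg (inner ℝ (φ j) x - inner ℝ (φ j) y)]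
    nlinarith [mul_le_mul_of_nonneg_left h2 hw]
  smul_mem' := by
    intro c x hx
    refine (Summable.mul_left (c ^ 2) hx).congr (fun j => ?_)
    rw [inner_smul_right]
    ring

/-- The Hilbert space `H^s` (for `s ≥ 0`). It is a type of its own, so that it carries the norm
`‖·‖_s` and not the norm of `H`. -/
def SobolevSpace (φ : HilbertBasis ℕ ℝ H) (s : ℝ) : Type _ := sobolevSubmodule φ s

variable (φ : HilbertBasis ℕ ℝ H) (s : ℝ)

section Norm

/-- The vector space structure of `H^s`, inherited from `H`. -/
@[reducible] def SobolevSpace.addCommGroup : AddCommGroup (SobolevSpace φ s) :=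
  inferInstanceAs (AddCommGroup (sobolevSubmodule φ s))

attribute [local instance] SobolevSpace.addCommGroup

/-- The vector space structure of `H^s`, inherited from `H`. -/
@[reducible] def SobolevSpace.module : Module ℝ (SobolevSpace φ s) :=
  inferInstanceAs (Module ℝ (sobolevSubmodule φ s))

attribute [local instance] SobolevSpace.module

theorem SobolevSpace.summable_mul (x y : SobolevSpace φ s) :
    Summable fun j : ℕ => ((j : ℝ) + 1) ^ (2 * s) *
      (inner ℝ (φ j) (x.1 : H) * inner ℝ (φ j) (y.1 : H)) := by
  have h := (((x + y).2 : Summable _).sub ((x.2 : Summable _).add (y.2 : Summable _))).mul_left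
    (1 / 2)
  refine h.congr (fun j => ?_)
  have hxy : ((x + y).1 : H) = x.1 + y.1 := rfl
  rw [hxy, inner_add_right]
  ring

/-- The scalar product `⟨x, y⟩_s = ∑_j j^{2s} x_j y_j`. -/
@[reducible] def SobolevSpace.core : InnerProductSpace.Core ℝ (SobolevSpace φ s) where
  inner x y := ∑' j : ℕ, ((j : ℝ) + 1) ^ (2 * s) *
    (inner ℝ (φ j) (x.1 : H) * inner ℝ (φ j) (y.1 : H))
  conj_inner_symm x y := by
    simp only [conj_trivial]
    exact tsum_congr fun j => by ring
  re_inner_nonneg x := by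
    simp only [RCLike.re_to_real]
    exact tsum_nonneg fun j => mul_nonneg (by positivity) (mul_self_nonneg _)
  add_left x y z := by
    rw [← (SobolevSpace.summable_mul φ s x z).tsum_add (SobolevSpace.summable_mul φ s y z)]
    refine tsum_congr fun j => ?_
    have hxy : ((x + y).1 : H) = x.1 + y.1 := rfl
    rw [hxy, inner_add_right]
    ring
  smul_left x y r := by
    simp only [conj_trivial]
    rw [← tsum_mul_left]
    refine tsum_congr fun j => ?_
    have hx : ((r • x).1 : H) = r • x.1 := rfl
    rw [hx, inner_smul_right]
    ring
  definite x hx := by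
    have hnn : ∀ j : ℕ, (0 : ℝ) ≤ ((j : ℝ) + 1) ^ (2 * s) *
        (inner ℝ (φ j) (x.1 : H) * inner ℝ (φ j) (x.1 : H)) :=
      fun j => mul_nonneg (by positivity) (mul_self_nonneg _)
    have h0 := (hasSum_zero_iff_of_nonneg hnn).1
      (hx ▸ (SobolevSpace.summable_mul φ s x x).hasSum)
    have hc : ∀ j : ℕ, inner ℝ (φ j) (x.1 : H) = 0 := by
      intro j
      have hj := congrFun h0 j
      have hw : (0 : ℝ) < ((j : ℝ) + 1) ^ (2 * s) := by positivity
      simpa [hw.ne'] using hj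
    have hx0 : (x.1 : H) = 0 := by
      apply φ.repr.injective
      ext j
      simpa [φ.repr_apply_apply] using hc j
    exact Subtype.ext hx0

/-- The norm `‖·‖_s` of `H^s`. -/
instance : NormedAddCommGroup (SobolevSpace φ s) :=
  (SobolevSpace.core φ s).toNormedAddCommGroup

instance : InnerProductSpace ℝ (SobolevSpace φ s) :=
  InnerProductSpace.ofCore (SobolevSpace.core φ s).toCore

end Norm

/-- The inclusion `H^s ⊆ H`. -/
def SobolevSpace.toH : SobolevSpace φ s →ₗ[ℝ] H where
  toFun x := x.1
  map_add' _ _ := rfl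
  map_smul' _ _ := rfl

/-- The basis vector `φ_j` as an element of `H^s`. -/
def basisVec (j : ℕ) : SobolevSpace φ s :=
  ⟨φ j, summable_of_ne_finset_zero (s := {j}) fun i hi => by
    have hij : i ≠ j := by simpa using hi
    simp [φ.orthonormal.2 hij]⟩

/-- The projection `P^N x = ∑_{j ≤ N} ⟨φ_j, x⟩ φ_j` of `H` onto
`X^N = span {φ_1, …, φ_N}`. -/
def proj (N : ℕ) : H →L[ℝ] H :=
  ∑ j ∈ Finset.range N, (innerSL ℝ (φ j)).smulRight (φ j)

/-- The same projection `P^N`, seen as a map of `H` into `H^s` (which contains `X^N`). -/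
def projS (N : ℕ) : H →L[ℝ] SobolevSpace φ s :=
  ∑ j ∈ Finset.range N, (innerSL ℝ (φ j)).smulRight (basisVec φ s j)

/-- `Ψ^N = Ψ ∘ P^N`. -/
def PsiN (Ψ : SobolevSpace φ s → ℝ) (N : ℕ) (x : H) : ℝ := Ψ (projS φ s N x)

/-- `C_N = P^N ∘ C ∘ P^N`. -/
def covN (C : H →L[ℝ] H) (N : ℕ) : H →L[ℝ] H := proj φ N ∘L C ∘L proj φ N

/-- `C_N^{1/2}`, the operator with `φ_j ↦ λ_j φ_j` for `j ≤ N`, and zero on the orthogonal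
complement of `X^N`. -/
def sqrtCovN (lam : ℕ → ℝ) (N : ℕ) : H →L[ℝ] H :=
  ∑ j ∈ Finset.range N, (innerSL ℝ (φ j)).smulRight (lam j • φ j)

/-- `‖x‖²_{C_N} = ∑_{j ≤ N} x_j² / λ_j²`. -/
def normSqCN (lam : ℕ → ℝ) (N : ℕ) (x : H) : ℝ :=
  ∑ j ∈ Finset.range N, (inner ℝ (φ j) x) ^ 2 / lam j ^ 2

/-- The distance from stationarity `(1/N) ∑_{i ≤ N} x_i² / λ_i²` of a point. -/
def meanSq (lam : ℕ → ℝ) (N : ℕ) (x : H) : ℝ := 1 / (N : ℝ) * normSqCN φ lam N x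

/-- The set `H^s_∩` of those `x ∈ H^s` for which `(1/N) ∑_{i ≤ N} x_i² / λ_i²` has a finite limit
as `N → ∞`. -/
def sobolevCap (lam : ℕ → ℝ) : Set (SobolevSpace φ s) :=
  {x | ∃ L : ℝ, Tendsto (fun N : ℕ => meanSq φ lam N (SobolevSpace.toH φ s x)) atTop (𝓝 L)}

/-- The standing assumption on the covariance operator `C` (with `C φ_j = λ_j² φ_j`) and on the
functional `Ψ`. The derivative `∇Ψ(x)` is an element of the dual of `H^s`, and its norm `‖·‖_{-s}`
is the norm of that dual. -/
structure StandingAssumption (C : H →L[ℝ] H) (lam : ℕ → ℝ) (κ : ℝ)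
    (Ψ : SobolevSpace φ s → ℝ) : Prop where
  eigen : ∀ j, C (φ j) = (lam j ^ 2) • φ j
  half_lt : 1 / 2 < κ
  decay : ∃ c₁ > (0 : ℝ), ∃ c₂ : ℝ, ∀ j : ℕ,
    c₁ * ((j : ℝ) + 1) ^ (-κ) ≤ lam j ∧ lam j ≤ c₂ * ((j : ℝ) + 1) ^ (-κ)
  nonneg_s : 0 ≤ s
  s_lt : s < κ - 1 / 2
  differentiable : Differentiable ℝ Ψ
  deriv_bounded : ∃ K : ℝ, ∀ x, ‖fderiv ℝ Ψ x‖ ≤ K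
  deriv_lipschitz : ∃ K : ℝ, ∀ x y, ‖fderiv ℝ Ψ x - fderiv ℝ Ψ y‖ ≤ K * ‖x - y‖

end Space

section Algorithm

variable {H : Type*} [NormedAddCommGroup H] [InnerProductSpace ℝ H] [CompleteSpace H]
variable (φ : HilbertBasis ℕ ℝ H) (s : ℝ) (C : H →L[ℝ] H) (lam : ℕ → ℝ)
  (Ψ : SobolevSpace φ s → ℝ) (ℓ : ℝ) (N : ℕ)

/-- The time step `δ = ℓ / N^{1/2}`. -/
def step : ℝ := ℓ / √(N : ℝ)

/-- `C_N ∇ log π^N (x) = -(x + C_N ∇Ψ^N(x))` for `x ∈ X^N`. -/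
def drift (x : H) : H := -(x + covN φ C N (gradient (PsiN φ s Ψ N) x))

/-- The proposal `y = x + δ C_N ∇ log π^N (x) + (2δ)^{1/2} C_N^{1/2} ξ` with
`ξ = ∑_{j ≤ N} ξ_j φ_j`. -/
def proposal (x : H) (ξ : Fin N → ℝ) : H :=
  x + step ℓ N • drift φ s C Ψ N x
    + √(2 * step ℓ N) • sqrtCovN φ lam N (∑ j : Fin N, ξ j • φ j)

/-- The density of the target measure `π^N` with respect to Lebesgue measure on `X^N ≅ ℝ^N`, up to
the normalization constant (which cancels in the acceptance probability):
`π^N ∝ exp(-Ψ^N) N(0, C_N)`. -/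
def targetDensity (x : H) : ℝ :=
  Real.exp (-PsiN φ s Ψ N x) * Real.exp (-(1 / 2) * normSqCN φ lam N x)

/-- The density `q^N(x, y)` of the proposal, up to a constant independent of `x` and `y` (which
cancels in the acceptance probability). -/
def proposalDensity (x y : H) : ℝ :=
  Real.exp (-(1 / (4 * step ℓ N)) *
    normSqCN φ lam N ((y - x) - step ℓ N • drift φ s C Ψ N x))

/-- The Metropolis-Hastings acceptance probability `α^N(x, y)`. -/
def acceptProb (x y : H) : ℝ :=
  min 1 ((targetDensity φ s lam Ψ N y * proposalDensity φ s C lam Ψ ℓ N y x) /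
    (targetDensity φ s lam Ψ N x * proposalDensity φ s C lam Ψ ℓ N x y))

open Classical in
/-- The MALA chain `x^{k,N}` in `X^N`, driven by Gaussian vectors `ξ^k` and uniform variables
`U^k`, and started at `x^{0,N} = P^N(x⁰)`: the proposal is accepted if and only if
`U^k ≤ α^N(x^k, y^k)`. -/
def chain (x₀ : H) (ξ : ℕ → Fin N → ℝ) (U : ℕ → ℝ) : ℕ → H
  | 0 => proj φ N x₀
  | k + 1 =>
    let x := chain x₀ ξ U k
    let y := proposal φ s C lam Ψ ℓ N x (ξ k)
    if U k ≤ acceptProb φ s C lam Ψ ℓ N x y then y else x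

/-- The sequence `S^{k,N} = (1/N) ∑_{i ≤ N} |x_i^{k,N}|² / λ_i²`. -/
def chainS (x₀ : H) (ξ : ℕ → Fin N → ℝ) (U : ℕ → ℝ) (k : ℕ) : ℝ :=
  meanSq φ lam N (chain φ s C lam Ψ ℓ N x₀ ξ U k)

end Algorithm

section Interpolant

/-- The piecewise linear function of `u ≥ 0` with value `a k` at `u = k`. -/
def linInterp (a : ℕ → ℝ) (u : ℝ) : ℝ :=
  (u - (⌊u⌋₊ : ℝ)) * a (⌊u⌋₊ + 1) + ((⌊u⌋₊ : ℝ) + 1 - u) * a ⌊u⌋₊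

theorem linInterp_eq (a : ℕ → ℝ) (k : ℕ) {u : ℝ} (h : u ∈ Set.Icc (k : ℝ) (k + 1)) :
    linInterp a u = (u - k) * a (k + 1) + (k + 1 - u) * a k := by
  rcases h.2.lt_or_eq with h2 | h2
  · have hf : ⌊u⌋₊ = k := by
      rw [Nat.floor_eq_iff ((Nat.cast_nonneg k).trans h.1)]
      exact ⟨h.1, h2⟩
    simp [linInterp, hf]
  · have hf : ⌊u⌋₊ = k + 1 := by
      rw [h2]
      exact_mod_cast Nat.floor_natCast (R := ℝ) (k + 1)
    unfold linInterp
    rw [hf, h2]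
    push_cast
    ring

theorem continuousOn_linInterp (a : ℕ → ℝ) (n : ℕ) :
    ContinuousOn (linInterp a) (Set.Icc 0 (n : ℝ)) := by
  induction n with
  | zero => simp
  | succ n ih =>
    have hpiece : ContinuousOn (linInterp a) (Set.Icc (n : ℝ) (n + 1)) := by
      refine ContinuousOn.congr (f := fun u : ℝ => (u - n) * a (n + 1) + (n + 1 - u) * a n) ?_
        (fun u hu => linInterp_eq a n hu)
      fun_prop
    have hu : Set.Icc (0 : ℝ) ((n + 1 : ℕ) : ℝ) = Set.Icc 0 (n : ℝ) ∪ Set.Icc (n : ℝ) (n + 1) := by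
      rw [Set.Icc_union_Icc_eq_Icc (Nat.cast_nonneg n) (by linarith)]
      push_cast
      rfl
    rw [hu]
    exact ih.union_of_isClosed hpiece isClosed_Icc isClosed_Icc

/-- The continuous interpolant on `[0, T]` of a sequence `a`, with time step `N^{-1/2}`:
`(N^{1/2} t - k) a_{k+1} + (k + 1 - N^{1/2} t) a_k` for `t_k ≤ t < t_{k+1}`, `t_k = k / N^{1/2}`. -/
def interpolant (N : ℕ) (T : ℝ) (a : ℕ → ℝ) : C(Set.Icc (0 : ℝ) T, ℝ) where
  toFun t := linInterp a (√(N : ℝ) * t)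
  continuous_toFun := by
    obtain ⟨n, hn⟩ := exists_nat_ge (√(N : ℝ) * T)
    refine (continuousOn_linInterp a n).comp_continuous (by fun_prop) (fun t => ?_)
    exact ⟨mul_nonneg (Real.sqrt_nonneg _) t.2.1,
      (mul_le_mul_of_nonneg_left t.2.2 (Real.sqrt_nonneg _)).trans hn⟩

end Interpolant

section Limit

/-- `α_ℓ(s) = 1 ∧ exp(ℓ² (s - 1) / 2)`. -/
def alphaLim (ℓ s : ℝ) : ℝ := min 1 (Real.exp (ℓ ^ 2 * (s - 1) / 2))

/-- `h_ℓ(s) = ℓ α_ℓ(s)`. -/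
def hLim (ℓ s : ℝ) : ℝ := ℓ * alphaLim ℓ s

/-- `b_ℓ(s) = 2 (1 - s) h_ℓ(s) = 2 ℓ (1 - s) (1 ∧ exp(ℓ² (s - 1) / 2))`. -/
def bLim (ℓ s : ℝ) : ℝ := 2 * (1 - s) * hLim ℓ s

/-- `S ∈ C([0,T]; ℝ)` solves `dS = b_ℓ(S) dt`, `S(0) = S₀`, on `[0, T]` (with one-sided derivatives
at the two endpoints). -/
def IsODESolution (ℓ : ℝ) {T : ℝ} (hT : 0 < T) (S₀ : ℝ) (S : C(Set.Icc (0 : ℝ) T, ℝ)) : Prop :=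
  S ⟨0, Set.left_mem_Icc.2 hT.le⟩ = S₀ ∧
    ∀ t : Set.Icc (0 : ℝ) T,
      HasDerivWithinAt (Set.IccExtend hT.le S) (bLim ℓ (S t)) (Set.Icc 0 T) t

end Limit

section Noise

/-- The sources of noise of the algorithm in dimension `N`: standard Gaussian variables `ξ^k_j`
(`j ≤ N`, `k ≥ 0`) and uniform variables `U^k` on `[0, 1]` (`k ≥ 0`), all of them independent. -/
structure IsNoise {Ω : Type*} [MeasurableSpace Ω] (P : Measure Ω) (N : ℕ)
    (ξ : ℕ → Fin N → Ω → ℝ) (U : ℕ → Ω → ℝ) : Prop where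
  gaussian : ∀ k j, HasLaw (ξ k j) (gaussianReal 0 1) P
  uniform : ∀ k, HasLaw (U k) (volume.restrict (Set.Icc (0 : ℝ) 1)) P
  indep : iIndepFun
    (Sum.elim (fun p : ℕ × Fin N => ξ p.1 p.2) U) P

end Noise

end

end MALA

/-!
The chain is written in the coordinates `z_j = x_j / λ_j` of `X^N`, with `r = N^{-1/4}`, so that
`δ = ℓ r²`, the time step of the interpolant is `r²`, and `S = r⁴ |z|²`. All estimates are in `L¹`
and use only three facts about the potential, with constants that do not depend on `N`
(`IsCoordModel`): its gradient pairs with a vector at the cost of the norm of `H^s`, the trapezoidal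
rule for it has an error quadratic in that norm, and the weights `j^s λ_j` of that norm are square
summable.

*One step.* In the logarithm of the Metropolis-Hastings ratio the terms of order `δ⁻¹` cancel, and so
do the Gaussian part of the target and the symmetric part of the proposal (`acceptProb_embZ`). What
is left is a trapezoidal error plus `-(δ / 4)` times the increment of a quadratic form, whose leading
part is `2δ (N - |z|²)`; since `δ² N = ℓ²`, the logarithm is `ℓ² (S - 1) / 2` up to `O(r)`
(`IsCoordModel.exists_logRatio_bound`). The same expansion shows that an accepted step moves `S` by
`2ℓ r² (1 - S) + O(r³)`. The errors are bounded by `fluct`, a function of the state and the Gaussian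
increment whose mean is controlled by a Lyapunov function (`integral_fluct_le`). The norm of `H^s`
only needs the crude bound `O(N^{1/4})` that comes from adding up `√N` steps. No truncation of `S` is
needed: for `S ≥ 1` the limiting acceptance probability is `1`, and the error in the acceptance
probability times `S - 1` is still bounded by the error in the logarithm
(`abs_one_sub_mul_abs_min_exp_sub_le`).

*Drift and noise.* Hence `S` makes an Euler step `r² b_ℓ(S)`, plus a martingale increment due to the
uniform variable, plus a remainder whose sum over `O(r⁻²)` steps is `O(r)` in `L¹`
(`exists_integral_error_le`). The martingale increments are bounded by `2ℓ r²` and orthogonal. The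
square of a partial sum of bounded increments telescopes, so its maximum is bounded by its time
average (`sq_sum_le_of_abs_le`), and no maximal inequality is used.

*Limit.* The drift `b_ℓ` is globally Lipschitz (`abs_bLim_sub_le`), so the equation has a unique
solution, and a discrete Grönwall estimate (`abs_sub_sub_sum_le`) compares it with the perturbed Euler
scheme, uniformly in time. Markov's inequality then gives convergence in probability.
-/

namespace MALA

noncomputable section

/-! ### The limiting ordinary differential equation -/

theorem alphaLim_nonneg (ℓ r : ℝ) : 0 ≤ alphaLim ℓ r :=
  le_min zero_le_one (Real.exp_nonneg _)

theorem alphaLim_le_one (ℓ r : ℝ) : alphaLim ℓ r ≤ 1 := min_le_left _ _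

theorem alphaLim_of_one_le {ℓ r : ℝ} (hr : 1 ≤ r) : alphaLim ℓ r = 1 :=
  min_eq_left (Real.one_le_exp (by nlinarith [sq_nonneg ℓ]))

theorem alphaLim_of_le_one {ℓ r : ℝ} (hr : r ≤ 1) :
    alphaLim ℓ r = Real.exp (ℓ ^ 2 * (r - 1) / 2) :=
  min_eq_right (Real.exp_le_one_iff.2 (by nlinarith [sq_nonneg ℓ]))

theorem continuous_alphaLim (ℓ : ℝ) : Continuous (alphaLim ℓ) := by
  unfold alphaLim; fun_prop

/-- The map `x ↦ x exp(-c x)` is `1`-Lipschitz on `[0, ∞)`. -/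
theorem abs_mul_exp_sub_le {c x y : ℝ} (hc : 0 ≤ c) (hy : 0 ≤ y) (hxy : y ≤ x) :
    |x * Real.exp (-(c * x)) - y * Real.exp (-(c * y))| ≤ x - y := by
  have hmono : Real.exp (-(c * x)) ≤ Real.exp (-(c * y)) :=
    Real.exp_le_exp.2 (by nlinarith)
  have hy1 : Real.exp (-(c * y)) ≤ 1 := Real.exp_le_one_iff.2 (by nlinarith [mul_nonneg hc hy])
  have hpos := Real.exp_pos (-(c * x))
  have hcy : c * y * Real.exp (-(c * y)) ≤ 1 := by
    rw [Real.exp_neg, ← div_eq_mul_inv, div_le_one (Real.exp_pos _)]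
    linarith [Real.add_one_le_exp (c * y)]
  have hsplit : Real.exp (-(c * x)) = Real.exp (-(c * y)) * Real.exp (-(c * (x - y))) := by
    rw [← Real.exp_add]; ring_nf
  have hlin := Real.add_one_le_exp (-(c * (x - y)))
  have hpos' := Real.exp_pos (-(c * y))
  rw [abs_le]
  constructor
  · have h1 : Real.exp (-(c * y)) - Real.exp (-(c * x))
        ≤ Real.exp (-(c * y)) * (c * (x - y)) := by
      rw [hsplit]; nlinarith
    have h2 := mul_le_mul_of_nonneg_left h1 hy
    have h3 : y * (Real.exp (-(c * y)) * (c * (x - y))) ≤ x - y := by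
      have := mul_le_mul_of_nonneg_right hcy (sub_nonneg.2 hxy)
      linarith [this]
    nlinarith [mul_nonneg (sub_nonneg.2 hxy) hpos.le]
  · have h1 : x * Real.exp (-(c * x)) ≤ x * Real.exp (-(c * y)) :=
      mul_le_mul_of_nonneg_left hmono (hy.trans hxy)
    nlinarith [mul_le_mul_of_nonneg_left hy1 (sub_nonneg.2 hxy)]

theorem bLim_of_one_le {ℓ r : ℝ} (hr : 1 ≤ r) : bLim ℓ r = 2 * ℓ * (1 - r) := by
  rw [bLim, hLim, alphaLim_of_one_le hr]; ring

theorem bLim_of_le_one {ℓ r : ℝ} (hr : r ≤ 1) :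
    bLim ℓ r = 2 * ℓ * ((1 - r) * Real.exp (-(ℓ ^ 2 / 2 * (1 - r)))) := by
  rw [bLim, hLim, alphaLim_of_le_one hr]; ring_nf

/-- The drift of the limiting equation is globally Lipschitz. -/
theorem abs_bLim_sub_le {ℓ : ℝ} (hℓ : 0 ≤ ℓ) (p q : ℝ) :
    |bLim ℓ p - bLim ℓ q| ≤ 2 * ℓ * |p - q| := by
  wlog hpq : p ≤ q generalizing p q
  · rw [abs_sub_comm, abs_sub_comm p q]; exact this q p (le_of_not_ge hpq)
  have hc : 0 ≤ ℓ ^ 2 / 2 := by positivity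
  have habs : |p - q| = q - p := by rw [abs_sub_comm, abs_of_nonneg (sub_nonneg.2 hpq)]
  rw [habs]
  rcases le_total q 1 with hq | hq
  · rw [bLim_of_le_one (hpq.trans hq), bLim_of_le_one hq, ← mul_sub, abs_mul,
      abs_of_nonneg (by positivity : 0 ≤ 2 * ℓ)]
    refine mul_le_mul_of_nonneg_left ?_ (by positivity)
    have := abs_mul_exp_sub_le hc (sub_nonneg.2 hq) (by linarith : 1 - q ≤ 1 - p)
    linarith
  rcases le_total p 1 with hp | hp
  · rw [bLim_of_le_one hp, bLim_of_one_le hq, ← mul_sub, abs_mul,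
      abs_of_nonneg (by positivity : 0 ≤ 2 * ℓ)]
    refine mul_le_mul_of_nonneg_left ?_ (by positivity)
    have h1 : Real.exp (-(ℓ ^ 2 / 2 * (1 - p))) ≤ 1 :=
      Real.exp_le_one_iff.2 (by nlinarith [mul_nonneg hc (sub_nonneg.2 hp)])
    have h0 := Real.exp_pos (-(ℓ ^ 2 / 2 * (1 - p)))
    rw [abs_le]
    constructor <;> nlinarith [mul_nonneg (sub_nonneg.2 hp) h0.le,
      mul_le_mul_of_nonneg_left h1 (sub_nonneg.2 hp)]
  · rw [bLim_of_one_le hp, bLim_of_one_le hq, ← mul_sub, abs_mul,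
      abs_of_nonneg (by positivity : 0 ≤ 2 * ℓ)]
    refine mul_le_mul_of_nonneg_left ?_ (by positivity)
    rw [abs_le]; constructor <;> linarith

theorem lipschitzWith_bLim {ℓ : ℝ} (hℓ : 0 ≤ ℓ) :
    LipschitzWith (Real.toNNReal (2 * ℓ)) (bLim ℓ) :=
  LipschitzWith.of_dist_le_mul fun p q => by
    rw [Real.dist_eq, Real.dist_eq, Real.coe_toNNReal _ (by positivity)]
    exact abs_bLim_sub_le hℓ p q

theorem abs_bLim_min_le {ℓ : ℝ} (hℓ : 0 < ℓ) {A : ℝ} (hA : 1 ≤ A) (x : ℝ) :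
    |bLim ℓ (min x A)| ≤ 2 * ℓ * (2 / ℓ ^ 2 + A) := by
  rcases le_total (min x A) 1 with h | h
  · rw [bLim_of_le_one h, abs_mul, abs_of_nonneg (by positivity : 0 ≤ 2 * ℓ)]
    refine mul_le_mul_of_nonneg_left ?_ (by positivity)
    have h1 : 0 ≤ 1 - min x A := sub_nonneg.2 h
    rw [abs_of_nonneg (by positivity), Real.exp_neg, ← div_eq_mul_inv, div_le_iff₀ (Real.exp_pos _)]
    have h2 := Real.add_one_le_exp (ℓ ^ 2 / 2 * (1 - min x A))
    have h3 : 2 / ℓ ^ 2 * (ℓ ^ 2 / 2 * (1 - min x A) + 1)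
        ≤ 2 / ℓ ^ 2 * Real.exp (ℓ ^ 2 / 2 * (1 - min x A)) :=
      mul_le_mul_of_nonneg_left h2 (by positivity)
    have h4 : 2 / ℓ ^ 2 * (ℓ ^ 2 / 2 * (1 - min x A) + 1) = (1 - min x A) + 2 / ℓ ^ 2 := by
      field_simp
    have h5 : 0 ≤ 2 / ℓ ^ 2 := by positivity
    nlinarith [Real.exp_pos (ℓ ^ 2 / 2 * (1 - min x A))]
  · rw [bLim_of_one_le h, abs_mul, abs_of_nonneg (by positivity : 0 ≤ 2 * ℓ)]
    refine mul_le_mul_of_nonneg_left ?_ (by positivity)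
    have h5 : 0 ≤ 2 / ℓ ^ 2 := by positivity
    have h6 := min_le_right x A
    rw [abs_le]; constructor <;> linarith

/-- The limiting equation has a solution on every bounded interval. The drift is truncated above a
level `A` where it points downwards; a solution of the truncated equation never exceeds `A`. -/
theorem exists_solution {ℓ : ℝ} (hℓ : 0 < ℓ) (S₀ : ℝ) {τ : ℝ} (hτ : 0 ≤ τ) :
    ∃ σ : ℝ → ℝ, σ 0 = S₀ ∧
      ∀ t ∈ Set.Icc 0 τ, HasDerivWithinAt σ (bLim ℓ (σ t)) (Set.Icc 0 τ) t := by
  set A : ℝ := max S₀ 1 with hAdef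
  have hA : 1 ≤ A := le_max_right _ _
  have hB0 : 0 ≤ 2 * ℓ * (2 / ℓ ^ 2 + A) := by positivity
  obtain ⟨σ, hσ0, hσ⟩ := (IsPicardLindelof.of_time_independent (f := fun x => bLim ℓ (min x A))
    (tmin := 0) (tmax := τ) (t₀ := ⟨0, Set.left_mem_Icc.2 hτ⟩) (x₀ := S₀) (r := 0)
    (a := Real.toNNReal (2 * ℓ * (2 / ℓ ^ 2 + A) * τ))
    (L := Real.toNNReal (2 * ℓ * (2 / ℓ ^ 2 + A))) (K := Real.toNNReal (2 * ℓ) * 1)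
    (fun x _ => by
      rw [Real.norm_eq_abs, Real.coe_toNNReal _ hB0]
      exact abs_bLim_min_le hℓ hA x)
    (((lipschitzWith_bLim hℓ.le).comp (LipschitzWith.id.min_const A)).lipschitzOnWith)
    (by
      rw [Real.coe_toNNReal _ hB0, Real.coe_toNNReal _ (mul_nonneg hB0 hτ)]
      simp [hτ])).exists_eq_forall_mem_Icc_hasDerivWithinAt₀
  refine ⟨σ, hσ0, fun t ht => ?_⟩
  have hle : ∀ t ∈ Set.Icc 0 τ, σ t ≤ A := by
    intro t ht
    refine le_of_forall_pos_le_add fun ε hε => ?_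
    have hτ1 : 0 < 1 + τ := by linarith
    -- A strict supersolution that exceeds `A` by at most `ε` on the interval.
    have hfence := image_le_of_deriv_right_lt_deriv_boundary (f := σ)
      (f' := fun t => bLim ℓ (min (σ t) A)) (a := 0) (b := τ)
      (B := fun t => A + ε / (1 + τ) * (1 + t)) (B' := fun _ => ε / (1 + τ))
      (fun x hx => (hσ x hx).continuousWithinAt)
      (fun x hx => (hσ x ⟨hx.1, hx.2.le⟩).mono_of_mem_nhdsWithin
        (mem_of_superset (Icc_mem_nhdsGE hx.2) (Set.Icc_subset_Icc_left hx.1)))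
      (by
        have : 0 ≤ ε / (1 + τ) * (1 + 0) := by positivity
        have h2 : S₀ ≤ A := le_max_left _ _
        have h3 : σ 0 = S₀ := hσ0
        linarith)
      (fun x => by
        simpa using (((hasDerivAt_id x).const_add 1).const_mul (ε / (1 + τ))).const_add A)
      (fun x hx hx' => by
        have hx0 := hx.1
        have : A ≤ σ x := by
          rw [hx']
          have : 0 ≤ ε / (1 + τ) * (1 + x) := by positivity
          linarith
        rw [min_eq_right this, bLim_of_one_le hA]
        have h1 : 0 < ε / (1 + τ) := by positivity
        nlinarith) ht
    refine hfence.trans ?_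
    have : ε / (1 + τ) * (1 + t) ≤ ε := by
      rw [div_mul_eq_mul_div, div_le_iff₀ hτ1]
      nlinarith [ht.2]
    linarith
  have h := hσ t ht
  rwa [min_eq_left (hle t ht)] at h

theorem isODESolution_eq {ℓ : ℝ} (hℓ : 0 < ℓ) {T : ℝ} (hT : 0 < T) {S₀ : ℝ}
    {R S : C(Set.Icc (0 : ℝ) T, ℝ)} (hR : IsODESolution ℓ hT S₀ R)
    (hS : IsODESolution ℓ hT S₀ S) : R = S := by
  have key := ODE_solution_unique_of_mem_Icc_right (v := fun _ => bLim ℓ) (s := fun _ => Set.univ)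
    (f := Set.IccExtend hT.le R) (g := Set.IccExtend hT.le S) (a := 0) (b := T)
    (fun t _ => (lipschitzWith_bLim hℓ.le).lipschitzOnWith)
    (R.continuous.Icc_extend' (h := hT.le)).continuousOn
    (fun t ht => by
      have h := hR.2 ⟨t, ht.1, ht.2.le⟩
      rw [Set.IccExtend_of_mem hT.le R ⟨ht.1, ht.2.le⟩]
      exact h.mono_of_mem_nhdsWithin
        (mem_of_superset (Icc_mem_nhdsGE ht.2) (Set.Icc_subset_Icc_left ht.1)))
    (fun _ _ => Set.mem_univ _)
    (S.continuous.Icc_extend' (h := hT.le)).continuousOn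
    (fun t ht => by
      have h := hS.2 ⟨t, ht.1, ht.2.le⟩
      rw [Set.IccExtend_of_mem hT.le S ⟨ht.1, ht.2.le⟩]
      exact h.mono_of_mem_nhdsWithin
        (mem_of_superset (Icc_mem_nhdsGE ht.2) (Set.Icc_subset_Icc_left ht.1)))
    (fun _ _ => Set.mem_univ _)
    (by
      rw [Set.IccExtend_of_mem hT.le R (Set.left_mem_Icc.2 hT.le),
        Set.IccExtend_of_mem hT.le S (Set.left_mem_Icc.2 hT.le), hR.1, hS.1])
  ext t
  have := key t.2
  rwa [Set.IccExtend_of_mem hT.le R t.2, Set.IccExtend_of_mem hT.le S t.2] at this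

/-- A solution on a longer interval restricts to a solution in the sense of `IsODESolution`. -/
theorem isODESolution_restrict {ℓ T τ S₀ : ℝ} (hT : 0 < T) (hτ : T ≤ τ) {σ : ℝ → ℝ}
    (h0 : σ 0 = S₀)
    (hσ : ∀ t ∈ Set.Icc 0 τ, HasDerivWithinAt σ (bLim ℓ (σ t)) (Set.Icc 0 τ) t)
    (S : C(Set.Icc (0 : ℝ) T, ℝ)) (hS : ∀ t, S t = σ t) : IsODESolution ℓ hT S₀ S := by
  refine ⟨by rw [hS]; exact h0, fun t => ?_⟩
  rw [hS]
  refine ((hσ t ⟨t.2.1, t.2.2.trans hτ⟩).mono (Set.Icc_subset_Icc_right hτ)).congr_of_mem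
    (fun x hx => ?_) t.2
  rw [Set.IccExtend_of_mem hT.le S hx, hS]

/-- The local error of the explicit Euler scheme for the limiting equation is quadratic. -/
theorem exists_euler_error {ℓ τ : ℝ} (hℓ : 0 < ℓ) {σ : ℝ → ℝ}
    (hσ : ∀ t ∈ Set.Icc 0 τ, HasDerivWithinAt σ (bLim ℓ (σ t)) (Set.Icc 0 τ) t) :
    ∃ D, 0 ≤ D ∧ (∀ t ∈ Set.Icc 0 τ, ∀ u ∈ Set.Icc 0 τ, |σ u - σ t| ≤ D * |u - t|) ∧
      ∀ t ∈ Set.Icc 0 τ, ∀ h, 0 ≤ h → t + h ≤ τ →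
        |σ (t + h) - σ t - h * bLim ℓ (σ t)| ≤ 2 * ℓ * D * h ^ 2 := by
  have hcont : ContinuousOn σ (Set.Icc 0 τ) := fun t ht => (hσ t ht).continuousWithinAt
  obtain ⟨D, hD⟩ := isCompact_Icc.exists_bound_of_continuousOn
    ((lipschitzWith_bLim hℓ.le).continuous.comp_continuousOn hcont)
  have hD' : ∀ t ∈ Set.Icc 0 τ, ‖bLim ℓ (σ t)‖ ≤ max D 0 := fun t ht =>
    (hD t ht).trans (le_max_left _ _)
  have hlip : ∀ t ∈ Set.Icc 0 τ, ∀ u ∈ Set.Icc 0 τ, |σ u - σ t| ≤ max D 0 * |u - t| := by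
    intro t ht u hu
    exact (convex_Icc 0 τ).norm_image_sub_le_of_norm_hasDerivWithin_le hσ hD' ht hu
  refine ⟨max D 0, le_max_right _ _, hlip, fun t ht h hh hth => ?_⟩
  have hsub : Set.Icc t (t + h) ⊆ Set.Icc 0 τ := Set.Icc_subset_Icc ht.1 hth
  have hder : ∀ u ∈ Set.Icc t (t + h), HasDerivWithinAt (fun u => σ u - u * bLim ℓ (σ t))
      (bLim ℓ (σ u) - 1 * bLim ℓ (σ t)) (Set.Icc t (t + h)) u := fun u hu =>
    ((hσ u (hsub hu)).mono hsub).sub ((hasDerivWithinAt_id _ _).mul_const _)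
  have hbd : ∀ u ∈ Set.Icc t (t + h),
      ‖bLim ℓ (σ u) - 1 * bLim ℓ (σ t)‖ ≤ 2 * ℓ * max D 0 * h := by
    intro u hu
    rw [one_mul, Real.norm_eq_abs]
    refine (abs_bLim_sub_le hℓ.le _ _).trans ?_
    rw [mul_assoc (2 * ℓ)]
    refine mul_le_mul_of_nonneg_left ((hlip t ht u (hsub hu)).trans ?_) (by positivity)
    refine mul_le_mul_of_nonneg_left ?_ (le_max_right _ _)
    rw [abs_of_nonneg (by linarith [hu.1])]; linarith [hu.2]
  have := (convex_Icc t (t + h)).norm_image_sub_le_of_norm_hasDerivWithin_le hder hbd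
    (Set.left_mem_Icc.2 (by linarith)) (Set.right_mem_Icc.2 (by linarith))
  simp only [Real.norm_eq_abs, add_sub_cancel_left, abs_of_nonneg hh] at this
  calc _ = |σ (t + h) - (t + h) * bLim ℓ (σ t) - (σ t - t * bLim ℓ (σ t))| := by
        congr 1; ring
    _ ≤ 2 * ℓ * max D 0 * h * h := this
    _ = _ := by ring

/-! ### One step of the algorithm in rescaled coordinates -/

section OneStep

variable {N : ℕ}

/-- The squared Euclidean norm of a coordinate vector. -/
def sqNorm (z : Fin N → ℝ) : ℝ := ∑ j, z j ^ 2

/-- The weighted squared norm `∑ (ρ_j z_j)²`; with `ρ_j = j^s λ_j` it is the squared `H^s` norm of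
the point with rescaled coordinates `z_j = x_j / λ_j`. -/
def wSq (ρ z : Fin N → ℝ) : ℝ := ∑ j, (ρ j * z j) ^ 2

/-- The properties of the potential in the coordinates `z_j = x_j / λ_j` of `X^N`, with constants
that do not depend on the dimension: `G` is the potential, `v` its gradient in these coordinates,
and `ρ` are the weights of the norm of `H^s`. -/
structure IsCoordModel (K B : ℝ) (ρ : Fin N → ℝ) (G : (Fin N → ℝ) → ℝ)
    (v : (Fin N → ℝ) → Fin N → ℝ) : Prop where
  measurable_pot : Measurable G
  measurable_grad : Measurable v
  sum_weights : ∑ j, ρ j ^ 2 ≤ B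
  pairing : ∀ z w, |∑ j, w j * v z j| ≤ K * √(wSq ρ w)
  trapezoid : ∀ z y, |G z - G y + 1 / 2 * ∑ j, (y j - z j) * (v z j + v y j)|
    ≤ 2 * K * wSq ρ (y - z)

/-- The proposal in rescaled coordinates. -/
def propZ (δ : ℝ) (v : (Fin N → ℝ) → Fin N → ℝ) (z ξ : Fin N → ℝ) : Fin N → ℝ :=
  fun j => (1 - δ) * z j - δ * v z j + √(2 * δ) * ξ j

/-- The logarithm of the Metropolis-Hastings ratio in rescaled coordinates. The terms of order
`δ⁻¹` and the Gaussian part of the target cancel. -/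
def logRatio (δ : ℝ) (G : (Fin N → ℝ) → ℝ) (v : (Fin N → ℝ) → Fin N → ℝ) (z y : Fin N → ℝ) : ℝ :=
  G z - G y + 1 / 2 * ∑ j, (y j - z j) * (v z j + v y j)
    - δ / 4 * (sqNorm (y + v y) - sqNorm (z + v z))

/-- The Lyapunov function `1 + N⁻¹ |z|² + N^{-1/2} ‖x‖_s²`, written with `r = N^{-1/4}`. -/
def lyap (r : ℝ) (ρ z : Fin N → ℝ) : ℝ := 1 + r ^ 4 * sqNorm z + r ^ 2 * wSq ρ z

/-- The quantity that bounds all errors of one step: the Lyapunov function of the current state and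
the fluctuations of the Gaussian increment, each scaled to be of order one. -/
def fluct (r : ℝ) (ρ z ξ : Fin N → ℝ) : ℝ :=
  lyap r ρ z + r ^ 4 * (∑ j, z j * ξ j) ^ 2 + r ^ 4 * (sqNorm ξ - N) ^ 2 + wSq ρ ξ

theorem sqNorm_nonneg (z : Fin N → ℝ) : 0 ≤ sqNorm z := Finset.sum_nonneg fun _ _ => sq_nonneg _

theorem wSq_nonneg (ρ z : Fin N → ℝ) : 0 ≤ wSq ρ z := Finset.sum_nonneg fun _ _ => sq_nonneg _

theorem one_le_lyap {r : ℝ} (ρ z : Fin N → ℝ) : 1 ≤ lyap r ρ z := by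
  have h1 : 0 ≤ r ^ 4 * sqNorm z := mul_nonneg (by positivity) (sqNorm_nonneg z)
  have h2 : 0 ≤ r ^ 2 * wSq ρ z := mul_nonneg (by positivity) (wSq_nonneg ρ z)
  unfold lyap; linarith

theorem lyap_le_fluct {r : ℝ} (ρ z ξ : Fin N → ℝ) : lyap r ρ z ≤ fluct r ρ z ξ := by
  have h1 : 0 ≤ r ^ 4 * (∑ j, z j * ξ j) ^ 2 := by positivity
  have h2 : 0 ≤ r ^ 4 * (sqNorm ξ - N) ^ 2 := by positivity
  have h3 := wSq_nonneg ρ ξ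
  unfold fluct; linarith

theorem one_le_fluct {r : ℝ} (ρ z ξ : Fin N → ℝ) : 1 ≤ fluct r ρ z ξ :=
  (one_le_lyap ρ z).trans (lyap_le_fluct ρ z ξ)

theorem sqNorm_propZ {δ : ℝ} (hδ : 0 ≤ δ) (v : (Fin N → ℝ) → Fin N → ℝ) (z ξ : Fin N → ℝ) :
    sqNorm (propZ δ v z ξ) = (1 - δ) ^ 2 * sqNorm z + δ ^ 2 * sqNorm (v z) + 2 * δ * sqNorm ξ
      - 2 * δ * (1 - δ) * ∑ j, z j * v z j + 2 * (1 - δ) * √(2 * δ) * ∑ j, z j * ξ j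
      - 2 * δ * √(2 * δ) * ∑ j, ξ j * v z j := by
  have hs : √(2 * δ) ^ 2 = 2 * δ := Real.sq_sqrt (by positivity)
  unfold sqNorm propZ
  simp only [Finset.mul_sum, ← Finset.sum_add_distrib, ← Finset.sum_sub_distrib]
  refine Finset.sum_congr rfl fun j _ => ?_
  linear_combination (ξ j ^ 2) * hs

theorem wSq_add_le {η : ℝ} (hη : 0 < η) (ρ z w : Fin N → ℝ) :
    wSq ρ (z + w) ≤ (1 + η) * wSq ρ z + (1 + 1 / η) * wSq ρ w := by
  unfold wSq
  rw [Finset.mul_sum, Finset.mul_sum, ← Finset.sum_add_distrib]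
  refine Finset.sum_le_sum fun j _ => ?_
  have key : 0 ≤ (η * (ρ j * z j) - ρ j * w j) ^ 2 / η := by positivity
  have h2 : (η * (ρ j * z j) - ρ j * w j) ^ 2 / η
      = η * (ρ j * z j) ^ 2 - 2 * (ρ j * z j) * (ρ j * w j) + 1 / η * (ρ j * w j) ^ 2 := by
    field_simp; ring
  simp only [Pi.add_apply]
  nlinarith

theorem wSq_smul (ρ z : Fin N → ℝ) (c : ℝ) : wSq ρ (c • z) = c ^ 2 * wSq ρ z := by
  unfold wSq
  rw [Finset.mul_sum]
  exact Finset.sum_congr rfl fun j _ => by simp only [Pi.smul_apply, smul_eq_mul]; ring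

theorem propZ_eq (δ : ℝ) (v : (Fin N → ℝ) → Fin N → ℝ) (z ξ : Fin N → ℝ) :
    propZ δ v z ξ = (1 - δ) • z + ((-δ) • v z + √(2 * δ) • ξ) := by
  ext j; simp [propZ]; ring

theorem two_mul_sqrt_le {r W : ℝ} (hW : 0 ≤ W) : 2 * (r * √W) ≤ 1 + r ^ 2 * W := by
  nlinarith [sq_nonneg (r * √W - 1), Real.sq_sqrt hW]

namespace IsCoordModel

variable {K B : ℝ} {ρ : Fin N → ℝ} {G : (Fin N → ℝ) → ℝ} {v : (Fin N → ℝ) → Fin N → ℝ}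

theorem wSq_le (h : IsCoordModel K B ρ G v) (w : Fin N → ℝ) : wSq ρ w ≤ B * sqNorm w := by
  unfold wSq sqNorm
  rw [Finset.mul_sum]
  refine Finset.sum_le_sum fun j _ => ?_
  rw [mul_pow]
  refine mul_le_mul_of_nonneg_right ?_ (sq_nonneg _)
  exact (Finset.single_le_sum (f := fun j => ρ j ^ 2) (fun i _ => sq_nonneg _)
    (Finset.mem_univ j)).trans h.sum_weights

theorem B_nonneg (h : IsCoordModel K B ρ G v) : 0 ≤ B :=
  (Finset.sum_nonneg fun _ _ => sq_nonneg _).trans h.sum_weights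

theorem sqNorm_grad_le (h : IsCoordModel K B ρ G v) (z : Fin N → ℝ) :
    sqNorm (v z) ≤ K ^ 2 * B := by
  have h1 : sqNorm (v z) ≤ K * √(wSq ρ (v z)) := by
    refine le_trans (le_of_eq ?_) ((le_abs_self _).trans (h.pairing z (v z)))
    exact Finset.sum_congr rfl fun j _ => pow_two _
  have h0 := sqNorm_nonneg (v z)
  have h2 : sqNorm (v z) ^ 2 ≤ K ^ 2 * B * sqNorm (v z) := by
    calc sqNorm (v z) ^ 2 ≤ (K * √(wSq ρ (v z))) ^ 2 := by gcongr
      _ = K ^ 2 * wSq ρ (v z) := by rw [mul_pow, Real.sq_sqrt (wSq_nonneg _ _)]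
      _ ≤ K ^ 2 * (B * sqNorm (v z)) := by gcongr; exact h.wSq_le _
      _ = _ := by ring
  rcases h0.eq_or_lt with h3 | h3
  · rw [← h3]; have := h.B_nonneg; positivity
  · nlinarith

/-- The increment of `|z|²` is `2δ (N - |z|²)` up to an error of order `N^{1/4}`. -/
theorem abs_sqNorm_propZ_sub_le (h : IsCoordModel K B ρ G v) (hK : 0 ≤ K) {ℓ r : ℝ} (hℓ : 0 < ℓ)
    (hr : 0 < r) (hr1 : r ≤ 1) (hδ : ℓ * r ^ 2 ≤ 1) (z ξ : Fin N → ℝ) :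
    r * |sqNorm (propZ (ℓ * r ^ 2) v z ξ) - sqNorm z - 2 * (ℓ * r ^ 2) * (N - sqNorm z)|
      ≤ (ℓ + ℓ ^ 2 + K ^ 2 * B + ℓ * K + √(2 * ℓ) + 2 * K) * fluct r ρ z ξ := by
  set δ := ℓ * r ^ 2 with hδdef
  have hδ0 : 0 < δ := by positivity
  have hB := h.B_nonneg
  set Φ := fluct r ρ z ξ with hΦ
  have hA := sqNorm_nonneg z
  have hW := wSq_nonneg ρ z
  have hZ := wSq_nonneg ρ ξ
  have hrA : 0 ≤ r ^ 4 * sqNorm z := by positivity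
  have hrW : 0 ≤ r ^ 2 * wSq ρ z := by positivity
  have hrY : 0 ≤ r ^ 4 * (∑ j, z j * ξ j) ^ 2 := by positivity
  have hrX : 0 ≤ r ^ 4 * (sqNorm ξ - N) ^ 2 := by positivity
  have hΦdef : Φ = 1 + r ^ 4 * sqNorm z + r ^ 2 * wSq ρ z + r ^ 4 * (∑ j, z j * ξ j) ^ 2
    + r ^ 4 * (sqNorm ξ - N) ^ 2 + wSq ρ ξ := rfl
  have hΦ1 : 1 ≤ Φ := one_le_fluct ρ z ξ
  have hv := h.sqNorm_grad_le z
  have hv0 := sqNorm_nonneg (v z)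
  have hzv := h.pairing z z
  have hξv := h.pairing z ξ
  have hsq : √(2 * δ) = √(2 * ℓ) * r := by
    rw [hδdef, ← mul_assoc, Real.sqrt_mul (by positivity), Real.sqrt_sq hr.le]
  have hsq2 : √(2 * δ) ≤ 2 := by
    rw [Real.sqrt_le_left (by norm_num)]; linarith
  have e1 : |2 * δ * (sqNorm ξ - N)| ≤ ℓ * Φ := by
    rw [abs_mul, abs_of_pos (by positivity : 0 < 2 * δ)]
    have : 2 * (r ^ 2 * |sqNorm ξ - N|) ≤ 1 + r ^ 4 * (sqNorm ξ - N) ^ 2 := by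
      rw [← sq_abs (sqNorm ξ - N)]
      nlinarith [sq_nonneg (r ^ 2 * |sqNorm ξ - N| - 1)]
    calc 2 * δ * |sqNorm ξ - N| = ℓ * (2 * (r ^ 2 * |sqNorm ξ - N|)) := by rw [hδdef]; ring
      _ ≤ ℓ * Φ := by gcongr; linarith
  have e2 : |δ ^ 2 * sqNorm z| ≤ ℓ ^ 2 * Φ := by
    rw [abs_of_nonneg (by positivity)]
    calc δ ^ 2 * sqNorm z = ℓ ^ 2 * (r ^ 4 * sqNorm z) := by rw [hδdef]; ring
      _ ≤ ℓ ^ 2 * Φ := by gcongr; linarith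
  have e3 : |δ ^ 2 * sqNorm (v z)| ≤ K ^ 2 * B * Φ := by
    rw [abs_of_nonneg (by positivity)]
    calc δ ^ 2 * sqNorm (v z) ≤ 1 * (K ^ 2 * B) := by
          gcongr; exact pow_le_one₀ hδ0.le hδ
      _ ≤ K ^ 2 * B * Φ := by nlinarith [mul_nonneg (sq_nonneg K) hB]
  have e4 : |2 * δ * (1 - δ) * ∑ j, z j * v z j| ≤ ℓ * K * Φ := by
    rw [abs_mul, abs_of_nonneg (mul_nonneg (by positivity) (sub_nonneg.2 hδ))]
    have h2 : 2 * (r * √(wSq ρ z)) ≤ Φ := (two_mul_sqrt_le hW).trans (by linarith)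
    calc 2 * δ * (1 - δ) * |∑ j, z j * v z j| ≤ 2 * δ * 1 * (K * √(wSq ρ z)) := by
          gcongr; linarith
      _ = ℓ * K * (r * (2 * (r * √(wSq ρ z)))) := by rw [hδdef]; ring
      _ ≤ ℓ * K * (1 * Φ) := by gcongr
      _ = _ := by ring
  have e5 : r * |2 * (1 - δ) * √(2 * δ) * ∑ j, z j * ξ j| ≤ √(2 * ℓ) * Φ := by
    rw [abs_mul, abs_of_nonneg
      (mul_nonneg (mul_nonneg zero_le_two (sub_nonneg.2 hδ)) (Real.sqrt_nonneg _)), hsq]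
    have : 2 * (r ^ 2 * |∑ j, z j * ξ j|) ≤ 1 + r ^ 4 * (∑ j, z j * ξ j) ^ 2 := by
      rw [← sq_abs (∑ j, z j * ξ j)]
      nlinarith [sq_nonneg (r ^ 2 * |∑ j, z j * ξ j| - 1)]
    calc r * (2 * (1 - δ) * (√(2 * ℓ) * r) * |∑ j, z j * ξ j|)
        ≤ r * (2 * 1 * (√(2 * ℓ) * r) * |∑ j, z j * ξ j|) := by gcongr; linarith
      _ = √(2 * ℓ) * (2 * (r ^ 2 * |∑ j, z j * ξ j|)) := by ring
      _ ≤ √(2 * ℓ) * Φ := by gcongr; linarith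
  have e6 : |2 * δ * √(2 * δ) * ∑ j, ξ j * v z j| ≤ 2 * K * Φ := by
    rw [abs_mul, abs_of_nonneg (by positivity)]
    have h2 : 2 * (1 * √(wSq ρ ξ)) ≤ Φ := (two_mul_sqrt_le hZ).trans (by linarith)
    calc 2 * δ * √(2 * δ) * |∑ j, ξ j * v z j| ≤ 2 * 1 * 2 * (K * √(wSq ρ ξ)) := by gcongr
      _ = 2 * K * (2 * (1 * √(wSq ρ ξ))) := by ring
      _ ≤ 2 * K * Φ := by gcongr
  rw [sqNorm_propZ hδ0.le]
  have habs : ∀ a b c d e f : ℝ, r * |a + b + c - d + e - f|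
      ≤ |a| + |b| + |c| + |d| + r * |e| + |f| := by
    intro a b c d e f
    have h1 : |a + b + c - d + e - f| ≤ |a| + |b| + |c| + |d| + |e| + |f| := by
      rw [sub_eq_add_neg, sub_eq_add_neg]
      refine (abs_add_le _ _).trans ?_
      rw [abs_neg]
      gcongr
      refine (abs_add_le _ _).trans ?_
      gcongr
      refine (abs_add_le _ _).trans ?_
      rw [abs_neg]
      gcongr
      exact abs_add_three _ _ _
    have h2 : 0 ≤ |a| + |b| + |c| + |d| + |f| := by positivity
    calc _ ≤ r * (|a| + |b| + |c| + |d| + |e| + |f|) := by gcongr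
      _ = r * (|a| + |b| + |c| + |d| + |f|) + r * |e| := by ring
      _ ≤ 1 * (|a| + |b| + |c| + |d| + |f|) + r * |e| := by gcongr
      _ = _ := by ring
  have := habs (2 * δ * (sqNorm ξ - N)) (δ ^ 2 * sqNorm z) (δ ^ 2 * sqNorm (v z))
    (2 * δ * (1 - δ) * ∑ j, z j * v z j) (2 * (1 - δ) * √(2 * δ) * ∑ j, z j * ξ j)
    (2 * δ * √(2 * δ) * ∑ j, ξ j * v z j)
  have heq : (1 - δ) ^ 2 * sqNorm z + δ ^ 2 * sqNorm (v z) + 2 * δ * sqNorm ξ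
      - 2 * δ * (1 - δ) * ∑ j, z j * v z j + 2 * (1 - δ) * √(2 * δ) * ∑ j, z j * ξ j
      - 2 * δ * √(2 * δ) * ∑ j, ξ j * v z j - sqNorm z - 2 * δ * (N - sqNorm z)
    = 2 * δ * (sqNorm ξ - N) + δ ^ 2 * sqNorm z + δ ^ 2 * sqNorm (v z)
      - 2 * δ * (1 - δ) * ∑ j, z j * v z j + 2 * (1 - δ) * √(2 * δ) * ∑ j, z j * ξ j
      - 2 * δ * √(2 * δ) * ∑ j, ξ j * v z j := by ring
  rw [heq]
  linarith

/-- The squared `H^s` norm grows by at most a constant multiple of `fluct` in one step. Since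
`r ^ 2 * wSq ρ z` is one of the terms of `fluct`, bounded moments of `fluct` propagate over the
`O(√N)` steps of the time horizon. -/
theorem wSq_propZ_le (h : IsCoordModel K B ρ G v) {ℓ r : ℝ} (hℓ : 0 < ℓ)
    (hr : 0 < r) (hδ : ℓ * r ^ 2 ≤ 1) (z ξ : Fin N → ℝ) :
    wSq ρ (propZ (ℓ * r ^ 2) v z ξ)
      ≤ wSq ρ z + (ℓ + 4 * (B * (K ^ 2 * B)) + 8) * fluct r ρ z ξ := by
  set δ := ℓ * r ^ 2 with hδdef
  have hδ0 : 0 < δ := by positivity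
  have hB := h.B_nonneg
  have hW := wSq_nonneg ρ z
  have hZ := wSq_nonneg ρ ξ
  have hrA : 0 ≤ r ^ 4 * sqNorm z := mul_nonneg (by positivity) (sqNorm_nonneg z)
  have hrW : 0 ≤ r ^ 2 * wSq ρ z := by positivity
  have hrY : 0 ≤ r ^ 4 * (∑ j, z j * ξ j) ^ 2 := by positivity
  have hrX : 0 ≤ r ^ 4 * (sqNorm ξ - N) ^ 2 := by positivity
  have hΦdef : fluct r ρ z ξ = 1 + r ^ 4 * sqNorm z + r ^ 2 * wSq ρ z
    + r ^ 4 * (∑ j, z j * ξ j) ^ 2 + r ^ 4 * (sqNorm ξ - N) ^ 2 + wSq ρ ξ := rfl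
  set Φ := fluct r ρ z ξ
  have hV : wSq ρ (v z) ≤ B * (K ^ 2 * B) :=
    (h.wSq_le _).trans (mul_le_mul_of_nonneg_left (h.sqNorm_grad_le z) hB)
  have hsq : √(2 * δ) ^ 2 = 2 * δ := Real.sq_sqrt (by positivity)
  rw [propZ_eq]
  have h1 := wSq_add_le hδ0 ρ ((1 - δ) • z) ((-δ) • v z + √(2 * δ) • ξ)
  have h2 := wSq_add_le one_pos ρ ((-δ) • v z) (√(2 * δ) • ξ)
  rw [wSq_smul, wSq_smul, hsq] at h2
  rw [wSq_smul] at h1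
  have h3 : (1 - δ) ^ 2 ≤ 1 := by nlinarith
  have hinv : (1 + 1 / δ) * δ ≤ 2 := by
    rw [add_mul, one_div_mul_cancel hδ0.ne']; linarith
  have h4 : (1 + 1 / δ) * wSq ρ ((-δ) • v z + √(2 * δ) • ξ)
      ≤ 2 * (2 * (B * (K ^ 2 * B)) + 4 * wSq ρ ξ) := by
    calc (1 + 1 / δ) * wSq ρ ((-δ) • v z + √(2 * δ) • ξ)
        ≤ (1 + 1 / δ) * ((1 + 1) * ((-δ) ^ 2 * wSq ρ (v z))
          + (1 + 1 / 1) * (2 * δ * wSq ρ ξ)) := by gcongr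
      _ = ((1 + 1 / δ) * δ) * (2 * (δ * wSq ρ (v z)) + 4 * wSq ρ ξ) := by ring
      _ ≤ 2 * (2 * (1 * (B * (K ^ 2 * B))) + 4 * wSq ρ ξ) := by
          have := wSq_nonneg ρ (v z)
          gcongr
      _ = _ := by ring
  have h5 : (1 + δ) * ((1 - δ) ^ 2 * wSq ρ z) ≤ wSq ρ z + ℓ * Φ := by
    calc (1 + δ) * ((1 - δ) ^ 2 * wSq ρ z) ≤ (1 + δ) * (1 * wSq ρ z) := by gcongr
      _ = wSq ρ z + ℓ * (r ^ 2 * wSq ρ z) := by rw [hδdef]; ring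
      _ ≤ wSq ρ z + ℓ * Φ := by gcongr; linarith
  have h6 : 4 * (B * (K ^ 2 * B)) * 1 ≤ 4 * (B * (K ^ 2 * B)) * Φ := by
    gcongr; linarith
  linarith

theorem wSq_propZ_sub_le (h : IsCoordModel K B ρ G v) {ℓ r : ℝ} (hℓ : 0 < ℓ)
    (hr : 0 < r) (hr1 : r ≤ 1) (z ξ : Fin N → ℝ) :
    wSq ρ (propZ (ℓ * r ^ 2) v z ξ - z)
      ≤ r * ((2 * ℓ ^ 2 + 4 * (ℓ ^ 2 * (B * (K ^ 2 * B))) + 8 * ℓ) * fluct r ρ z ξ) := by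
  set δ := ℓ * r ^ 2 with hδdef
  have hδ0 : 0 < δ := by positivity
  have hB := h.B_nonneg
  have hW := wSq_nonneg ρ z
  have hZ := wSq_nonneg ρ ξ
  have hrA : 0 ≤ r ^ 4 * sqNorm z := mul_nonneg (by positivity) (sqNorm_nonneg z)
  have hrW : 0 ≤ r ^ 2 * wSq ρ z := by positivity
  have hrY : 0 ≤ r ^ 4 * (∑ j, z j * ξ j) ^ 2 := by positivity
  have hrX : 0 ≤ r ^ 4 * (sqNorm ξ - N) ^ 2 := by positivity
  have hΦdef : fluct r ρ z ξ = 1 + r ^ 4 * sqNorm z + r ^ 2 * wSq ρ z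
    + r ^ 4 * (∑ j, z j * ξ j) ^ 2 + r ^ 4 * (sqNorm ξ - N) ^ 2 + wSq ρ ξ := rfl
  set Φ := fluct r ρ z ξ
  have hV : wSq ρ (v z) ≤ B * (K ^ 2 * B) :=
    (h.wSq_le _).trans (mul_le_mul_of_nonneg_left (h.sqNorm_grad_le z) hB)
  have hsq : √(2 * δ) ^ 2 = 2 * δ := Real.sq_sqrt (by positivity)
  have heq : propZ δ v z ξ - z = (-δ) • z + ((-δ) • v z + √(2 * δ) • ξ) := by
    ext j; simp [propZ]; ring
  rw [heq]
  have h1 := wSq_add_le one_pos ρ ((-δ) • z) ((-δ) • v z + √(2 * δ) • ξ)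
  have h2 := wSq_add_le one_pos ρ ((-δ) • v z) (√(2 * δ) • ξ)
  rw [wSq_smul, wSq_smul, hsq] at h2
  rw [wSq_smul] at h1
  have hr2 : r ^ 2 ≤ r := by nlinarith
  have e1 : (-δ) ^ 2 * wSq ρ z ≤ r * (ℓ ^ 2 * Φ) := by
    calc (-δ) ^ 2 * wSq ρ z = r ^ 2 * (ℓ ^ 2 * (r ^ 2 * wSq ρ z)) := by rw [hδdef]; ring
      _ ≤ r * (ℓ ^ 2 * Φ) := by gcongr; linarith
  have e2 : (-δ) ^ 2 * wSq ρ (v z) ≤ r * (ℓ ^ 2 * (B * (K ^ 2 * B)) * Φ) := by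
    calc (-δ) ^ 2 * wSq ρ (v z) ≤ (-δ) ^ 2 * (B * (K ^ 2 * B)) := by gcongr
      _ = r ^ 2 * (r ^ 2 * (ℓ ^ 2 * (B * (K ^ 2 * B)))) := by rw [hδdef]; ring
      _ ≤ r * (1 * (ℓ ^ 2 * (B * (K ^ 2 * B)))) := by
          gcongr; exact hr2.trans hr1
      _ ≤ r * (ℓ ^ 2 * (B * (K ^ 2 * B)) * Φ) := by
          rw [one_mul]
          refine mul_le_mul_of_nonneg_left (le_mul_of_one_le_right (by positivity) ?_) hr.le
          linarith
  have e3 : 2 * δ * wSq ρ ξ ≤ r * (2 * ℓ * Φ) := by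
    calc 2 * δ * wSq ρ ξ = r ^ 2 * (2 * ℓ * wSq ρ ξ) := by rw [hδdef]; ring
      _ ≤ r * (2 * ℓ * Φ) := by gcongr; linarith
  linarith

/-- The logarithm of the Metropolis-Hastings ratio is `ℓ² (S - 1) / 2`, where `S = |z|² / N`, up to
an error of order `N^{-1/4}`. -/
theorem exists_logRatio_bound {ℓ K B : ℝ} (hℓ : 0 < ℓ) (hK : 0 ≤ K) (hB : 0 ≤ B) :
    ∃ C, 0 ≤ C ∧ ∀ {N : ℕ} {ρ : Fin N → ℝ} {G : (Fin N → ℝ) → ℝ} {v : (Fin N → ℝ) → Fin N → ℝ},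
      IsCoordModel K B ρ G v → ∀ r : ℝ, 0 < r → r ≤ 1 → r ^ 4 * N = 1 → ℓ * r ^ 2 ≤ 1 → ∀ z ξ,
      |logRatio (ℓ * r ^ 2) G v z (propZ (ℓ * r ^ 2) v z ξ) - ℓ ^ 2 * (r ^ 4 * sqNorm z - 1) / 2|
        ≤ r * (C * fluct r ρ z ξ) := by
  set C₁ := ℓ + ℓ ^ 2 + K ^ 2 * B + ℓ * K + √(2 * ℓ) + 2 * K with hC₁
  set C₂ := 2 * ℓ ^ 2 + 4 * (ℓ ^ 2 * (B * (K ^ 2 * B))) + 8 * ℓ with hC₂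
  set C₃ := ℓ + 4 * (B * (K ^ 2 * B)) + 8 with hC₃
  have hC₁0 : 0 ≤ C₁ := by positivity
  have hC₂0 : 0 ≤ C₂ := by positivity
  have hC₃0 : 0 ≤ C₃ := by positivity
  refine ⟨2 * K * C₂ + ℓ * C₁ + ℓ * K * (1 + C₃) + ℓ * K + ℓ * (K ^ 2 * B), by positivity, ?_⟩
  intro N ρ G v h r hr hr1 hN hδ z ξ
  have hE := h.abs_sqNorm_propZ_sub_le hK hℓ hr hr1 hδ z ξ
  have hD := h.wSq_propZ_sub_le hℓ hr hr1 z ξ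
  have hWy := h.wSq_propZ_le hℓ hr hδ z ξ
  set δ := ℓ * r ^ 2 with hδdef
  set y := propZ δ v z ξ with hy
  have hδ0 : 0 < δ := by positivity
  have hW := wSq_nonneg ρ z
  have hZ := wSq_nonneg ρ ξ
  have hrA : 0 ≤ r ^ 4 * sqNorm z := mul_nonneg (by positivity) (sqNorm_nonneg z)
  have hrW : 0 ≤ r ^ 2 * wSq ρ z := by positivity
  have hrY : 0 ≤ r ^ 4 * (∑ j, z j * ξ j) ^ 2 := by positivity
  have hrX : 0 ≤ r ^ 4 * (sqNorm ξ - N) ^ 2 := by positivity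
  have hΦdef : fluct r ρ z ξ = 1 + r ^ 4 * sqNorm z + r ^ 2 * wSq ρ z
    + r ^ 4 * (∑ j, z j * ξ j) ^ 2 + r ^ 4 * (sqNorm ξ - N) ^ 2 + wSq ρ ξ := rfl
  set Φ := fluct r ρ z ξ
  have hΦ1 : 1 ≤ Φ := by linarith
  have htrap := h.trapezoid z y
  have hexp : ∀ w : Fin N → ℝ, sqNorm (w + v w) = sqNorm w + 2 * ∑ j, w j * v w j
      + sqNorm (v w) := by
    intro w
    unfold sqNorm
    rw [Finset.mul_sum, ← Finset.sum_add_distrib, ← Finset.sum_add_distrib]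
    exact Finset.sum_congr rfl fun j _ => by simp only [Pi.add_apply]; ring
  set E := sqNorm y - sqNorm z - 2 * δ * (N - sqNorm z) with hEdef
  set t := G z - G y + 1 / 2 * ∑ j, (y j - z j) * (v z j + v y j) with ht
  -- The contribution of `2δ (N - |z|²)` gives the limit, because `δ² N = ℓ²`.
  have hδN : δ ^ 2 * N = ℓ ^ 2 := by
    calc δ ^ 2 * N = ℓ ^ 2 * (r ^ 4 * N) := by rw [hδdef]; ring
      _ = ℓ ^ 2 := by rw [hN, mul_one]
  have hδA : δ ^ 2 * sqNorm z = ℓ ^ 2 * (r ^ 4 * sqNorm z) := by rw [hδdef]; ring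
  have heq : logRatio δ G v z y - ℓ ^ 2 * (r ^ 4 * sqNorm z - 1) / 2
      = t - δ / 4 * E - δ / 2 * (∑ j, y j * v y j) + δ / 2 * (∑ j, z j * v z j)
        - δ / 4 * (sqNorm (v y) - sqNorm (v z)) := by
    rw [logRatio, hexp, hexp, hEdef]
    linear_combination (1 / 2) * hδA - (1 / 2) * hδN
  rw [heq]
  have e1 : |t| ≤ r * (2 * K * C₂ * Φ) := by
    calc |t| ≤ 2 * K * wSq ρ (y - z) := htrap
      _ ≤ 2 * K * (r * (C₂ * Φ)) := by gcongr
      _ = _ := by ring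
  have e2 : |δ / 4 * E| ≤ r * (ℓ * C₁ * Φ) := by
    rw [abs_mul, abs_of_pos (by positivity)]
    calc δ / 4 * |E| = r * ℓ / 4 * (r * |E|) := by rw [hδdef]; ring
      _ ≤ r * ℓ / 4 * (C₁ * Φ) := by gcongr
      _ = r * (ℓ * C₁ * Φ) / 4 := by ring
      _ ≤ _ := div_le_self (by positivity) (by norm_num)
  have hpair : ∀ w, ∀ c : ℝ, r ^ 2 * wSq ρ w ≤ c → |δ / 2 * ∑ j, w j * v w j|
      ≤ r * (ℓ * K * (1 + c)) := by
    intro w c hc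
    have h1 := h.pairing w w
    have h2 : 2 * (r * √(wSq ρ w)) ≤ 1 + c :=
      (two_mul_sqrt_le (wSq_nonneg ρ w)).trans (by linarith)
    rw [abs_mul, abs_of_pos (by positivity)]
    calc δ / 2 * |∑ j, w j * v w j| ≤ δ / 2 * (K * √(wSq ρ w)) := by gcongr
      _ = r * (ℓ * K * (2 * (r * √(wSq ρ w)))) / 4 := by rw [hδdef]; ring
      _ ≤ r * (ℓ * K * (1 + c)) / 4 := by gcongr
      _ ≤ _ := div_le_self (by
          have : 0 ≤ 1 + c := by
            have : 0 ≤ r * √(wSq ρ w) := by positivity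
            linarith
          positivity) (by norm_num)
  have hr2 : r ^ 2 ≤ 1 := pow_le_one₀ hr.le hr1
  have e3 : |δ / 2 * ∑ j, y j * v y j| ≤ r * (ℓ * K * (1 + C₃) * Φ) := by
    refine (hpair y (r ^ 2 * wSq ρ z + C₃ * Φ) ?_).trans ?_
    · calc r ^ 2 * wSq ρ y ≤ r ^ 2 * (wSq ρ z + C₃ * Φ) := by gcongr
        _ = r ^ 2 * wSq ρ z + r ^ 2 * (C₃ * Φ) := by ring
        _ ≤ r ^ 2 * wSq ρ z + 1 * (C₃ * Φ) := by gcongr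
        _ = _ := by ring
    · rw [mul_assoc (ℓ * K)]
      gcongr
      linarith
  have e4 : |δ / 2 * ∑ j, z j * v z j| ≤ r * (ℓ * K * Φ) := by
    refine (hpair z (r ^ 2 * wSq ρ z) le_rfl).trans ?_
    gcongr
    linarith
  have e5 : |δ / 4 * (sqNorm (v y) - sqNorm (v z))| ≤ r * (ℓ * (K ^ 2 * B) * Φ) := by
    rw [abs_mul, abs_of_pos (by positivity)]
    have h1 := h.sqNorm_grad_le y
    have h2 := h.sqNorm_grad_le z
    have h3 := sqNorm_nonneg (v y)
    have h4 := sqNorm_nonneg (v z)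
    have h5 : |sqNorm (v y) - sqNorm (v z)| ≤ K ^ 2 * B := by
      rw [abs_le]; constructor <;> linarith
    calc δ / 4 * |sqNorm (v y) - sqNorm (v z)| ≤ δ / 4 * (K ^ 2 * B) := by gcongr
      _ ≤ δ * (K ^ 2 * B) := by gcongr; linarith
      _ = r * (r * (ℓ * (K ^ 2 * B))) := by rw [hδdef]; ring
      _ ≤ r * (1 * (ℓ * (K ^ 2 * B))) := by gcongr
      _ ≤ r * (ℓ * (K ^ 2 * B) * Φ) := by
          rw [one_mul]
          exact mul_le_mul_of_nonneg_left (le_mul_of_one_le_right (by positivity) hΦ1) hr.le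
  have habs : ∀ a b c d e : ℝ, |a - b - c + d - e| ≤ |a| + |b| + |c| + |d| + |e| := by
    intro a b c d e
    rw [sub_eq_add_neg, sub_eq_add_neg, sub_eq_add_neg]
    refine (abs_add_le _ _).trans ?_
    rw [abs_neg]
    gcongr
    refine (abs_add_le _ _).trans ?_
    gcongr
    refine (abs_add_three _ _ _).trans ?_
    rw [abs_neg, abs_neg]
  refine (habs _ _ _ _ _).trans ?_
  linarith

end IsCoordModel

/-- The error in the acceptance probability, weighted by the distance `|1 - S|` from stationarity,
is controlled by the error in the logarithm of the ratio. For large `S` the limiting probability is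
`1`, and the other one differs from `1` only if the logarithms differ by at least
`ℓ² (S - 1) / 2`. -/
theorem abs_one_sub_mul_abs_min_exp_sub_le {ℓ : ℝ} (hℓ : 0 < ℓ) {S : ℝ} (hS : 0 ≤ S) (q : ℝ) :
    |1 - S| * |min 1 (Real.exp q) - alphaLim ℓ S|
      ≤ (1 + 2 / ℓ ^ 2) * |q - ℓ ^ 2 * (S - 1) / 2| := by
  set p := ℓ ^ 2 * (S - 1) / 2 with hp
  have hR := abs_nonneg (q - p)
  have h2ℓ : 0 < 2 / ℓ ^ 2 := by positivity
  rcases le_total S 1 with h | h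
  · have h1 : |1 - S| ≤ 1 := by rw [abs_le]; constructor <;> linarith
    have hmin : ∀ x : ℝ, min 1 (Real.exp x) = Real.exp (min 0 x) := by
      intro x
      rcases le_total 0 x with hx | hx
      · rw [min_eq_left hx, Real.exp_zero, min_eq_left (Real.one_le_exp hx)]
      · rw [min_eq_right hx, min_eq_right (Real.exp_le_one_iff.2 hx)]
    have hexp : ∀ x y : ℝ, x ≤ y → y ≤ 0 → |Real.exp x - Real.exp y| ≤ y - x := by
      intro x y hxy hy
      have h3 : Real.exp x ≤ Real.exp y := Real.exp_le_exp.2 hxy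
      have h4 : Real.exp y ≤ 1 := Real.exp_le_one_iff.2 hy
      have h5 := Real.add_one_le_exp (x - y)
      have h6 : Real.exp x = Real.exp y * Real.exp (x - y) := by rw [← Real.exp_add]; ring_nf
      rw [abs_sub_comm, abs_of_nonneg (by linarith)]
      nlinarith [Real.exp_pos y]
    have h2 : |min 1 (Real.exp q) - alphaLim ℓ S| ≤ |q - p| := by
      rw [alphaLim, hmin, hmin]
      have hmm : |min 0 q - min 0 p| ≤ |q - p| := by
        have := abs_min_sub_min_le_max 0 q 0 p
        simpa using this
      refine le_trans ?_ hmm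
      rcases le_total (min 0 q) (min 0 p) with hm | hm
      · rw [abs_sub_comm (min 0 q), abs_of_nonneg (sub_nonneg.2 hm)]
        exact hexp _ _ hm (min_le_left _ _)
      · rw [abs_sub_comm, abs_of_nonneg (sub_nonneg.2 hm)]
        exact hexp _ _ hm (min_le_left _ _)
    calc |1 - S| * |min 1 (Real.exp q) - alphaLim ℓ S| ≤ 1 * |q - p| := by gcongr
      _ ≤ _ := by nlinarith
  · rw [alphaLim_of_one_le h]
    rcases le_total 0 q with hq | hq
    · rw [min_eq_left (Real.one_le_exp hq)]; simp only [sub_self, abs_zero, mul_zero]; positivity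
    · have hp0 : 0 ≤ p := by rw [hp]; have := sub_nonneg.2 h; positivity
      have hq1 := Real.exp_le_one_iff.2 hq
      have hq0 := Real.exp_pos q
      rw [min_eq_right hq1, abs_of_nonpos (by linarith), abs_of_nonpos (by linarith),
        abs_of_nonpos (by linarith)]
      have hS1 : S - 1 = 2 / ℓ ^ 2 * p := by rw [hp]; field_simp
      have h3 : -(1 - S) * -(Real.exp q - 1) ≤ (S - 1) * 1 := by nlinarith
      nlinarith

/-- The combined effect of one step: the drift of `S = |z|² / N`, the logarithm of the acceptance
ratio, and the growth of the Lyapunov function, with constants independent of the dimension. -/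
theorem exists_oneStep_bounds {ℓ K B : ℝ} (hℓ : 0 < ℓ) (hK : 0 ≤ K) (hB : 0 ≤ B) :
    ∃ C, 0 ≤ C ∧ ∀ {N : ℕ} {ρ : Fin N → ℝ} {G : (Fin N → ℝ) → ℝ} {v : (Fin N → ℝ) → Fin N → ℝ},
      IsCoordModel K B ρ G v → ∀ r : ℝ, 0 < r → r ≤ 1 → r ^ 4 * N = 1 → ℓ * r ^ 2 ≤ 1 → ∀ z ξ,
      |r ^ 4 * sqNorm (propZ (ℓ * r ^ 2) v z ξ) - r ^ 4 * sqNorm z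
          - r ^ 2 * (2 * ℓ * (1 - r ^ 4 * sqNorm z))| ≤ r ^ 3 * (C * fluct r ρ z ξ) ∧
      |1 - r ^ 4 * sqNorm z| *
        |min 1 (Real.exp (logRatio (ℓ * r ^ 2) G v z (propZ (ℓ * r ^ 2) v z ξ)))
          - alphaLim ℓ (r ^ 4 * sqNorm z)| ≤ r * (C * fluct r ρ z ξ) ∧
      lyap r ρ (propZ (ℓ * r ^ 2) v z ξ) ≤ lyap r ρ z + r ^ 2 * (C * fluct r ρ z ξ) := by
  obtain ⟨Cq, hCq, hq⟩ := IsCoordModel.exists_logRatio_bound hℓ hK hB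
  set C₁ := ℓ + ℓ ^ 2 + K ^ 2 * B + ℓ * K + √(2 * ℓ) + 2 * K with hC₁
  set C₃ := ℓ + 4 * (B * (K ^ 2 * B)) + 8 with hC₃
  have hC₁0 : 0 ≤ C₁ := by positivity
  have hC₃0 : 0 ≤ C₃ := by positivity
  have hCq' : 0 ≤ (1 + 2 / ℓ ^ 2) * Cq := by positivity
  refine ⟨C₁ + (1 + 2 / ℓ ^ 2) * Cq + C₃ + 2 * ℓ, by positivity, ?_⟩
  intro N ρ G v h r hr hr1 hN hδ z ξ
  have hE := h.abs_sqNorm_propZ_sub_le hK hℓ hr hr1 hδ z ξ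
  have hWy := h.wSq_propZ_le hℓ hr hδ z ξ
  have hQ := hq h r hr hr1 hN hδ z ξ
  have hΦ1 : 1 ≤ fluct r ρ z ξ := one_le_fluct ρ z ξ
  set y := propZ (ℓ * r ^ 2) v z ξ with hy
  set Φ := fluct r ρ z ξ
  have hΦ0 : 0 ≤ Φ := zero_le_one.trans hΦ1
  have hS : 0 ≤ r ^ 4 * sqNorm z := mul_nonneg (by positivity) (sqNorm_nonneg z)
  have hdrift : |r ^ 4 * sqNorm y - r ^ 4 * sqNorm z - r ^ 2 * (2 * ℓ * (1 - r ^ 4 * sqNorm z))|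
      ≤ r ^ 3 * (C₁ * Φ) := by
    have heq : r ^ 4 * sqNorm y - r ^ 4 * sqNorm z - r ^ 2 * (2 * ℓ * (1 - r ^ 4 * sqNorm z))
        = r ^ 4 * (sqNorm y - sqNorm z - 2 * (ℓ * r ^ 2) * (N - sqNorm z)) := by
      linear_combination (2 * ℓ * r ^ 2) * hN
    rw [heq, abs_mul, abs_of_pos (by positivity)]
    calc _ = r ^ 3 * (r * |sqNorm y - sqNorm z - 2 * (ℓ * r ^ 2) * (N - sqNorm z)|) := by ring
      _ ≤ _ := by gcongr
  refine ⟨hdrift.trans ?_, ?_, ?_⟩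
  · gcongr; linarith
  · refine (abs_one_sub_mul_abs_min_exp_sub_le hℓ hS _).trans ?_
    calc _ ≤ (1 + 2 / ℓ ^ 2) * (r * (Cq * Φ)) := by gcongr
      _ = r * (((1 + 2 / ℓ ^ 2) * Cq) * Φ) := by ring
      _ ≤ _ := by gcongr; linarith
  · have h1 := (abs_le.1 hdrift).2
    have h2 : r ^ 3 * (C₁ * Φ) ≤ r ^ 2 * (C₁ * Φ) := by
      gcongr ?_ * _
      exact pow_le_pow_of_le_one hr.le hr1 (by norm_num)
    have h3 : r ^ 2 * (2 * ℓ * (1 - r ^ 4 * sqNorm z)) ≤ r ^ 2 * (2 * ℓ * Φ) := by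
      gcongr; linarith
    have h4 : r ^ 2 * wSq ρ y ≤ r ^ 2 * (wSq ρ z + C₃ * Φ) := by gcongr
    have h5 : 0 ≤ r ^ 2 * ((1 + 2 / ℓ ^ 2) * Cq * Φ) := by positivity
    unfold lyap
    linarith

end OneStep

/-! ### Moments of the Gaussian increments -/

section Moments

variable {Ω : Type*} [MeasurableSpace Ω] {P : Measure Ω}

theorem integrable_mul_of_sq {f g : Ω → ℝ} (hf : AEStronglyMeasurable f P)
    (hg : AEStronglyMeasurable g P) (hf2 : Integrable (fun ω => f ω ^ 2) P)
    (hg2 : Integrable (fun ω => g ω ^ 2) P) : Integrable (fun ω => f ω * g ω) P := by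
  refine (hf2.add hg2).mono (hf.mul hg) (Eventually.of_forall fun ω => ?_)
  simp only [Pi.add_apply, Real.norm_eq_abs, abs_mul]
  rw [abs_of_nonneg (by positivity : 0 ≤ f ω ^ 2 + g ω ^ 2), ← sq_abs (f ω), ← sq_abs (g ω)]
  nlinarith [sq_nonneg (|f ω| - |g ω|), abs_nonneg (f ω), abs_nonneg (g ω)]

/-- Second moment of a sum `∑ a_j η_j` where the `η_j` are orthogonal with second moment `c` and
independent of the coefficients `a_j`. -/
theorem integral_sq_sum_mul {N : ℕ} {a η : Ω → Fin N → ℝ} {c : ℝ} (ha : Measurable a)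
    (hη : Measurable η) (hind : IndepFun a η P)
    (ha2 : ∀ j, Integrable (fun ω => a ω j ^ 2) P) (hη2 : ∀ j, Integrable (fun ω => η ω j ^ 2) P)
    (horth : ∀ i j, ∫ ω, η ω i * η ω j ∂P = if i = j then c else 0) :
    Integrable (fun ω => (∑ j, a ω j * η ω j) ^ 2) P ∧
      ∫ ω, (∑ j, a ω j * η ω j) ^ 2 ∂P = c * ∫ ω, ∑ j, a ω j ^ 2 ∂P := by
  have hma : ∀ j, Measurable fun ω => a ω j := fun j => (measurable_pi_apply j).comp ha
  have hmη : ∀ j, Measurable fun ω => η ω j := fun j => (measurable_pi_apply j).comp hη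
  have hexp : ∀ ω, (∑ j, a ω j * η ω j) ^ 2
      = ∑ i, ∑ j, (a ω i * a ω j) * (η ω i * η ω j) := by
    intro ω
    rw [pow_two, Finset.sum_mul_sum]
    exact Finset.sum_congr rfl fun i _ => Finset.sum_congr rfl fun j _ => by ring
  have hind' : ∀ i j, IndepFun (fun ω => a ω i * a ω j) (fun ω => η ω i * η ω j) P := fun i j =>
    hind.comp (φ := fun x : Fin N → ℝ => x i * x j) (ψ := fun x : Fin N → ℝ => x i * x j)
      (by fun_prop) (by fun_prop)
  have hia : ∀ i j, Integrable (fun ω => a ω i * a ω j) P := fun i j =>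
    integrable_mul_of_sq (hma i).aestronglyMeasurable (hma j).aestronglyMeasurable (ha2 i) (ha2 j)
  have hiη : ∀ i j, Integrable (fun ω => η ω i * η ω j) P := fun i j =>
    integrable_mul_of_sq (hmη i).aestronglyMeasurable (hmη j).aestronglyMeasurable (hη2 i) (hη2 j)
  have hint : ∀ i j, Integrable (fun ω => (a ω i * a ω j) * (η ω i * η ω j)) P := fun i j =>
    (hind' i j).integrable_mul (hia i j) (hiη i j)
  simp only [hexp]
  refine ⟨integrable_finsetSum _ fun i _ => integrable_finsetSum _ fun j _ => hint i j, ?_⟩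
  rw [integral_finsetSum _ fun i _ => integrable_finsetSum _ fun j _ => hint i j,
    integral_finsetSum _ fun i _ => ha2 i, Finset.mul_sum]
  refine Finset.sum_congr rfl fun i _ => ?_
  rw [integral_finsetSum _ fun j _ => hint i j]
  have hterm : ∀ j, ∫ ω, (a ω i * a ω j) * (η ω i * η ω j) ∂P
      = if i = j then c * ∫ ω, a ω i ^ 2 ∂P else 0 := by
    intro j
    rw [(hind' i j).integral_fun_mul_eq_mul_integral (hia i j).1 (hiη i j).1, horth]
    split_ifs with hij
    · subst hij
      rw [mul_comm]
      congr 1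
      exact integral_congr_ae (Eventually.of_forall fun ω => (pow_two _).symm)
    · rw [mul_zero]
  simp [hterm]

/-- The variance of the square of a standard Gaussian variable. -/
def gaussFourth : ℝ := ∫ x, (x ^ 2 - 1) ^ 2 ∂gaussianReal 0 1

theorem gaussFourth_nonneg : 0 ≤ gaussFourth := integral_nonneg fun _ => sq_nonneg _

theorem integrable_gaussian_pow (n : ℕ) :
    Integrable (fun x : ℝ => x ^ n) (gaussianReal 0 1) := by
  rcases Nat.eq_zero_or_pos n with rfl | hn
  · simp
  have h := (memLp_id_gaussianReal (μ := 0) (v := 1) n).integrable_norm_pow hn.ne'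
  exact h.mono (by fun_prop) (Eventually.of_forall fun x => by simp)

theorem integrable_gaussian_sq_sub : Integrable (fun x : ℝ => (x ^ 2 - 1) ^ 2)
    (gaussianReal 0 1) := by
  have h : (fun x : ℝ => (x ^ 2 - 1) ^ 2) = fun x : ℝ => x ^ 4 - 2 * x ^ 2 + 1 := by
    ext x; ring
  rw [h]
  exact ((integrable_gaussian_pow 4).sub ((integrable_gaussian_pow 2).const_mul 2)).add
    (integrable_const 1)

theorem integral_gaussian_sq : ∫ x, x ^ 2 ∂gaussianReal 0 1 = 1 := by
  have h := variance_id_gaussianReal (μ := 0) (v := 1)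
  rw [variance_eq_integral (by fun_prop)] at h
  simpa [integral_id_gaussianReal] using h

section Vector

variable {N : ℕ} {z η : Ω → Fin N → ℝ}

theorem _root_.ProbabilityTheory.HasLaw.integrable_comp_gaussian {X : Ω → ℝ}
    (h : HasLaw X (gaussianReal 0 1) P) {f : ℝ → ℝ} (hf : Integrable f (gaussianReal 0 1)) :
    Integrable (fun ω => f (X ω)) P := by
  rw [← h.map_eq] at hf
  exact hf.comp_aemeasurable h.aemeasurable

theorem _root_.ProbabilityTheory.HasLaw.integral_comp_gaussian {X : Ω → ℝ}
    (h : HasLaw X (gaussianReal 0 1) P) {f : ℝ → ℝ} (hf : Continuous f) :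
    ∫ ω, f (X ω) ∂P = ∫ x, f x ∂gaussianReal 0 1 := by
  rw [← h.map_eq, integral_map h.aemeasurable hf.aestronglyMeasurable]

/-- Functions of independent standard Gaussian variables that are centred are orthogonal. -/
theorem integral_mul_gaussian (hlaw : ∀ j, HasLaw (fun ω => η ω j) (gaussianReal 0 1) P)
    (hind : ∀ i j, i ≠ j → IndepFun (fun ω => η ω i) (fun ω => η ω j) P)
    {f : ℝ → ℝ} (hf : Continuous f) (h0 : ∫ x, f x ∂gaussianReal 0 1 = 0) (i j : Fin N) :
    ∫ ω, f (η ω i) * f (η ω j) ∂P = if i = j then ∫ x, f x ^ 2 ∂gaussianReal 0 1 else 0 := by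
  split_ifs with hij
  · subst hij
    rw [← (hlaw i).integral_comp_gaussian (f := fun x => f x ^ 2) (hf.pow 2)]
    exact integral_congr_ae (Eventually.of_forall fun ω => (pow_two _).symm)
  · rw [(hind i j hij).integral_fun_comp_mul_comp (hlaw i).aemeasurable (hlaw j).aemeasurable
      hf.aestronglyMeasurable hf.aestronglyMeasurable, (hlaw i).integral_comp_gaussian hf, h0,
      zero_mul]

/-- The expected size of the fluctuations is bounded by the expected Lyapunov function. -/
theorem integral_fluct_le [IsProbabilityMeasure P] (hz : Measurable z) (hη : Measurable η)
    (hzη : IndepFun z η P)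
    (hlaw : ∀ j, HasLaw (fun ω => η ω j) (gaussianReal 0 1) P)
    (hind : ∀ i j, i ≠ j → IndepFun (fun ω => η ω i) (fun ω => η ω j) P)
    {r B : ℝ} (hr : 0 < r) (hN : r ^ 4 * N = 1) {ρ : Fin N → ℝ} (hρ : ∑ j, ρ j ^ 2 ≤ B)
    (hV : Integrable (fun ω => lyap r ρ (z ω)) P) :
    Integrable (fun ω => fluct r ρ (z ω) (η ω)) P ∧
      ∫ ω, fluct r ρ (z ω) (η ω) ∂P
        ≤ (2 + gaussFourth + B) * ∫ ω, lyap r ρ (z ω) ∂P := by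
  have hmz : ∀ j, Measurable fun ω => z ω j := fun j => (measurable_pi_apply j).comp hz
  have hmη : ∀ j, Measurable fun ω => η ω j := fun j => (measurable_pi_apply j).comp hη
  have hmA : Measurable fun ω => sqNorm (z ω) := by unfold sqNorm; fun_prop
  have hrA : Integrable (fun ω => r ^ 4 * sqNorm (z ω)) P := by
    refine hV.mono (hmA.const_mul _).aestronglyMeasurable (Eventually.of_forall fun ω => ?_)
    have h1 : 0 ≤ r ^ 4 * sqNorm (z ω) := mul_nonneg (by positivity) (sqNorm_nonneg _)
    have h2 : 0 ≤ r ^ 2 * wSq ρ (z ω) := mul_nonneg (by positivity) (wSq_nonneg _ _)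
    rw [Real.norm_eq_abs, Real.norm_eq_abs, abs_of_nonneg h1,
      abs_of_nonneg (zero_le_one.trans (one_le_lyap _ _))]
    unfold lyap; linarith
  have hA : Integrable (fun ω => sqNorm (z ω)) P := by
    refine (hrA.const_mul (r ^ 4)⁻¹).congr (Eventually.of_forall fun ω => ?_)
    have : r ^ 4 ≠ 0 := by positivity
    simp only; field_simp
  have hz2 : ∀ j, Integrable (fun ω => z ω j ^ 2) P := fun j => by
    refine hA.mono ((hmz j).pow_const 2).aestronglyMeasurable (Eventually.of_forall fun ω => ?_)
    rw [Real.norm_eq_abs, Real.norm_eq_abs, abs_of_nonneg (sq_nonneg _),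
      abs_of_nonneg (sqNorm_nonneg _)]
    exact Finset.single_le_sum (f := fun j => z ω j ^ 2) (fun i _ => sq_nonneg _)
      (Finset.mem_univ j)
  have hη2 : ∀ j, Integrable (fun ω => η ω j ^ 2) P := fun j =>
    (hlaw j).integrable_comp_gaussian (integrable_gaussian_pow 2)
  have hη2' : ∀ j, ∫ ω, η ω j ^ 2 ∂P = 1 := fun j => by
    rw [(hlaw j).integral_comp_gaussian (f := fun x => x ^ 2) (by fun_prop), integral_gaussian_sq]
  obtain ⟨hY, hY'⟩ := integral_sq_sum_mul hz hη hzη hz2 hη2 (c := 1) (fun i j => by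
    rw [integral_mul_gaussian hlaw hind (f := fun x => x) continuous_id
      (integral_id_gaussianReal (μ := 0) (v := 1)), integral_gaussian_sq])
  obtain ⟨hX, hX'⟩ := integral_sq_sum_mul (a := fun _ _ => 1) (η := fun ω j => η ω j ^ 2 - 1)
    (P := P) measurable_const (by fun_prop) (indepFun_const_left _ _)
    (fun j => by simp)
    (fun j => (hlaw j).integrable_comp_gaussian integrable_gaussian_sq_sub)
    (c := gaussFourth) (fun i j => integral_mul_gaussian hlaw hind
      (f := fun x => x ^ 2 - 1) (by fun_prop) (by
        rw [integral_sub (integrable_gaussian_pow 2) (integrable_const 1), integral_gaussian_sq]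
        simp) i j)
  have hXeq : ∀ ω, (∑ j, (1 : ℝ) * (η ω j ^ 2 - 1)) = sqNorm (η ω) - N := fun ω => by
    simp [sqNorm, Finset.sum_sub_distrib]
  simp only [hXeq] at hX hX'
  have hZterm : ∀ j, Integrable (fun ω => (ρ j * η ω j) ^ 2) P := fun j => by
    simp only [mul_pow]; exact (hη2 j).const_mul _
  have hZ : Integrable (fun ω => wSq ρ (η ω)) P := integrable_finsetSum _ fun j _ => hZterm j
  have hZ' : ∫ ω, wSq ρ (η ω) ∂P ≤ B := by
    unfold wSq
    rw [integral_finsetSum _ fun j _ => hZterm j]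
    refine le_trans (le_of_eq (Finset.sum_congr rfl fun j _ => ?_)) hρ
    simp only [mul_pow]
    rw [integral_const_mul, hη2', mul_one]
  have hY'' := hY.const_mul (r ^ 4)
  have hX'' := hX.const_mul (r ^ 4)
  have hVY : Integrable (fun ω => lyap r ρ (z ω) + r ^ 4 * (∑ j, z ω j * η ω j) ^ 2) P :=
    hV.add hY''
  have hVYX : Integrable (fun ω => lyap r ρ (z ω) + r ^ 4 * (∑ j, z ω j * η ω j) ^ 2
      + r ^ 4 * (sqNorm (η ω) - N) ^ 2) P := hVY.add hX''
  refine ⟨hVYX.add hZ, ?_⟩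
  have hV1 : 1 ≤ ∫ ω, lyap r ρ (z ω) ∂P := by
    have : ∫ _, (1 : ℝ) ∂P ≤ ∫ ω, lyap r ρ (z ω) ∂P :=
      integral_mono (integrable_const 1) hV fun ω => one_le_lyap ρ (z ω)
    simpa using this
  have hsum : ∫ ω, fluct r ρ (z ω) (η ω) ∂P = ∫ ω, lyap r ρ (z ω) ∂P
      + r ^ 4 * ∫ ω, (∑ j, z ω j * η ω j) ^ 2 ∂P + r ^ 4 * ∫ ω, (sqNorm (η ω) - N) ^ 2 ∂P
      + ∫ ω, wSq ρ (η ω) ∂P := by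
    rw [← integral_const_mul, ← integral_const_mul, ← integral_add hV hY'',
      ← integral_add hVY hX'', ← integral_add hVYX hZ]
    rfl
  have hAle : r ^ 4 * ∫ ω, (∑ j, z ω j * η ω j) ^ 2 ∂P ≤ ∫ ω, lyap r ρ (z ω) ∂P := by
    rw [hY', one_mul, ← integral_const_mul]
    refine integral_mono hrA hV fun ω => ?_
    have h2 : 0 ≤ r ^ 2 * wSq ρ (z ω) := mul_nonneg (by positivity) (wSq_nonneg _ _)
    have h3 : sqNorm (z ω) = ∑ j, z ω j ^ 2 := rfl
    simp only [lyap, h3] at *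
    linarith
  have hXle : r ^ 4 * ∫ ω, (sqNorm (η ω) - N) ^ 2 ∂P = gaussFourth := by
    rw [hX']
    simp only [one_pow, Finset.sum_const, Finset.card_univ, Fintype.card_fin, nsmul_eq_mul,
      mul_one, integral_const, probReal_univ, one_smul]
    linear_combination gaussFourth * hN
  have hB : 0 ≤ B := (Finset.sum_nonneg fun _ _ => sq_nonneg _).trans hρ
  rw [hsum, hXle]
  have h4 : gaussFourth ≤ gaussFourth * ∫ ω, lyap r ρ (z ω) ∂P :=
    le_mul_of_one_le_right gaussFourth_nonneg hV1
  have h5 : B ≤ B * ∫ ω, lyap r ρ (z ω) ∂P := le_mul_of_one_le_right hB hV1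
  linarith

end Vector

end Moments

/-! ### Acceptance by an independent uniform variable -/

section Uniform

variable {Ω : Type*} [MeasurableSpace Ω] {P : Measure Ω}

/-- The indicator of the event that a proposal with acceptance probability `a` is accepted, when the
uniform variable takes the value `u`. -/
def accepted (u a : ℝ) : ℝ := if u ≤ a then 1 else 0

theorem accepted_nonneg (u a : ℝ) : 0 ≤ accepted u a := by
  unfold accepted; split_ifs <;> norm_num

theorem accepted_le_one (u a : ℝ) : accepted u a ≤ 1 := by
  unfold accepted; split_ifs <;> norm_num

theorem measurable_accepted : Measurable fun p : ℝ × ℝ => accepted p.1 p.2 :=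
  Measurable.ite (measurableSet_le measurable_fst measurable_snd) measurable_const measurable_const

theorem abs_accepted_sub (u a b : ℝ) :
    |accepted u a - accepted u b| = accepted u (max a b) - accepted u (min a b) := by
  unfold accepted
  rcases le_total a b with h | h
  · rw [max_eq_right h, min_eq_left h]
    split_ifs <;> first | (exfalso; linarith) | norm_num
  · rw [max_eq_left h, min_eq_right h]
    split_ifs <;> first | (exfalso; linarith) | norm_num

theorem integral_accepted {a : ℝ} (h0 : 0 ≤ a) (h1 : a ≤ 1) :
    ∫ u, accepted u a ∂(volume.restrict (Set.Icc (0 : ℝ) 1)) = a := by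
  have h : (fun u => accepted u a) = (Set.Iic a).indicator fun _ => (1 : ℝ) := by
    ext u; simp [accepted, Set.indicator_apply]
  rw [h, integral_indicator measurableSet_Iic, Measure.restrict_restrict measurableSet_Iic]
  have h2 : Set.Iic a ∩ Set.Icc (0 : ℝ) 1 = Set.Icc 0 a := by
    ext u; simp only [Set.mem_inter_iff, Set.mem_Iic, Set.mem_Icc]
    constructor
    · rintro ⟨h3, h4, h5⟩; exact ⟨h4, h3⟩
    · rintro ⟨h3, h4⟩; exact ⟨h4, h3, h4.trans h1⟩
  rw [h2]
  simp [h0]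

/-- Conditionally on everything that is independent of the uniform variable, the event of
acceptance has probability `a`. -/
theorem integral_mul_accepted [IsProbabilityMeasure P] {f a U : Ω → ℝ}
    (hf : Measurable f) (ha : Measurable a)
    (hU : Measurable U) (hlaw : HasLaw U (volume.restrict (Set.Icc (0 : ℝ) 1)) P)
    (hind : IndepFun (fun ω => (f ω, a ω)) U P) (hfi : Integrable f P)
    (h0 : ∀ ω, 0 ≤ a ω) (h1 : ∀ ω, a ω ≤ 1) :
    ∫ ω, f ω * accepted (U ω) (a ω) ∂P = ∫ ω, f ω * a ω ∂P := by
  have hmfa : Measurable fun ω => (f ω, a ω) := hf.prodMk ha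
  have hmap := hind.map_prod_eq_prod_map_map hmfa.aemeasurable hU.aemeasurable
  rw [hlaw.map_eq] at hmap
  have hprob : IsProbabilityMeasure (volume.restrict (Set.Icc (0 : ℝ) 1)) := ⟨by simp⟩
  set g : (ℝ × ℝ) × ℝ → ℝ := fun p => p.1.1 * accepted p.2 p.1.2 with hg
  have hmg : Measurable g :=
    (measurable_fst.comp measurable_fst).mul (measurable_accepted.comp
      (measurable_snd.prodMk (measurable_snd.comp measurable_fst)))
  have hmeas : Measurable fun ω => ((f ω, a ω), U ω) := hmfa.prodMk hU
  have hgi : Integrable g ((P.map fun ω => (f ω, a ω)).prod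
      (volume.restrict (Set.Icc (0 : ℝ) 1))) := by
    rw [← hmap, integrable_map_measure hmg.aestronglyMeasurable hmeas.aemeasurable]
    refine hfi.mono (hmg.comp hmeas).aestronglyMeasurable (Eventually.of_forall fun ω => ?_)
    simp only [hg, Function.comp, norm_mul]
    refine mul_le_of_le_one_right (norm_nonneg _) ?_
    rw [Real.norm_eq_abs, abs_of_nonneg (accepted_nonneg _ _)]
    exact accepted_le_one _ _
  have hprob' : IsProbabilityMeasure (P.map fun ω => (f ω, a ω)) :=
    Measure.isProbabilityMeasure_map hmfa.aemeasurable
  calc ∫ ω, f ω * accepted (U ω) (a ω) ∂P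
      = ∫ p, g p ∂(P.map fun ω => ((f ω, a ω), U ω)) :=
        (integral_map hmeas.aemeasurable hmg.aestronglyMeasurable).symm
    _ = ∫ q, ∫ u, g (q, u) ∂(volume.restrict (Set.Icc (0 : ℝ) 1))
          ∂(P.map fun ω => (f ω, a ω)) := by rw [hmap, integral_prod g hgi]
    _ = ∫ ω, ∫ u, g ((f ω, a ω), u) ∂(volume.restrict (Set.Icc (0 : ℝ) 1)) ∂P :=
        integral_map hmfa.aemeasurable
          hmg.stronglyMeasurable.integral_prod_right'.aestronglyMeasurable
    _ = ∫ ω, f ω * a ω ∂P := by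
        refine integral_congr_ae (Eventually.of_forall fun ω => ?_)
        simp only [hg]
        rw [integral_const_mul, integral_accepted (h0 ω) (h1 ω)]

theorem integrable_mul_accepted {f a U : Ω → ℝ} (ha : Measurable a)
    (hU : Measurable U) (hfi : Integrable f P) :
    Integrable (fun ω => f ω * accepted (U ω) (a ω)) P :=
  hfi.mul_bdd (c := 1) (measurable_accepted.comp (hU.prodMk ha)).aestronglyMeasurable
    (Eventually.of_forall fun ω => by
      change |accepted (U ω) (a ω)| ≤ 1
      rw [abs_of_nonneg (accepted_nonneg _ _)]
      exact accepted_le_one _ _)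

theorem integral_mul_abs_accepted_sub [IsProbabilityMeasure P] {f a b U : Ω → ℝ}
    (hf : Measurable f) (ha : Measurable a)
    (hb : Measurable b) (hU : Measurable U)
    (hlaw : HasLaw U (volume.restrict (Set.Icc (0 : ℝ) 1)) P)
    (hind : IndepFun (fun ω => (f ω, a ω, b ω)) U P) (hfi : Integrable f P)
    (ha0 : ∀ ω, 0 ≤ a ω) (ha1 : ∀ ω, a ω ≤ 1) (hb0 : ∀ ω, 0 ≤ b ω) (hb1 : ∀ ω, b ω ≤ 1) :
    ∫ ω, f ω * |accepted (U ω) (a ω) - accepted (U ω) (b ω)| ∂P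
      = ∫ ω, f ω * |a ω - b ω| ∂P := by
  have hmax := ha.max hb
  have hmin := ha.min hb
  have hbdd : ∀ {c : Ω → ℝ}, Measurable c → (∀ ω, 0 ≤ c ω) → (∀ ω, c ω ≤ 1) →
      Integrable (fun ω => f ω * c ω) P := fun hc h0 h1 =>
    hfi.mul_bdd (c := 1) hc.aestronglyMeasurable (Eventually.of_forall fun ω => by
      rw [Real.norm_eq_abs, abs_of_nonneg (h0 ω)]; exact h1 ω)
  have habs : ∀ ω, |a ω - b ω| = max (a ω) (b ω) - min (a ω) (b ω) := fun ω => by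
    rw [abs_sub_comm, max_sub_min_eq_abs]
  simp only [abs_accepted_sub, habs, mul_sub]
  rw [integral_sub (integrable_mul_accepted hmax hU hfi) (integrable_mul_accepted hmin hU hfi),
    integral_sub (hbdd hmax (fun ω => le_max_of_le_left (ha0 ω)) fun ω => max_le (ha1 ω) (hb1 ω))
      (hbdd hmin (fun ω => le_min (ha0 ω) (hb0 ω)) fun ω => min_le_of_left_le (ha1 ω)),
    integral_mul_accepted hf hmax hU hlaw
      (hind.comp (φ := fun p : ℝ × ℝ × ℝ => (p.1, max p.2.1 p.2.2)) (by fun_prop) measurable_id)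
      hfi (fun ω => le_max_of_le_left (ha0 ω)) fun ω => max_le (ha1 ω) (hb1 ω),
    integral_mul_accepted hf hmin hU hlaw
      (hind.comp (φ := fun p : ℝ × ℝ × ℝ => (p.1, min p.2.1 p.2.2)) (by fun_prop) measurable_id)
      hfi (fun ω => le_min (ha0 ω) (hb0 ω)) fun ω => min_le_of_left_le (ha1 ω)]

end Uniform

/-! ### The chain in rescaled coordinates and its sources of noise -/

section ChainZ

variable {N : ℕ}

/-- The acceptance probability in rescaled coordinates. -/
def accZ (δ : ℝ) (G : (Fin N → ℝ) → ℝ) (v : (Fin N → ℝ) → Fin N → ℝ) (z y : Fin N → ℝ) : ℝ :=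
  min 1 (Real.exp (logRatio δ G v z y))

open Classical in
/-- The chain in rescaled coordinates. -/
def chainZ (δ : ℝ) (G : (Fin N → ℝ) → ℝ) (v : (Fin N → ℝ) → Fin N → ℝ) (z₀ : Fin N → ℝ)
    (ξ : ℕ → Fin N → ℝ) (U : ℕ → ℝ) : ℕ → Fin N → ℝ
  | 0 => z₀
  | k + 1 =>
    let z := chainZ δ G v z₀ ξ U k
    let y := propZ δ v z (ξ k)
    if U k ≤ accZ δ G v z y then y else z

/-- The martingale part of one step: the difference between acceptance with the limiting probability
and that probability itself, times the drift of an accepted step. -/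
def mart (ℓ r S u : ℝ) : ℝ :=
  2 * ℓ * r ^ 2 * (1 - S) * (accepted u (alphaLim ℓ S) - alphaLim ℓ S)

theorem accZ_nonneg (δ : ℝ) (G : (Fin N → ℝ) → ℝ) (v : (Fin N → ℝ) → Fin N → ℝ)
    (z y : Fin N → ℝ) : 0 ≤ accZ δ G v z y := le_min zero_le_one (Real.exp_nonneg _)

theorem accZ_le_one (δ : ℝ) (G : (Fin N → ℝ) → ℝ) (v : (Fin N → ℝ) → Fin N → ℝ)
    (z y : Fin N → ℝ) : accZ δ G v z y ≤ 1 := min_le_left _ _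

theorem measurable_sqNorm : Measurable (sqNorm : (Fin N → ℝ) → ℝ) := by
  unfold sqNorm; fun_prop

theorem measurable_lyap (r : ℝ) (ρ : Fin N → ℝ) : Measurable (lyap r ρ) := by
  unfold lyap wSq sqNorm; fun_prop

theorem measurable_propZ {Ω : Type*} {_ : MeasurableSpace Ω} (δ : ℝ)
    {v : (Fin N → ℝ) → Fin N → ℝ} (hv : Measurable v) {z ξ : Ω → Fin N → ℝ}
    (hz : Measurable z) (hξ : Measurable ξ) : Measurable fun ω => propZ δ v (z ω) (ξ ω) := by
  unfold propZ; fun_prop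

theorem measurable_accZ {Ω : Type*} {_ : MeasurableSpace Ω} (δ : ℝ) {G : (Fin N → ℝ) → ℝ}
    {v : (Fin N → ℝ) → Fin N → ℝ} (hG : Measurable G) (hv : Measurable v)
    {z y : Ω → Fin N → ℝ} (hz : Measurable z) (hy : Measurable y) :
    Measurable fun ω => accZ δ G v (z ω) (y ω) := by
  unfold accZ logRatio sqNorm
  simp only [Pi.add_apply]
  fun_prop

theorem measurable_chainZ {Ω : Type*} {_ : MeasurableSpace Ω} (δ : ℝ) {G : (Fin N → ℝ) → ℝ}
    {v : (Fin N → ℝ) → Fin N → ℝ} (hG : Measurable G) (hv : Measurable v) (z₀ : Fin N → ℝ)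
    {ξ : ℕ → Fin N → Ω → ℝ} {U : ℕ → Ω → ℝ} {k : ℕ}
    (hξ : ∀ i < k, ∀ j, Measurable (ξ i j)) (hU : ∀ i < k, Measurable (U i)) :
    Measurable fun ω => chainZ δ G v z₀ (fun i j => ξ i j ω) (fun i => U i ω) k := by
  induction k with
  | zero => exact measurable_const
  | succ k ih =>
    have hz := ih (fun i hi => hξ i (hi.trans k.lt_succ_self))
      (fun i hi => hU i (hi.trans k.lt_succ_self))
    have hy := measurable_propZ δ hv hz (measurable_pi_lambda (fun ω j => ξ k j ω)
      (hξ k k.lt_succ_self))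
    exact Measurable.ite (measurableSet_le (hU k k.lt_succ_self)
      (measurable_accZ δ hG hv hz hy)) hy hz

theorem measurable_mart {Ω : Type*} {_ : MeasurableSpace Ω} (ℓ r : ℝ) {S U : Ω → ℝ}
    (hS : Measurable S) (hU : Measurable U) : Measurable fun ω => mart ℓ r (S ω) (U ω) := by
  have h := (continuous_alphaLim ℓ).measurable.comp hS
  have h2 : Measurable fun ω => accepted (U ω) (alphaLim ℓ (S ω)) :=
    measurable_accepted.comp (hU.prodMk h)
  unfold mart
  exact ((hS.const_sub 1).const_mul _).mul (h2.sub h)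

theorem measurable_sum_mart {Ω : Type*} {_ : MeasurableSpace Ω} (ℓ r : ℝ) {S U : ℕ → Ω → ℝ} {k : ℕ}
    (hS : ∀ i < k, Measurable (S i)) (hU : ∀ i < k, Measurable (U i)) :
    Measurable fun ω => ∑ i ∈ Finset.range k, mart ℓ r (S i ω) (U i ω) :=
  Finset.measurable_fun_sum _ fun i hi =>
    measurable_mart ℓ r (hS i (Finset.mem_range.1 hi)) (hU i (Finset.mem_range.1 hi))

end ChainZ

section Filtration

variable {Ω : Type*} {N : ℕ}

/-- The `σ`-algebra generated by the sources of noise with index in `I`. -/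
@[reducible] def noiseSigma (ξ : ℕ → Fin N → Ω → ℝ) (U : ℕ → Ω → ℝ) (I : Set ((ℕ × Fin N) ⊕ ℕ)) :
    MeasurableSpace Ω :=
  ⨆ i ∈ I, MeasurableSpace.comap
    (Sum.elim (fun p : ℕ × Fin N => ξ p.1 p.2) U i) inferInstance

/-- The sources of noise used before step `k`. -/
def past (N k : ℕ) : Set ((ℕ × Fin N) ⊕ ℕ) := {i | Sum.elim (fun p => p.1) id i < k}

/-- The Gaussian variables of step `k`. -/
def gaussIdx (N k : ℕ) : Set ((ℕ × Fin N) ⊕ ℕ) := Set.range fun j : Fin N => Sum.inl (k, j)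

theorem disjoint_past_gaussIdx (N k : ℕ) : Disjoint (past N k) (gaussIdx N k) := by
  rw [Set.disjoint_left]
  rintro _ h ⟨j, rfl⟩
  exact lt_irrefl k h

theorem disjoint_union_inr (N k : ℕ) :
    Disjoint (past N k ∪ gaussIdx N k) {(Sum.inr k : (ℕ × Fin N) ⊕ ℕ)} := by
  rw [Set.disjoint_singleton_right]
  rintro (h | ⟨j, hj⟩)
  · exact lt_irrefl k h
  · simp at hj

variable {ξ : ℕ → Fin N → Ω → ℝ} {U : ℕ → Ω → ℝ}

theorem noiseSigma_mono {I J : Set ((ℕ × Fin N) ⊕ ℕ)} (h : I ⊆ J) :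
    noiseSigma ξ U I ≤ noiseSigma ξ U J := biSup_mono h

theorem measurable_gauss_noiseSigma {I : Set ((ℕ × Fin N) ⊕ ℕ)} {k : ℕ} {j : Fin N}
    (h : Sum.inl (k, j) ∈ I) : Measurable[noiseSigma ξ U I] (ξ k j) :=
  Measurable.of_comap_le
    (le_iSup₂ (f := fun (i : (ℕ × Fin N) ⊕ ℕ) (_ : i ∈ I) => MeasurableSpace.comap
      (Sum.elim (fun p : ℕ × Fin N => ξ p.1 p.2) U i) inferInstance) (Sum.inl (k, j)) h)

theorem measurable_unif_noiseSigma {I : Set ((ℕ × Fin N) ⊕ ℕ)} {k : ℕ}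
    (h : Sum.inr k ∈ I) : Measurable[noiseSigma ξ U I] (U k) :=
  Measurable.of_comap_le
    (le_iSup₂ (f := fun (i : (ℕ × Fin N) ⊕ ℕ) (_ : i ∈ I) => MeasurableSpace.comap
      (Sum.elim (fun p : ℕ × Fin N => ξ p.1 p.2) U i) inferInstance) (Sum.inr k) h)

theorem noiseSigma_le [mΩ : MeasurableSpace Ω] (hξ : ∀ k j, Measurable (ξ k j))
    (hU : ∀ k, Measurable (U k)) (I : Set ((ℕ × Fin N) ⊕ ℕ)) : noiseSigma ξ U I ≤ mΩ := by
  refine iSup₂_le fun i _ => ?_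
  rcases i with ⟨k, j⟩ | k
  · exact (hξ k j).comap_le
  · exact (hU k).comap_le

/-- Random variables built from disjoint sets of noise indices are independent. -/
theorem IsNoise.indepFun_of_disjoint [MeasurableSpace Ω] {P : Measure Ω}
    (h : IsNoise P N ξ U) (hξ : ∀ k j, Measurable (ξ k j)) (hU : ∀ k, Measurable (U k))
    {I J : Set ((ℕ × Fin N) ⊕ ℕ)} (hIJ : Disjoint I J) {α β : Type*} [MeasurableSpace α]
    [MeasurableSpace β] {X : Ω → α} {Y : Ω → β} (hX : Measurable[noiseSigma ξ U I] X)
    (hY : Measurable[noiseSigma ξ U J] Y) : IndepFun X Y P := by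
  rw [IndepFun_iff_Indep]
  refine indep_of_indep_of_le_left (indep_of_indep_of_le_right
    (indep_iSup_of_disjoint (fun i => ?_) h.indep.iIndep hIJ) hY.comap_le) hX.comap_le
  rcases i with ⟨k, j⟩ | k
  · exact (hξ k j).comap_le
  · exact (hU k).comap_le

variable [MeasurableSpace Ω] {P : Measure Ω}

theorem IsNoise.ae_unif_le_one (h : IsNoise P N ξ U) : ∀ᵐ ω ∂P, ∀ k, U k ω ≤ 1 := by
  rw [ae_all_iff]
  intro k
  have h1 : ∀ᵐ u ∂(P.map (U k)), u ≤ 1 := by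
    rw [(h.uniform k).map_eq]
    filter_upwards [ae_restrict_mem measurableSet_Icc] with u hu using hu.2
  exact ae_of_ae_map (h.uniform k).aemeasurable h1

/-- The martingale increments are bounded by a multiple of the time step: they vanish if `S ≥ 1`,
where the limiting acceptance probability is `1`. -/
theorem abs_mart_le {ℓ r S u : ℝ} (hℓ : 0 < ℓ) (hS : 0 ≤ S) (hu : u ≤ 1) :
    |mart ℓ r S u| ≤ 2 * ℓ * r ^ 2 := by
  rcases le_total 1 S with h | h
  · have : accepted u 1 = 1 := if_pos hu
    simp only [mart, alphaLim_of_one_le h, this, sub_self, mul_zero, abs_zero]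
    positivity
  · have h1 : |1 - S| ≤ 1 := by rw [abs_le]; constructor <;> linarith
    have h2 : |accepted u (alphaLim ℓ S) - alphaLim ℓ S| ≤ 1 := by
      have := alphaLim_nonneg ℓ S
      have := alphaLim_le_one ℓ S
      have := accepted_nonneg u (alphaLim ℓ S)
      have := accepted_le_one u (alphaLim ℓ S)
      rw [abs_le]; constructor <;> linarith
    rw [mart, abs_mul, abs_mul, abs_of_nonneg (by positivity : 0 ≤ 2 * ℓ * r ^ 2)]
    calc _ ≤ 2 * ℓ * r ^ 2 * 1 * 1 := by gcongr
      _ = _ := by ring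

/-- Orthogonality of the martingale increments. -/
theorem integral_sq_sum_mart_le [IsProbabilityMeasure P] (h : IsNoise P N ξ U)
    (hξ : ∀ k j, Measurable (ξ k j)) (hU : ∀ k, Measurable (U k)) {ℓ r : ℝ} (hℓ : 0 < ℓ)
    {S : ℕ → Ω → ℝ} (hS : ∀ k, Measurable[noiseSigma ξ U (past N k)] (S k))
    (hS0 : ∀ k ω, 0 ≤ S k ω) (hSi : ∀ k, Integrable (S k) P) (k : ℕ) :
    Integrable (fun ω => (∑ i ∈ Finset.range k, mart ℓ r (S i ω) (U i ω)) ^ 2) P ∧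
      ∫ ω, (∑ i ∈ Finset.range k, mart ℓ r (S i ω) (U i ω)) ^ 2 ∂P
        ≤ k * (2 * ℓ * r ^ 2) ^ 2 := by
  set c := 2 * ℓ * r ^ 2 with hc
  have hSm : ∀ k, Measurable (S k) := fun k => (hS k).mono (noiseSigma_le hξ hU _) le_rfl
  have hmm : ∀ k, Measurable fun ω => mart ℓ r (S k ω) (U k ω) := fun k =>
    measurable_mart ℓ r (hSm k) (hU k)
  have hbd : ∀ k, ∀ᵐ ω ∂P, |mart ℓ r (S k ω) (U k ω)| ≤ c := fun k => by
    filter_upwards [h.ae_unif_le_one] with ω hω using abs_mart_le hℓ (hS0 k ω) (hω k)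
  have hMm : ∀ k, Measurable fun ω => ∑ i ∈ Finset.range k, mart ℓ r (S i ω) (U i ω) := fun k =>
    measurable_sum_mart ℓ r (fun i _ => hSm i) (fun i _ => hU i)
  have hMbd : ∀ k : ℕ, ∀ᵐ ω ∂P, |∑ i ∈ Finset.range k, mart ℓ r (S i ω) (U i ω)| ≤ k * c := by
    intro k
    filter_upwards [ae_all_iff.2 hbd] with ω hω
    refine (Finset.abs_sum_le_sum_abs _ _).trans ((Finset.sum_le_sum fun i _ => hω i).trans ?_)
    simp
  have hsq : ∀ {f : Ω → ℝ} {b : ℝ}, Measurable f → (∀ᵐ ω ∂P, |f ω| ≤ b) →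
      Integrable (fun ω => f ω ^ 2) P := by
    intro f b hf hb
    refine Integrable.of_bound (hf.pow_const 2).aestronglyMeasurable (b ^ 2) ?_
    filter_upwards [hb] with ω hω
    rw [Real.norm_eq_abs, abs_pow]
    gcongr
  refine ⟨hsq (hMm k) (hMbd k), ?_⟩
  induction k with
  | zero => simp
  | succ k ih =>
    set M : Ω → ℝ := fun ω => ∑ i ∈ Finset.range k, mart ℓ r (S i ω) (U i ω) with hM
    have hMpast : Measurable[noiseSigma ξ U (past N k)] M := by
      refine @measurable_sum_mart Ω (noiseSigma ξ U (past N k)) ℓ r S U k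
        (fun i hi => (hS i).mono (noiseSigma_mono fun j (hj : _ < i) => lt_trans hj hi) le_rfl)
        (fun i hi => measurable_unif_noiseSigma (k := i) hi)
    have hmul : ∀ {f : Ω → ℝ}, Integrable f P → Integrable (fun ω => f ω * M ω) P := fun hf =>
      hf.mul_bdd (c := k * c) (hMm k).aestronglyMeasurable (hMbd k)
    set f : Ω → ℝ := fun ω => c * (1 - S k ω) * M ω with hf
    have hfi : Integrable f P := hmul (((integrable_const 1).sub (hSi k)).const_mul c)
    have hal : Measurable fun ω => alphaLim ℓ (S k ω) :=
      (continuous_alphaLim ℓ).measurable.comp (hSm k)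
    have hpair : Measurable[noiseSigma ξ U (past N k)] fun ω => (f ω, alphaLim ℓ (S k ω)) := by
      have h1 : Measurable fun p : ℝ × ℝ => (c * (1 - p.1) * p.2, alphaLim ℓ p.1) := by
        have := (continuous_alphaLim ℓ).measurable
        fun_prop
      exact h1.comp (Measurable.prodMk (hS k) hMpast)
    have hind : IndepFun (fun ω => (f ω, alphaLim ℓ (S k ω))) (U k) P :=
      h.indepFun_of_disjoint hξ hU (J := {Sum.inr k})
        ((disjoint_union_inr N k).mono_left Set.subset_union_left) hpair
        (measurable_unif_noiseSigma rfl)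
    have hfm : Measurable f := (((hSm k).const_sub 1).const_mul c).mul (hMm k)
    have hcross := integral_mul_accepted hfm hal (hU k) (h.uniform k) hind hfi
      (fun ω => alphaLim_nonneg _ _) (fun ω => alphaLim_le_one _ _)
    have hi1 := integrable_mul_accepted hal (hU k) hfi
    have hi2 : Integrable (fun ω => f ω * alphaLim ℓ (S k ω)) P :=
      hfi.mul_bdd (c := 1) hal.aestronglyMeasurable (Eventually.of_forall fun ω => by
        rw [Real.norm_eq_abs, abs_of_nonneg (alphaLim_nonneg _ _)]
        exact alphaLim_le_one _ _)
    have hM2 : Integrable (fun ω => M ω ^ 2) P := hsq (hMm k) (hMbd k)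
    have hm2 : Integrable (fun ω => mart ℓ r (S k ω) (U k ω) ^ 2) P := hsq (hmm k) (hbd k)
    have hexp : ∀ ω, (∑ i ∈ Finset.range (k + 1), mart ℓ r (S i ω) (U i ω)) ^ 2
        = M ω ^ 2 + 2 * (f ω * accepted (U k ω) (alphaLim ℓ (S k ω))
          - f ω * alphaLim ℓ (S k ω)) + mart ℓ r (S k ω) (U k ω) ^ 2 := by
      intro ω
      rw [Finset.sum_range_succ, add_sq]
      simp only [hf, hM, mart, hc]
      ring
    have hi3 : Integrable (fun ω => 2 * (f ω * accepted (U k ω) (alphaLim ℓ (S k ω))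
          - f ω * alphaLim ℓ (S k ω))) P := (hi1.sub hi2).const_mul 2
    have hi4 : Integrable (fun ω => M ω ^ 2 + 2 * (f ω * accepted (U k ω) (alphaLim ℓ (S k ω))
          - f ω * alphaLim ℓ (S k ω))) P := hM2.add hi3
    simp only [hexp]
    rw [integral_add hi4 hm2, integral_add hM2 hi3, integral_const_mul, integral_sub hi1 hi2,
      hcross, sub_self, mul_zero, add_zero]
    have hlast : ∫ ω, mart ℓ r (S k ω) (U k ω) ^ 2 ∂P ≤ c ^ 2 := by
      have : ∫ ω, mart ℓ r (S k ω) (U k ω) ^ 2 ∂P ≤ ∫ _, c ^ 2 ∂P := by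
        refine integral_mono_ae hm2 (integrable_const _) ?_
        filter_upwards [hbd k] with ω hω
        rw [← sq_abs]
        gcongr
      simpa using this
    push_cast
    linarith

/-- The expected size of the martingale, in the scaling `r = N^{-1/4}`. -/
theorem integral_abs_sum_mart_le [IsProbabilityMeasure P] (h : IsNoise P N ξ U)
    (hξ : ∀ k j, Measurable (ξ k j)) (hU : ∀ k, Measurable (U k)) {ℓ r : ℝ} (hℓ : 0 < ℓ)
    (hr : 0 < r) {S : ℕ → Ω → ℝ} (hS : ∀ k, Measurable[noiseSigma ξ U (past N k)] (S k))
    (hS0 : ∀ k ω, 0 ≤ S k ω) (hSi : ∀ k, Integrable (S k) P) {T : ℝ} {k : ℕ}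
    (hk : k * r ^ 2 ≤ T) :
    Integrable (fun ω => |∑ i ∈ Finset.range k, mart ℓ r (S i ω) (U i ω)|) P ∧
      ∫ ω, |∑ i ∈ Finset.range k, mart ℓ r (S i ω) (U i ω)| ∂P
        ≤ (4 * ℓ ^ 2 * T + 1) * r := by
  obtain ⟨h1, h2⟩ := integral_sq_sum_mart_le h hξ hU hℓ (r := r) hS hS0 hSi k
  set M : Ω → ℝ := fun ω => ∑ i ∈ Finset.range k, mart ℓ r (S i ω) (U i ω) with hM
  have hMm : Measurable M := measurable_sum_mart ℓ r
    (fun i _ => (hS i).mono (noiseSigma_le hξ hU _) le_rfl) (fun i _ => hU i)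
  have hi : Integrable (fun ω => M ω ^ 2 / r + r) P := (h1.div_const r).add (integrable_const r)
  have hle : ∀ ω, |M ω| ≤ M ω ^ 2 / r + r := fun ω => by
    have : 0 ≤ (|M ω| - r) ^ 2 / r := by positivity
    have h3 : (|M ω| - r) ^ 2 / r = M ω ^ 2 / r - 2 * |M ω| + r := by
      rw [sub_sq, sq_abs]; field_simp
    have := abs_nonneg (M ω)
    linarith
  have habs : Integrable (fun ω => |M ω|) P := by
    refine hi.mono hMm.abs.aestronglyMeasurable (Eventually.of_forall fun ω => ?_)
    rw [Real.norm_eq_abs, Real.norm_eq_abs, abs_abs]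
    exact (hle ω).trans (le_abs_self _)
  refine ⟨habs, (integral_mono habs hi hle).trans ?_⟩
  rw [integral_add (h1.div_const r) (integrable_const r), integral_div]
  simp only [integral_const, probReal_univ, one_smul]
  have h3 : (∫ ω, M ω ^ 2 ∂P) / r ≤ (k * (2 * ℓ * r ^ 2) ^ 2) / r := by gcongr
  have h4 : (k * (2 * ℓ * r ^ 2) ^ 2) / r = 4 * ℓ ^ 2 * (k * r ^ 2) * r := by
    field_simp; ring
  have h5 : 4 * ℓ ^ 2 * (k * r ^ 2) * r ≤ 4 * ℓ ^ 2 * T * r := by gcongr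
  linarith

end Filtration

/-! ### Decomposition into drift, martingale and small errors -/

section Decomposition

variable {Ω : Type*} [MeasurableSpace Ω] {P : Measure Ω} [IsProbabilityMeasure P]

/-- The error in the Euler step `S ↦ S + r² b_ℓ(S)` that is left after subtraction of the
martingale increment. -/
def remainder (ℓ r S S' u : ℝ) : ℝ := S' - S - r ^ 2 * bLim ℓ S - mart ℓ r S u

theorem lyap_chainZ_succ_le {N : ℕ} {ρ : Fin N → ℝ} {δ r c : ℝ} {G : (Fin N → ℝ) → ℝ}
    {v : (Fin N → ℝ) → Fin N → ℝ} {z₀ : Fin N → ℝ} {ξ : ℕ → Fin N → ℝ} {U : ℕ → ℝ} {k : ℕ}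
    (hc : 0 ≤ c)
    (h : lyap r ρ (propZ δ v (chainZ δ G v z₀ ξ U k) (ξ k))
      ≤ lyap r ρ (chainZ δ G v z₀ ξ U k) + c) :
    lyap r ρ (chainZ δ G v z₀ ξ U (k + 1)) ≤ lyap r ρ (chainZ δ G v z₀ ξ U k) + c := by
  simp only [chainZ]
  split_ifs
  · exact h
  · linarith

theorem abs_remainder_chainZ_le {N : ℕ} {ℓ δ r c : ℝ} (hℓ : 0 < ℓ) {G : (Fin N → ℝ) → ℝ}
    {v : (Fin N → ℝ) → Fin N → ℝ} {z₀ : Fin N → ℝ} {ξ : ℕ → Fin N → ℝ} {U : ℕ → ℝ} {k : ℕ}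
    (h : |r ^ 4 * sqNorm (propZ δ v (chainZ δ G v z₀ ξ U k) (ξ k))
        - r ^ 4 * sqNorm (chainZ δ G v z₀ ξ U k)
        - r ^ 2 * (2 * ℓ * (1 - r ^ 4 * sqNorm (chainZ δ G v z₀ ξ U k)))| ≤ c) :
    |remainder ℓ r (r ^ 4 * sqNorm (chainZ δ G v z₀ ξ U k))
        (r ^ 4 * sqNorm (chainZ δ G v z₀ ξ U (k + 1))) (U k)|
      ≤ c + 2 * ℓ * r ^ 2 * (|1 - r ^ 4 * sqNorm (chainZ δ G v z₀ ξ U k)| *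
        |accepted (U k) (accZ δ G v (chainZ δ G v z₀ ξ U k)
          (propZ δ v (chainZ δ G v z₀ ξ U k) (ξ k)))
        - accepted (U k) (alphaLim ℓ (r ^ 4 * sqNorm (chainZ δ G v z₀ ξ U k)))|) := by
  set z := chainZ δ G v z₀ ξ U k with hz
  set y := propZ δ v z (ξ k) with hy
  set S := r ^ 4 * sqNorm z with hS
  set J := accepted (U k) (alphaLim ℓ S) with hJ
  set A := accepted (U k) (accZ δ G v z y) with hA
  have hstep : r ^ 4 * sqNorm (chainZ δ G v z₀ ξ U (k + 1)) - S = A * (r ^ 4 * sqNorm y - S) := by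
    simp only [chainZ, hA, accepted]
    split_ifs
    · rw [one_mul]
    · rw [zero_mul, sub_self]
  have heq : remainder ℓ r S (r ^ 4 * sqNorm (chainZ δ G v z₀ ξ U (k + 1))) (U k)
      = A * (r ^ 4 * sqNorm y - S - r ^ 2 * (2 * ℓ * (1 - S)))
        + 2 * ℓ * r ^ 2 * ((1 - S) * (A - J)) := by
    rw [remainder, hstep, mart, bLim, hLim]
    ring
  rw [heq]
  refine (abs_add_le _ _).trans ?_
  rw [abs_mul, abs_mul (2 * ℓ * r ^ 2), abs_mul (1 - S),
    abs_of_nonneg (by positivity : 0 ≤ 2 * ℓ * r ^ 2)]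
  gcongr
  calc |A| * _ ≤ 1 * c := by
        gcongr
        rw [abs_of_nonneg (accepted_nonneg _ _)]
        exact accepted_le_one _ _
    _ = c := one_mul c

/-- Along the chain, the sum of the remainders and the time integral of the martingale are of order
`N^{-1/4}` in `L¹`, uniformly over the models with given constants. -/
theorem exists_integral_error_le {ℓ K B Λ T : ℝ} (hℓ : 0 < ℓ) (hK : 0 ≤ K) (hB : 0 ≤ B)
    (hΛ : 0 ≤ Λ) (hT : 0 ≤ T) :
    ∃ C, 0 ≤ C ∧ ∀ {N : ℕ} {ρ : Fin N → ℝ} {G : (Fin N → ℝ) → ℝ}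
      {v : (Fin N → ℝ) → Fin N → ℝ}, IsCoordModel K B ρ G v →
      ∀ r : ℝ, 0 < r → r ≤ 1 → r ^ 4 * N = 1 → ℓ * r ^ 2 ≤ 1 →
      ∀ z₀ : Fin N → ℝ, lyap r ρ z₀ ≤ Λ →
      ∀ {ξ : ℕ → Fin N → Ω → ℝ} {U : ℕ → Ω → ℝ}, IsNoise P N ξ U →
      (∀ k j, Measurable (ξ k j)) → (∀ k, Measurable (U k)) →
      ∀ S : ℕ → Ω → ℝ, (∀ k ω, S k ω = r ^ 4 * sqNorm (chainZ (ℓ * r ^ 2) G v z₀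
        (fun i j => ξ i j ω) (fun i => U i ω) k)) →
      ∀ n : ℕ, n * r ^ 2 ≤ T →
        Integrable (fun ω => ∑ k ∈ Finset.range n,
          (r ^ 2 * |∑ i ∈ Finset.range k, mart ℓ r (S i ω) (U i ω)|
            + |remainder ℓ r (S k ω) (S (k + 1) ω) (U k ω)|)) P ∧
        ∫ ω, ∑ k ∈ Finset.range n,
          (r ^ 2 * |∑ i ∈ Finset.range k, mart ℓ r (S i ω) (U i ω)|
            + |remainder ℓ r (S k ω) (S (k + 1) ω) (U k ω)|) ∂P ≤ C * r := by
  obtain ⟨C, hC, hstep⟩ := exists_oneStep_bounds hℓ hK hB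
  set D := 2 + gaussFourth + B with hD
  have hD0 : 0 ≤ D := by have := gaussFourth_nonneg; positivity
  set L := Λ * Real.exp (T * (C * D)) with hL
  have hL0 : 0 ≤ L := by positivity
  refine ⟨T * (4 * ℓ ^ 2 * T + 1) + T * ((1 + 2 * ℓ) * (C * (D * L))), by positivity, ?_⟩
  intro N ρ G v hmod r hr hr1 hN hδ z₀ hz₀ ξ U hnoise hξ hU S hS n hn
  set δ := ℓ * r ^ 2 with hδdef
  set z : ℕ → Ω → Fin N → ℝ := fun k ω =>
    chainZ δ G v z₀ (fun i j => ξ i j ω) (fun i => U i ω) k with hzdef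
  set η : ℕ → Ω → Fin N → ℝ := fun k ω j => ξ k j ω with hηdef
  have hzpast : ∀ k, Measurable[noiseSigma ξ U (past N k)] (z k) := fun k =>
    @measurable_chainZ N Ω (noiseSigma ξ U (past N k)) δ G v hmod.measurable_pot
      hmod.measurable_grad z₀ ξ U k
      (fun i hi j => measurable_gauss_noiseSigma (k := i) (j := j) hi)
      (fun i hi => measurable_unif_noiseSigma (k := i) hi)
  have hηidx : ∀ k, Measurable[noiseSigma ξ U (gaussIdx N k)] (η k) := fun k =>
    @measurable_pi_lambda Ω (Fin N) _ (noiseSigma ξ U (gaussIdx N k)) _ (η k)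
      (fun j => measurable_gauss_noiseSigma ⟨j, rfl⟩)
  have hzm : ∀ k, Measurable (z k) := fun k => (hzpast k).mono (noiseSigma_le hξ hU _) le_rfl
  have hηm : ∀ k, Measurable (η k) := fun k => measurable_pi_lambda _ (hξ k)
  have hfl : ∀ k, Integrable (fun ω => lyap r ρ (z k ω)) P →
      Integrable (fun ω => fluct r ρ (z k ω) (η k ω)) P ∧
      ∫ ω, fluct r ρ (z k ω) (η k ω) ∂P ≤ D * ∫ ω, lyap r ρ (z k ω) ∂P := fun k hk =>
    integral_fluct_le (hzm k) (hηm k)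
      (hnoise.indepFun_of_disjoint hξ hU (disjoint_past_gaussIdx N k) (hzpast k) (hηidx k))
      (fun j => hnoise.gaussian k j)
      (fun i j hij => hnoise.indep.indepFun
        (i := (Sum.inl (k, i) : (ℕ × Fin N) ⊕ ℕ)) (j := Sum.inl (k, j)) (by simpa using hij))
      hr hN hmod.sum_weights hk
  -- Moments of the Lyapunov function.
  have hV : ∀ k, Integrable (fun ω => lyap r ρ (z k ω)) P ∧
      ∫ ω, lyap r ρ (z k ω) ∂P ≤ Λ * (1 + r ^ 2 * (C * D)) ^ k := by
    intro k
    induction k with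
    | zero =>
      have : ∀ ω, lyap r ρ (z 0 ω) = lyap r ρ z₀ := fun ω => rfl
      simp only [this]
      exact ⟨integrable_const _, by simpa using hz₀⟩
    | succ k ih =>
      obtain ⟨hi, hle⟩ := ih
      obtain ⟨hΦi, hΦ⟩ := hfl k hi
      have hi2 : Integrable (fun ω => lyap r ρ (z k ω)
          + r ^ 2 * (C * fluct r ρ (z k ω) (η k ω))) P :=
        hi.add ((hΦi.const_mul C).const_mul (r ^ 2))
      have hpt : ∀ ω, lyap r ρ (z (k + 1) ω)
          ≤ lyap r ρ (z k ω) + r ^ 2 * (C * fluct r ρ (z k ω) (η k ω)) := fun ω =>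
        lyap_chainZ_succ_le
          (by have := zero_le_one.trans (one_le_fluct (r := r) ρ (z k ω) (η k ω)); positivity)
          (hstep hmod r hr hr1 hN hδ (z k ω) (η k ω)).2.2
      have hi3 : Integrable (fun ω => lyap r ρ (z (k + 1) ω)) P := by
        refine hi2.mono ((measurable_lyap r ρ).comp (hzm (k + 1))).aestronglyMeasurable
          (Eventually.of_forall fun ω => ?_)
        rw [Real.norm_eq_abs, Real.norm_eq_abs,
          abs_of_nonneg (zero_le_one.trans (one_le_lyap _ _))]
        exact (hpt ω).trans (le_abs_self _)
      refine ⟨hi3, (integral_mono hi3 hi2 hpt).trans ?_⟩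
      rw [integral_add hi ((hΦi.const_mul C).const_mul (r ^ 2)), integral_const_mul,
        integral_const_mul]
      calc _ ≤ ∫ ω, lyap r ρ (z k ω) ∂P + r ^ 2 * (C * (D * ∫ ω, lyap r ρ (z k ω) ∂P)) := by
            gcongr
        _ = (∫ ω, lyap r ρ (z k ω) ∂P) * (1 + r ^ 2 * (C * D)) := by ring
        _ ≤ (Λ * (1 + r ^ 2 * (C * D)) ^ k) * (1 + r ^ 2 * (C * D)) := by gcongr
        _ = _ := by rw [pow_succ]; ring
  have hkT : ∀ k < n, k * r ^ 2 ≤ T := fun k hk =>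
    le_trans (by have : (k : ℝ) ≤ n := by exact_mod_cast hk.le
                 gcongr) hn
  have hVL : ∀ k < n, ∫ ω, lyap r ρ (z k ω) ∂P ≤ L := by
    intro k hk
    refine (hV k).2.trans ?_
    rw [hL]
    gcongr
    calc (1 + r ^ 2 * (C * D)) ^ k ≤ Real.exp (r ^ 2 * (C * D)) ^ k := by
          gcongr
          linarith [Real.add_one_le_exp (r ^ 2 * (C * D))]
      _ = Real.exp ((k * r ^ 2) * (C * D)) := by rw [← Real.exp_nat_mul]; ring_nf
      _ ≤ Real.exp (T * (C * D)) := by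
          have := hkT k hk
          gcongr
  have hSz : ∀ k ω, S k ω = r ^ 4 * sqNorm (z k ω) := hS
  have hS0 : ∀ k ω, 0 ≤ S k ω := fun k ω => by
    rw [hSz]; exact mul_nonneg (by positivity) (sqNorm_nonneg _)
  have hSpast : ∀ k, Measurable[noiseSigma ξ U (past N k)] (S k) := fun k => by
    have : S k = (fun w => r ^ 4 * sqNorm w) ∘ z k := funext (hSz k)
    rw [this]
    exact (measurable_sqNorm.const_mul (r ^ 4)).comp (hzpast k)
  have hSm : ∀ k, Measurable (S k) := fun k => (hSpast k).mono (noiseSigma_le hξ hU _) le_rfl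
  have hSi : ∀ k, Integrable (S k) P := fun k => by
    refine (hV k).1.mono (hSm k).aestronglyMeasurable (Eventually.of_forall fun ω => ?_)
    rw [Real.norm_eq_abs, Real.norm_eq_abs, abs_of_nonneg (hS0 k ω),
      abs_of_nonneg (zero_le_one.trans (one_le_lyap _ _)), hSz]
    have h2 : 0 ≤ r ^ 2 * wSq ρ (z k ω) := mul_nonneg (by positivity) (wSq_nonneg _ _)
    unfold lyap; linarith
  have hmart : ∀ k < n, Integrable (fun ω => |∑ i ∈ Finset.range k, mart ℓ r (S i ω) (U i ω)|) P ∧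
      ∫ ω, |∑ i ∈ Finset.range k, mart ℓ r (S i ω) (U i ω)| ∂P ≤ (4 * ℓ ^ 2 * T + 1) * r :=
    fun k hk => integral_abs_sum_mart_le hnoise hξ hU hℓ hr hSpast hS0 hSi (hkT k hk)
  have hrem : ∀ k < n, Integrable (fun ω => |remainder ℓ r (S k ω) (S (k + 1) ω) (U k ω)|) P ∧
      ∫ ω, |remainder ℓ r (S k ω) (S (k + 1) ω) (U k ω)| ∂P
        ≤ r ^ 3 * ((1 + 2 * ℓ) * (C * (D * L))) := by
    intro k hk
    obtain ⟨hΦi, hΦ⟩ := hfl k (hV k).1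
    have hΦL : ∫ ω, fluct r ρ (z k ω) (η k ω) ∂P ≤ D * L :=
      hΦ.trans (mul_le_mul_of_nonneg_left (hVL k hk) hD0)
    set a : Ω → ℝ := fun ω => accZ δ G v (z k ω) (propZ δ v (z k ω) (η k ω)) with ha
    set b : Ω → ℝ := fun ω => alphaLim ℓ (S k ω) with hb
    set f : Ω → ℝ := fun ω => |1 - S k ω| with hf
    have hfi : Integrable f P := ((integrable_const 1).sub (hSi k)).abs
    have hI : past N k ⊆ past N k ∪ gaussIdx N k := Set.subset_union_left
    have hzp := (hzpast k).mono (noiseSigma_mono hI) le_rfl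
    have hSp := (hSpast k).mono (noiseSigma_mono hI) le_rfl
    have hηp := (hηidx k).mono (noiseSigma_mono (Set.subset_union_right (s := past N k))) le_rfl
    have hap : Measurable[noiseSigma ξ U (past N k ∪ gaussIdx N k)] a :=
      measurable_accZ δ hmod.measurable_pot hmod.measurable_grad hzp
        (measurable_propZ δ hmod.measurable_grad hzp hηp)
    have hbp : Measurable[noiseSigma ξ U (past N k ∪ gaussIdx N k)] b :=
      (continuous_alphaLim ℓ).measurable.comp hSp
    have hfp : Measurable[noiseSigma ξ U (past N k ∪ gaussIdx N k)] f :=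
      (show Measurable fun x : ℝ => |1 - x| by fun_prop).comp hSp
    have hle := noiseSigma_le hξ hU (past N k ∪ gaussIdx N k)
    have ham := hap.mono hle le_rfl
    have hbm := hbp.mono hle le_rfl
    have hfm := hfp.mono hle le_rfl
    have hind : IndepFun (fun ω => (f ω, a ω, b ω)) (U k) P :=
      hnoise.indepFun_of_disjoint hξ hU (J := {Sum.inr k}) (disjoint_union_inr N k)
        (hfp.prodMk (hap.prodMk hbp)) (measurable_unif_noiseSigma rfl)
    have hacc := integral_mul_abs_accepted_sub hfm ham hbm (hU k) (hnoise.uniform k) hind hfi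
      (fun ω => accZ_nonneg _ _ _ _ _) (fun ω => accZ_le_one _ _ _ _ _)
      (fun ω => alphaLim_nonneg _ _) (fun ω => alphaLim_le_one _ _)
    have hmabs : Measurable fun ω => |accepted (U k ω) (a ω) - accepted (U k ω) (b ω)| :=
      ((measurable_accepted.comp ((hU k).prodMk ham)).sub
        (measurable_accepted.comp ((hU k).prodMk hbm))).abs
    have hi1 : Integrable (fun ω => f ω * |accepted (U k ω) (a ω) - accepted (U k ω) (b ω)|) P :=
      hfi.mul_bdd (c := 1) hmabs.aestronglyMeasurable (Eventually.of_forall fun ω => by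
        rw [Real.norm_eq_abs, abs_abs, abs_le]
        have := accepted_nonneg (U k ω) (a ω)
        have := accepted_nonneg (U k ω) (b ω)
        have := accepted_le_one (U k ω) (a ω)
        have := accepted_le_one (U k ω) (b ω)
        constructor <;> linarith)
    have hi2 : Integrable (fun ω => f ω * |a ω - b ω|) P :=
      hfi.mul_bdd (c := 1) (ham.sub hbm).abs.aestronglyMeasurable (Eventually.of_forall fun ω => by
        rw [Real.norm_eq_abs, abs_abs, abs_le]
        have h1 : 0 ≤ a ω := accZ_nonneg _ _ _ _ _
        have h2 : a ω ≤ 1 := accZ_le_one _ _ _ _ _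
        have h3 : 0 ≤ b ω := alphaLim_nonneg _ _
        have h4 : b ω ≤ 1 := alphaLim_le_one _ _
        constructor <;> linarith)
    have hab : ∫ ω, f ω * |a ω - b ω| ∂P ≤ r * (C * (D * L)) := by
      refine (integral_mono hi2 ((hΦi.const_mul C).const_mul r) fun ω => ?_).trans ?_
      · have := (hstep hmod r hr hr1 hN hδ (z k ω) (η k ω)).2.1
        simp only [hf, ha, hb, hSz]
        exact this
      · rw [integral_const_mul, integral_const_mul]
        gcongr
    have hi3 := (hΦi.const_mul C).const_mul (r ^ 3)
    have hi4 := hi1.const_mul (2 * ℓ * r ^ 2)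
    have hpt : ∀ ω, |remainder ℓ r (S k ω) (S (k + 1) ω) (U k ω)|
        ≤ r ^ 3 * (C * fluct r ρ (z k ω) (η k ω)) + 2 * ℓ * r ^ 2 *
          (f ω * |accepted (U k ω) (a ω) - accepted (U k ω) (b ω)|) := by
      intro ω
      have := abs_remainder_chainZ_le (G := G) (z₀ := z₀) (U := fun i => U i ω)
        (ξ := fun i j => ξ i j ω) (k := k) hℓ
        (hstep hmod r hr hr1 hN hδ (z k ω) (η k ω)).1
      simp only [hf, ha, hb, hSz]
      exact this
    have hremm : Measurable fun ω => remainder ℓ r (S k ω) (S (k + 1) ω) (U k ω) := by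
      unfold remainder
      exact (((hSm (k + 1)).sub (hSm k)).sub
        (((lipschitzWith_bLim hℓ.le).continuous.measurable.comp (hSm k)).const_mul _)).sub
          (measurable_mart ℓ r (hSm k) (hU k))
    have hi5 : Integrable (fun ω => |remainder ℓ r (S k ω) (S (k + 1) ω) (U k ω)|) P := by
      refine (hi3.add hi4).mono hremm.abs.aestronglyMeasurable (Eventually.of_forall fun ω => ?_)
      rw [Real.norm_eq_abs, abs_abs]
      exact (hpt ω).trans (le_abs_self _)
    refine ⟨hi5, (integral_mono hi5 (hi3.add hi4) hpt).trans ?_⟩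
    have hsplit := integral_add hi3 hi4
    rw [integral_const_mul, integral_const_mul, integral_const_mul, hacc] at hsplit
    refine (le_of_eq hsplit).trans ?_
    calc _ ≤ r ^ 3 * (C * (D * L)) + 2 * ℓ * r ^ 2 * (r * (C * (D * L))) := by gcongr
      _ = _ := by ring
  have hterm : ∀ k ∈ Finset.range n, Integrable (fun ω =>
      r ^ 2 * |∑ i ∈ Finset.range k, mart ℓ r (S i ω) (U i ω)|
        + |remainder ℓ r (S k ω) (S (k + 1) ω) (U k ω)|) P := fun k hk =>
    ((hmart k (Finset.mem_range.1 hk)).1.const_mul _).add (hrem k (Finset.mem_range.1 hk)).1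
  refine ⟨integrable_finsetSum _ hterm, ?_⟩
  rw [integral_finsetSum _ hterm]
  have hbound : ∀ k ∈ Finset.range n, ∫ ω, (r ^ 2 * |∑ i ∈ Finset.range k, mart ℓ r (S i ω) (U i ω)|
        + |remainder ℓ r (S k ω) (S (k + 1) ω) (U k ω)|) ∂P
      ≤ r ^ 2 * ((4 * ℓ ^ 2 * T + 1) * r) + r ^ 3 * ((1 + 2 * ℓ) * (C * (D * L))) := by
    intro k hk
    have hk' := Finset.mem_range.1 hk
    rw [integral_add ((hmart k hk').1.const_mul _) (hrem k hk').1, integral_const_mul]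
    gcongr
    · exact (hmart k hk').2
    · exact (hrem k hk').2
  refine (Finset.sum_le_sum hbound).trans ?_
  rw [Finset.sum_const, Finset.card_range, nsmul_eq_mul]
  calc _ = (n * r ^ 2) * (((4 * ℓ ^ 2 * T + 1) + (1 + 2 * ℓ) * (C * (D * L))) * r) := by ring
    _ ≤ T * (((4 * ℓ ^ 2 * T + 1) + (1 + 2 * ℓ) * (C * (D * L))) * r) := by gcongr
    _ = _ := by ring

end Decomposition

/-! ### Stability of the Euler scheme under small perturbations -/

/-- A partial sum of increments that are bounded by `c` is controlled uniformly in time by its time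
average. -/
theorem sq_sum_le_of_abs_le {m : ℕ → ℝ} {c : ℝ} (hm : ∀ k, |m k| ≤ c) (k : ℕ) :
    (∑ i ∈ Finset.range k, m i) ^ 2
      ≤ 2 * c * ∑ i ∈ Finset.range k, |∑ l ∈ Finset.range i, m l| + k * c ^ 2 := by
  induction k with
  | zero => simp
  | succ k ih =>
    rw [Finset.sum_range_succ, Finset.sum_range_succ _ k]
    set M := ∑ i ∈ Finset.range k, m i
    have h1 : M * m k ≤ c * |M| := by
      calc M * m k ≤ |M * m k| := le_abs_self _
        _ = |m k| * |M| := by rw [abs_mul, mul_comm]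
        _ ≤ c * |M| := by gcongr; exact hm k
    have h2 : m k ^ 2 ≤ c ^ 2 := by rw [← sq_abs]; gcongr; exact hm k
    push_cast
    nlinarith

/-- Discrete Grönwall estimate for the Euler scheme of a Lipschitz vector field, perturbed by
increments `m` that enter through their partial sums and by errors `e`. -/
theorem abs_sub_sub_sum_le {b : ℝ → ℝ} {L h ε : ℝ} (hL : 0 ≤ L) (hh : 0 ≤ h)
    (hb : ∀ p q, |b p - b q| ≤ L * |p - q|) {S σ m e : ℕ → ℝ} {n : ℕ}
    (hS : ∀ k, S (k + 1) = S k + h * b (S k) + m k + e k)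
    (hσ : ∀ k < n, |σ (k + 1) - σ k - h * b (σ k)| ≤ ε) (hε : 0 ≤ ε) {k : ℕ} (hk : k ≤ n) :
    |S k - σ k - ∑ i ∈ Finset.range k, m i| ≤ Real.exp (k * (L * h)) * (|S 0 - σ 0|
      + ∑ i ∈ Finset.range k, (L * h * |∑ l ∈ Finset.range i, m l| + |e i|) + k * ε) := by
  induction k with
  | zero => simp
  | succ k ih =>
    have ih' := ih (Nat.le_of_succ_le hk)
    set M := ∑ i ∈ Finset.range k, m i with hM
    set G := S k - σ k - M with hG
    set X := |S 0 - σ 0|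
      + ∑ i ∈ Finset.range k, (L * h * |∑ l ∈ Finset.range i, m l| + |e i|) + k * ε with hX
    have hX0 : 0 ≤ X := by positivity
    have heq : S (k + 1) - σ (k + 1) - ∑ i ∈ Finset.range (k + 1), m i
        = G + h * (b (S k) - b (σ k)) + (e k + -(σ (k + 1) - σ k - h * b (σ k))) := by
      rw [hS, Finset.sum_range_succ]; ring
    have hD : |S k - σ k| ≤ |G| + |M| := by
      have : S k - σ k = G + M := by rw [hG]; ring
      rw [this]; exact abs_add_le _ _
    have h1 : |h * (b (S k) - b (σ k))| ≤ L * h * (|G| + |M|) := by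
      rw [abs_mul, abs_of_nonneg hh]
      calc h * |b (S k) - b (σ k)| ≤ h * (L * (|G| + |M|)) := by
            gcongr; exact (hb _ _).trans (by gcongr)
        _ = _ := by ring
    have h2 : |e k + -(σ (k + 1) - σ k - h * b (σ k))| ≤ |e k| + ε := by
      refine (abs_add_le _ _).trans ?_
      rw [abs_neg]
      gcongr
      exact hσ k hk
    have h3 : |S (k + 1) - σ (k + 1) - ∑ i ∈ Finset.range (k + 1), m i|
        ≤ (1 + L * h) * |G| + (L * h * |M| + |e k| + ε) := by
      rw [heq]
      refine (abs_add_three _ _ _).trans ?_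
      linarith
    have h4 : 1 + L * h ≤ Real.exp (L * h) := by linarith [Real.add_one_le_exp (L * h)]
    have h5 : Real.exp ((k + 1 : ℕ) * (L * h)) = Real.exp (L * h) * Real.exp (k * (L * h)) := by
      rw [← Real.exp_add]; push_cast; ring_nf
    have h6 : 1 ≤ Real.exp ((k + 1 : ℕ) * (L * h)) := Real.one_le_exp (by positivity)
    refine h3.trans ?_
    calc (1 + L * h) * |G| + (L * h * |M| + |e k| + ε)
        ≤ Real.exp (L * h) * (Real.exp (k * (L * h)) * X) + 1 * (L * h * |M| + |e k| + ε) := by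
          rw [one_mul]; gcongr
      _ ≤ Real.exp (L * h) * (Real.exp (k * (L * h)) * X)
          + Real.exp ((k + 1 : ℕ) * (L * h)) * (L * h * |M| + |e k| + ε) := by gcongr
      _ = _ := by
          rw [h5, Finset.sum_range_succ, hX]; push_cast; ring

theorem abs_linInterp_sub_le {a : ℕ → ℝ} {σ : ℝ → ℝ} {h T R D : ℝ} (hh : 0 < h) (hh1 : h ≤ 1)
    (hR : ∀ k : ℕ, k * h ≤ T + 1 → |a k - σ (k * h)| ≤ R) (hD : 0 ≤ D)
    (hσ : ∀ t ∈ Set.Icc 0 (T + 1), ∀ u ∈ Set.Icc 0 (T + 1), |σ u - σ t| ≤ D * |u - t|)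
    {t : ℝ} (ht : t ∈ Set.Icc 0 T) : |linInterp a (h⁻¹ * t) - σ t| ≤ R + D * h := by
  set u := h⁻¹ * t with hu
  have hu0 : 0 ≤ u := mul_nonneg (inv_nonneg.2 hh.le) ht.1
  have htu : t = u * h := by rw [hu]; field_simp
  set k := ⌊u⌋₊ with hk
  have h1 : (k : ℝ) ≤ u := Nat.floor_le hu0
  have h2 : u < k + 1 := Nat.lt_floor_add_one u
  have hkT : (k : ℝ) * h ≤ t := by rw [htu]; gcongr
  have hkT' : ((k + 1 : ℕ) : ℝ) * h ≤ t + h := by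
    push_cast; rw [htu, add_mul, one_mul]; gcongr
  have hk1 : t ≤ ((k + 1 : ℕ) : ℝ) * h := by push_cast; rw [htu]; gcongr
  have hk0 : 0 ≤ (k : ℝ) * h := by positivity
  have htI : t ∈ Set.Icc 0 (T + 1) := ⟨ht.1, by linarith [ht.2]⟩
  have e0 : |a k - σ t| ≤ R + D * h := by
    have h3 := hR k (by linarith [ht.2])
    have h4 := hσ t htI (k * h) ⟨hk0, by linarith [ht.2]⟩
    have h5 : |k * h - t| ≤ h := by
      rw [abs_le]; constructor <;> [skip; linarith]
      push_cast at hk1; linarith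
    calc |a k - σ t| ≤ |a k - σ (k * h)| + |σ (k * h) - σ t| := abs_sub_le _ _ _
      _ ≤ R + D * h := by gcongr; exact h4.trans (by gcongr)
  have e1 : |a (k + 1) - σ t| ≤ R + D * h := by
    have h3 := hR (k + 1) (by linarith [ht.2])
    have h4 := hσ t htI ((k + 1 : ℕ) * h) ⟨by linarith [ht.1], by linarith [ht.2]⟩
    have h5 : |((k + 1 : ℕ) : ℝ) * h - t| ≤ h := by rw [abs_le]; constructor <;> linarith
    calc |a (k + 1) - σ t| ≤ |a (k + 1) - σ ((k + 1 : ℕ) * h)| + |σ ((k + 1 : ℕ) * h) - σ t| :=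
          abs_sub_le _ _ _
      _ ≤ R + D * h := by gcongr; exact h4.trans (by gcongr)
  have heq : linInterp a u - σ t = (u - k) * (a (k + 1) - σ t) + (k + 1 - u) * (a k - σ t) := by
    rw [linInterp]; ring
  rw [heq]
  refine (abs_add_le _ _).trans ?_
  rw [abs_mul, abs_mul, abs_of_nonneg (by linarith : 0 ≤ u - k),
    abs_of_nonneg (by linarith : 0 ≤ (k : ℝ) + 1 - u)]
  calc _ ≤ (u - k) * (R + D * h) + (k + 1 - u) * (R + D * h) :=
        add_le_add (mul_le_mul_of_nonneg_left e1 (by linarith))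
          (mul_le_mul_of_nonneg_left e0 (by linarith))
    _ = _ := by ring

/-- Distance in `C([0, T])` of the interpolated chain from the solution of the limiting equation, in
terms of the sum `Θ` of the martingale and the remainders. -/
theorem abs_linInterp_sub_solution_le {ℓ r T D Θ : ℝ} (hℓ : 0 < ℓ) (hr : 0 < r) (hr1 : r ≤ 1)
    {σ : ℝ → ℝ} (hD : 0 ≤ D)
    (hσ : ∀ t ∈ Set.Icc 0 (T + 1), ∀ u ∈ Set.Icc 0 (T + 1), |σ u - σ t| ≤ D * |u - t|)
    (hσ' : ∀ t ∈ Set.Icc 0 (T + 1), ∀ h, 0 ≤ h → t + h ≤ T + 1 →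
        |σ (t + h) - σ t - h * bLim ℓ (σ t)| ≤ 2 * ℓ * D * h ^ 2)
    {S U : ℕ → ℝ} (hm : ∀ k, |mart ℓ r (S k) (U k)| ≤ 2 * ℓ * r ^ 2) {n : ℕ}
    (hn : n * r ^ 2 ≤ T + 1) (hn' : ∀ k : ℕ, k * r ^ 2 ≤ T + 1 → k ≤ n)
    (hΘ : ∑ k ∈ Finset.range n, (r ^ 2 * |∑ i ∈ Finset.range k, mart ℓ r (S i) (U i)|
      + |remainder ℓ r (S k) (S (k + 1)) (U k)|) = Θ) {t : ℝ} (ht : t ∈ Set.Icc 0 T) :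
    |linInterp S ((r ^ 2)⁻¹ * t) - σ t| ≤ Real.exp (2 * ℓ * (T + 1)) * (|S 0 - σ 0|
      + (2 * ℓ + 1) * Θ + (T + 1) * (2 * ℓ * D) * r ^ 2)
      + √(4 * ℓ * Θ + 4 * ℓ ^ 2 * (T + 1) * r ^ 2) + D * r ^ 2 := by
  have hr2 : 0 < r ^ 2 := by positivity
  refine abs_linInterp_sub_le hr2 (pow_le_one₀ hr.le hr1) (fun k hk => ?_) hD hσ ht
  have hkn := hn' k hk
  set m : ℕ → ℝ := fun k => mart ℓ r (S k) (U k) with hmdef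
  set e : ℕ → ℝ := fun k => remainder ℓ r (S k) (S (k + 1)) (U k) with hedef
  have hmono : ∀ f : ℕ → ℝ, (∀ i, 0 ≤ f i) →
      ∑ i ∈ Finset.range k, f i ≤ ∑ i ∈ Finset.range n, f i := fun f hf =>
    Finset.sum_le_sum_of_subset_of_nonneg (Finset.range_mono hkn) fun i _ _ => hf i
  have hΘ0 : 0 ≤ Θ := by rw [← hΘ]; positivity
  have hG := abs_sub_sub_sum_le (b := bLim ℓ) (L := 2 * ℓ) (h := r ^ 2) (S := S)
    (σ := fun k => σ (k * r ^ 2)) (m := m) (e := e) (n := n) (ε := 2 * ℓ * D * (r ^ 2) ^ 2)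
    (by positivity) hr2.le (abs_bLim_sub_le hℓ.le)
    (fun k => by simp only [hmdef, hedef, remainder]; ring)
    (fun k hk => by
      have hk' : ((k + 1 : ℕ) : ℝ) ≤ n := by exact_mod_cast hk
      have h1 : ((k + 1 : ℕ) : ℝ) * r ^ 2 ≤ T + 1 := le_trans (by gcongr) hn
      have h2 : ((k + 1 : ℕ) : ℝ) * r ^ 2 = k * r ^ 2 + r ^ 2 := by push_cast; ring
      rw [h2] at h1 ⊢
      exact hσ' (k * r ^ 2) ⟨by positivity, by linarith⟩ (r ^ 2) hr2.le h1)
    (by positivity) hkn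
  have hMsq := sq_sum_le_of_abs_le hm k
  have h1 : ∑ i ∈ Finset.range k, (2 * ℓ * r ^ 2 * |∑ l ∈ Finset.range i, m l| + |e i|)
      ≤ (2 * ℓ + 1) * Θ := by
    rw [← hΘ, Finset.mul_sum]
    refine (Finset.sum_le_sum fun i _ => ?_).trans (hmono _ fun i => by positivity)
    have h2 : 0 ≤ r ^ 2 * |∑ l ∈ Finset.range i, m l| := by positivity
    have h3 := abs_nonneg (e i)
    simp only [hmdef, hedef] at h2 h3 ⊢
    nlinarith
  have h2 : |∑ i ∈ Finset.range k, m i| ≤ √(4 * ℓ * Θ + 4 * ℓ ^ 2 * (T + 1) * r ^ 2) := by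
    refine Real.abs_le_sqrt (hMsq.trans ?_)
    have h3 : r ^ 2 * ∑ i ∈ Finset.range k, |∑ l ∈ Finset.range i, m l| ≤ Θ := by
      rw [← hΘ, Finset.mul_sum]
      refine (Finset.sum_le_sum fun i _ => ?_).trans (hmono _ fun i => by positivity)
      simp only [hmdef]
      linarith [abs_nonneg (remainder ℓ r (S i) (S (i + 1)) (U i))]
    have h4 : (k : ℝ) * (2 * ℓ * r ^ 2) ^ 2 ≤ 4 * ℓ ^ 2 * (T + 1) * r ^ 2 := by
      calc (k : ℝ) * (2 * ℓ * r ^ 2) ^ 2 = 4 * ℓ ^ 2 * (k * r ^ 2) * r ^ 2 := by ring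
        _ ≤ _ := by gcongr
    have h5 : 2 * (2 * ℓ * r ^ 2) * ∑ i ∈ Finset.range k, |∑ l ∈ Finset.range i, m l|
        ≤ 4 * ℓ * Θ := by
      calc _ = 4 * ℓ * (r ^ 2 * ∑ i ∈ Finset.range k, |∑ l ∈ Finset.range i, m l|) := by ring
        _ ≤ _ := by gcongr
    linarith
  have h6 : |S k - σ (k * r ^ 2)| ≤ |S k - σ (k * r ^ 2) - ∑ i ∈ Finset.range k, m i|
      + |∑ i ∈ Finset.range k, m i| := by
    simpa using abs_add_le (S k - σ (k * r ^ 2) - ∑ i ∈ Finset.range k, m i)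
      (∑ i ∈ Finset.range k, m i)
  refine h6.trans (add_le_add (hG.trans ?_) h2)
  simp only [Nat.cast_zero, zero_mul]
  have h7 : (k : ℝ) * (2 * ℓ * r ^ 2) ≤ 2 * ℓ * (T + 1) := by
    calc (k : ℝ) * (2 * ℓ * r ^ 2) = 2 * ℓ * (k * r ^ 2) := by ring
      _ ≤ _ := by gcongr
  have h8 : (k : ℝ) * (2 * ℓ * D * (r ^ 2) ^ 2) ≤ (T + 1) * (2 * ℓ * D) * r ^ 2 := by
    calc (k : ℝ) * (2 * ℓ * D * (r ^ 2) ^ 2) = (k * r ^ 2) * (2 * ℓ * D) * r ^ 2 := by ring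
      _ ≤ _ := by gcongr
  gcongr

/-- Convergence in probability from convergence to zero in `L¹` of quantities that control the
distance. -/
theorem tendstoInMeasure_of_control {Ω E : Type*} [MeasurableSpace Ω] {P : Measure Ω}
    [IsProbabilityMeasure P] [PseudoMetricSpace E] {f : ℕ → Ω → E} {g : E} {Θ : ℕ → Ω → ℝ}
    {x : ℕ → ℝ} (hx : Tendsto x atTop (𝓝 0)) (hΘ0 : ∀ N ω, 0 ≤ Θ N ω)
    (hΘ : ∀ᶠ N in atTop, Integrable (Θ N) P ∧ ∫ ω, Θ N ω ∂P ≤ x N)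
    (hf : ∀ ε > 0, ∃ η > 0, ∀ᶠ N in atTop, ∀ᵐ ω ∂P, Θ N ω < η → dist (f N ω) g < ε) :
    TendstoInMeasure P f atTop fun _ => g := by
  rw [tendstoInMeasure_iff_dist]
  intro ε hε
  obtain ⟨η, hη, hf⟩ := hf ε hε
  have hlim : Tendsto (fun N => ENNReal.ofReal (x N / η)) atTop (𝓝 0) := by
    have := ENNReal.tendsto_ofReal (hx.div_const η)
    simpa using this
  refine tendsto_of_tendsto_of_tendsto_of_le_of_le' tendsto_const_nhds hlim
    (Eventually.of_forall fun _ => zero_le) ?_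
  filter_upwards [hf, hΘ] with N hN hΘN
  have h1 : P {ω | ε ≤ dist (f N ω) g} ≤ P {ω | η ≤ Θ N ω} := by
    refine measure_mono_ae ?_
    filter_upwards [hN] with ω hω
    intro (h : ε ≤ dist (f N ω) g)
    exact not_lt.1 fun hlt => absurd (hω hlt) (not_lt.2 h)
  have h2 := mul_meas_ge_le_integral_of_nonneg (Eventually.of_forall (hΘ0 N)) hΘN.1 η
  have h3 : P.real {ω | η ≤ Θ N ω} ≤ x N / η := by
    rw [le_div_iff₀ hη, mul_comm]
    exact h2.trans hΘN.2
  refine h1.trans ?_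
  rw [← ofReal_measureReal]
  exact ENNReal.ofReal_le_ofReal h3

/-! ### Rescaled coordinates on `X^N` -/

section Coordinates

variable {H : Type*} [NormedAddCommGroup H] [InnerProductSpace ℝ H]
variable (φ : HilbertBasis ℕ ℝ H) (s : ℝ) (lam : ℕ → ℝ) (N : ℕ)

/-- The point of `X^N` with rescaled coordinates `z`, that is, `∑ λ_j z_j φ_j`. -/
def embZ : (Fin N → ℝ) →ₗ[ℝ] H :=
  ∑ j : Fin N, (LinearMap.proj j : (Fin N → ℝ) →ₗ[ℝ] ℝ).smulRight (lam j • φ j)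

/-- The point of `X^N` with rescaled coordinates `z`, as an element of `H^s`. -/
def embS : (Fin N → ℝ) →ₗ[ℝ] SobolevSpace φ s :=
  ∑ j : Fin N, (LinearMap.proj j : (Fin N → ℝ) →ₗ[ℝ] ℝ).smulRight (lam j • basisVec φ s j)

theorem embZ_apply (z : Fin N → ℝ) : embZ φ lam N z = ∑ j : Fin N, z j • lam j • φ j := by
  simp [embZ, LinearMap.sum_apply]

theorem embS_apply (z : Fin N → ℝ) :
    embS φ s lam N z = ∑ j : Fin N, z j • lam j • basisVec φ s j := by
  simp [embS, LinearMap.sum_apply]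

theorem inner_basis (i j : ℕ) : inner ℝ (φ i) (φ j) = if i = j then (1 : ℝ) else 0 :=
  orthonormal_iff_ite.1 φ.orthonormal i j

variable {N} in
theorem inner_embZ (z : Fin N → ℝ) (i : Fin N) :
    inner ℝ (φ i) (embZ φ lam N z) = lam i * z i := by
  rw [embZ_apply, inner_sum]
  simp only [inner_smul_right, inner_basis, Fin.val_inj]
  simp [mul_comm]

variable {N} in
theorem inner_embZ_of_le (z : Fin N → ℝ) {i : ℕ} (hi : N ≤ i) :
    inner ℝ (φ i) (embZ φ lam N z) = 0 := by
  rw [embZ_apply, inner_sum]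
  refine Finset.sum_eq_zero fun j _ => ?_
  have : i ≠ j := (j.2.trans_le hi).ne'
  simp [inner_smul_right, inner_basis, this]

theorem toH_embS (z : Fin N → ℝ) : SobolevSpace.toH φ s (embS φ s lam N z) = embZ φ lam N z := by
  rw [embS_apply, embZ_apply, map_sum]
  refine Finset.sum_congr rfl fun j _ => ?_
  rw [map_smul, map_smul]
  rfl

theorem norm_sq_sobolev (x : SobolevSpace φ s) :
    ‖x‖ ^ 2 = ∑' j : ℕ, ((j : ℝ) + 1) ^ (2 * s) * (inner ℝ (φ j) (SobolevSpace.toH φ s x)) ^ 2 := by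
  rw [← real_inner_self_eq_norm_sq]
  refine tsum_congr fun j => ?_
  rw [pow_two]
  rfl

/-- The weights of the norm of `H^s` in rescaled coordinates. -/
def sobWeight (j : Fin N) : ℝ := ((j : ℝ) + 1) ^ s * lam j

theorem rpow_two_mul_eq (j : ℕ) : ((j : ℝ) + 1) ^ (2 * s) = (((j : ℝ) + 1) ^ s) ^ 2 := by
  rw [mul_comm, Real.rpow_mul (by positivity), Real.rpow_two]

theorem norm_sq_embS (z : Fin N → ℝ) : ‖embS φ s lam N z‖ ^ 2 = wSq (sobWeight s lam N) z := by
  rw [norm_sq_sobolev, toH_embS, tsum_eq_sum (s := Finset.range N), Finset.sum_range]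
  · refine Finset.sum_congr rfl fun j _ => ?_
    rw [inner_embZ, rpow_two_mul_eq, sobWeight]
    ring
  · intro j hj
    rw [inner_embZ_of_le φ lam z (by simpa using hj)]
    simp

theorem norm_embS (z : Fin N → ℝ) : ‖embS φ s lam N z‖ = √(wSq (sobWeight s lam N) z) := by
  rw [← norm_sq_embS φ, Real.sqrt_sq (norm_nonneg _)]

variable {N} in
theorem proj_apply (x : H) : proj φ N x = ∑ j : Fin N, inner ℝ (φ j) x • φ j := by
  rw [proj, sum_apply, Finset.sum_range]
  rfl

variable {N} in
theorem projS_apply (x : H) : projS φ s N x = ∑ j : Fin N, inner ℝ (φ j) x • basisVec φ s j := by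
  rw [projS, sum_apply, Finset.sum_range]
  rfl

theorem projS_embZ (z : Fin N → ℝ) : projS φ s N (embZ φ lam N z) = embS φ s lam N z := by
  rw [projS_apply, embS_apply]
  refine Finset.sum_congr rfl fun j _ => ?_
  rw [inner_embZ, smul_smul, mul_comm]

theorem projS_basis (j : Fin N) : projS φ s N (φ j) = basisVec φ s j := by
  rw [projS_apply]
  simp [inner_basis, Fin.val_inj]

theorem normSqCN_embZ {lam : ℕ → ℝ} (hlam : ∀ j, lam j ≠ 0) (z : Fin N → ℝ) :
    normSqCN φ lam N (embZ φ lam N z) = sqNorm z := by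
  rw [normSqCN, Finset.sum_range]
  refine Finset.sum_congr rfl fun j _ => ?_
  rw [inner_embZ]
  have := hlam j
  field_simp

theorem sqrtCovN_sum (ξ : Fin N → ℝ) :
    sqrtCovN φ lam N (∑ j : Fin N, ξ j • φ j) = embZ φ lam N ξ := by
  rw [sqrtCovN, sum_apply, Finset.sum_range, embZ_apply]
  refine Finset.sum_congr rfl fun i _ => ?_
  simp [inner_basis, Fin.val_inj]

/-- The rescaled coordinates of a point of `H`. -/
def coordZ (x : H) : Fin N → ℝ := fun j => inner ℝ (φ j) x / lam j

theorem embZ_coordZ {lam : ℕ → ℝ} (hlam : ∀ j, lam j ≠ 0) (x : H) :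
    embZ φ lam N (coordZ φ lam N x) = proj φ N x := by
  rw [embZ_apply, proj_apply]
  refine Finset.sum_congr rfl fun j _ => ?_
  rw [smul_smul, coordZ, div_mul_cancel₀ _ (hlam j)]

/-- The potential in rescaled coordinates. -/
def potZ (Ψ : SobolevSpace φ s → ℝ) (z : Fin N → ℝ) : ℝ := Ψ (embS φ s lam N z)

/-- The gradient of the potential in rescaled coordinates, `C_N^{1/2} ∇Ψ^N`. -/
def gradZ (Ψ : SobolevSpace φ s → ℝ) (z : Fin N → ℝ) : Fin N → ℝ :=
  fun j => lam j * fderiv ℝ Ψ (embS φ s lam N z) (basisVec φ s j)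

theorem sum_mul_gradZ (Ψ : SobolevSpace φ s → ℝ) (z w : Fin N → ℝ) :
    ∑ j, w j * gradZ φ s lam N Ψ z j = fderiv ℝ Ψ (embS φ s lam N z) (embS φ s lam N w) := by
  rw [embS_apply _ _ _ _ w, map_sum]
  refine Finset.sum_congr rfl fun j _ => ?_
  rw [map_smul, map_smul, gradZ, smul_eq_mul, smul_eq_mul]

end Coordinates

section Taylor

variable {E : Type*} [NormedAddCommGroup E] [NormedSpace ℝ E]

/-- The trapezoidal rule for a function with Lipschitz derivative has a quadratic error. -/
theorem abs_trapezoid_le {f : E → ℝ} {K : ℝ} (hK : 0 ≤ K) (hf : Differentiable ℝ f)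
    (hlip : ∀ x y, ‖fderiv ℝ f x - fderiv ℝ f y‖ ≤ K * ‖x - y‖) (x y : E) :
    |f x - f y + 1 / 2 * (fderiv ℝ f x (y - x) + fderiv ℝ f y (y - x))| ≤ 2 * K * ‖y - x‖ ^ 2 := by
  have h1 : ‖f y - f x - fderiv ℝ f x (y - x)‖ ≤ K * ‖y - x‖ * ‖y - x‖ := by
    refine Convex.norm_image_sub_le_of_norm_fderiv_le' (𝕜 := ℝ) (fun u _ => hf u) (fun u hu => ?_)
      (convex_closedBall x ‖y - x‖) (Metric.mem_closedBall_self (norm_nonneg _))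
      (by rw [mem_closedBall_iff_norm])
    refine (hlip u x).trans ?_
    rw [mem_closedBall_iff_norm] at hu
    gcongr
  have h2 : |(fderiv ℝ f y - fderiv ℝ f x) (y - x)| ≤ K * ‖y - x‖ * ‖y - x‖ := by
    rw [← Real.norm_eq_abs]
    refine (ContinuousLinearMap.le_opNorm _ _).trans ?_
    gcongr
    exact hlip y x
  have heq : f x - f y + 1 / 2 * (fderiv ℝ f x (y - x) + fderiv ℝ f y (y - x))
      = -(f y - f x - fderiv ℝ f x (y - x))
        + 1 / 2 * (fderiv ℝ f y - fderiv ℝ f x) (y - x) := by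
    rw [sub_apply]; ring
  rw [heq]
  refine (abs_add_le _ _).trans ?_
  rw [abs_neg, abs_mul, abs_of_pos (by norm_num : (0 : ℝ) < 1 / 2)]
  rw [Real.norm_eq_abs] at h1
  have : 0 ≤ K * ‖y - x‖ * ‖y - x‖ := by positivity
  nlinarith

end Taylor

section Model

variable {H : Type*} [NormedAddCommGroup H] [InnerProductSpace ℝ H]
variable {φ : HilbertBasis ℕ ℝ H} {s κ : ℝ} {C : H →L[ℝ] H} {lam : ℕ → ℝ}
  {Ψ : SobolevSpace φ s → ℝ}

theorem StandingAssumption.lam_pos (h : StandingAssumption φ s C lam κ Ψ) (j : ℕ) : 0 < lam j := by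
  obtain ⟨c₁, hc₁, c₂, hc⟩ := h.decay
  exact lt_of_lt_of_le (by positivity) (hc j).1

/-- The embedding of `N(0, C)` into `H^s` has finite trace: `∑ j^{2s} λ_j² < ∞`. -/
theorem StandingAssumption.exists_sum_weights_le (h : StandingAssumption φ s C lam κ Ψ) :
    ∃ B, 0 ≤ B ∧ ∀ N, ∑ j, sobWeight s lam N j ^ 2 ≤ B := by
  obtain ⟨c₁, hc₁, c₂, hc⟩ := h.decay
  have hsum : Summable fun j : ℕ => c₂ ^ 2 * ((j : ℝ) + 1) ^ (2 * s - 2 * κ) := by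
    have h1 : Summable fun j : ℕ => (j : ℝ) ^ (2 * s - 2 * κ) :=
      Real.summable_nat_rpow.2 (by linarith [h.s_lt])
    have h2 := (summable_nat_add_iff 1).2 h1
    refine (h2.mul_left (c₂ ^ 2)).congr fun j => ?_
    push_cast
    rfl
  refine ⟨∑' j : ℕ, c₂ ^ 2 * ((j : ℝ) + 1) ^ (2 * s - 2 * κ),
    tsum_nonneg fun j => by positivity, fun N => ?_⟩
  simp only [sobWeight]
  rw [← Finset.sum_range (fun j : ℕ => (((j : ℝ) + 1) ^ s * lam j) ^ 2)]
  refine le_trans (Finset.sum_le_sum fun j _ => ?_)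
    (hsum.sum_le_tsum (Finset.range N) fun j _ => by positivity)
  have hj : (0 : ℝ) < (j : ℝ) + 1 := by positivity
  have hl := (h.lam_pos j).le
  calc (((j : ℝ) + 1) ^ s * lam j) ^ 2
      ≤ (((j : ℝ) + 1) ^ s * (c₂ * ((j : ℝ) + 1) ^ (-κ))) ^ 2 := by
        gcongr; exact (hc j).2
    _ = c₂ ^ 2 * (((j : ℝ) + 1) ^ s * ((j : ℝ) + 1) ^ (-κ)) ^ 2 := by ring
    _ = c₂ ^ 2 * ((j : ℝ) + 1) ^ (2 * s - 2 * κ) := by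
        rw [← Real.rpow_add hj, ← Real.rpow_mul_natCast hj.le]
        congr 2
        push_cast; ring

theorem StandingAssumption.exists_isCoordModel (h : StandingAssumption φ s C lam κ Ψ) :
    ∃ K B, 0 ≤ K ∧ 0 ≤ B ∧ ∀ N,
      IsCoordModel K B (sobWeight s lam N) (potZ φ s lam N Ψ) (gradZ φ s lam N Ψ) := by
  obtain ⟨B, hB, hsum⟩ := h.exists_sum_weights_le
  obtain ⟨K₁, hK₁⟩ := h.deriv_bounded
  obtain ⟨K₂, hK₂⟩ := h.deriv_lipschitz
  have hK0 : 0 ≤ max K₁ (max K₂ 0) := (le_max_right _ _).trans (le_max_right _ _)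
  have hb : ∀ x, ‖fderiv ℝ Ψ x‖ ≤ max K₁ (max K₂ 0) := fun x => (hK₁ x).trans (le_max_left _ _)
  have hl : ∀ x y, ‖fderiv ℝ Ψ x - fderiv ℝ Ψ y‖ ≤ max K₁ (max K₂ 0) * ‖x - y‖ := fun x y =>
    (hK₂ x y).trans (mul_le_mul_of_nonneg_right
      ((le_max_left _ _).trans (le_max_right _ _)) (norm_nonneg _))
  refine ⟨max K₁ (max K₂ 0), B, hK0, hB, fun N => ?_⟩
  have hemb : Continuous (embS φ s lam N) := LinearMap.continuous_of_finiteDimensional _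
  have hder : Continuous (fderiv ℝ Ψ) :=
    (LipschitzWith.of_dist_le_mul (K := Real.toNNReal (max K₁ (max K₂ 0))) fun x y => by
      rw [dist_eq_norm, dist_eq_norm, Real.coe_toNNReal _ hK0]
      exact hl x y).continuous
  refine ⟨(h.differentiable.continuous.comp hemb).measurable, ?_, hsum N, fun z w => ?_,
    fun z y => ?_⟩
  · refine measurable_pi_lambda _ fun j => Continuous.measurable ?_
    exact continuous_const.mul ((hder.comp hemb).clm_apply continuous_const)
  · rw [sum_mul_gradZ, ← norm_embS φ, ← Real.norm_eq_abs]
    refine (ContinuousLinearMap.le_opNorm _ _).trans ?_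
    gcongr
    exact hb _
  · have := abs_trapezoid_le hK0 h.differentiable hl (embS φ s lam N z) (embS φ s lam N y)
    rw [← map_sub, norm_sq_embS, ← sum_mul_gradZ, ← sum_mul_gradZ, ← Finset.sum_add_distrib] at this
    refine le_trans (le_of_eq ?_) this
    congr 4
    ext j
    simp only [Pi.sub_apply]
    ring

theorem covN_apply (hC : ∀ j, C (φ j) = (lam j ^ 2) • φ j) {N : ℕ} (x : H) :
    covN φ C N x = ∑ j : Fin N, (lam j ^ 2 * inner ℝ (φ j) x) • φ j := by
  rw [covN, ContinuousLinearMap.comp_apply, ContinuousLinearMap.comp_apply, proj_apply, proj_apply]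
  refine Finset.sum_congr rfl fun i _ => ?_
  congr 1
  simp only [map_sum, map_smul, hC, inner_sum, inner_smul_right, inner_basis, Fin.val_inj]
  simp [mul_comm]

theorem meanSq_eq_coordZ (lam : ℕ → ℝ) (N : ℕ) (x : H) :
    meanSq φ lam N x = 1 / (N : ℝ) * sqNorm (coordZ φ lam N x) := by
  rw [meanSq, normSqCN, Finset.sum_range]
  congr 1
  exact Finset.sum_congr rfl fun j _ => (div_pow _ _ 2).symm

theorem wSq_coordZ_le {lam : ℕ → ℝ} (hlam : ∀ j, lam j ≠ 0) (N : ℕ) (x : SobolevSpace φ s) :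
    wSq (sobWeight s lam N) (coordZ φ lam N (SobolevSpace.toH φ s x)) ≤ ‖x‖ ^ 2 := by
  have hsum : Summable fun j : ℕ =>
      ((j : ℝ) + 1) ^ (2 * s) * (inner ℝ (φ j) (SobolevSpace.toH φ s x)) ^ 2 := x.2
  rw [norm_sq_sobolev]
  refine le_trans (le_of_eq ?_) (hsum.sum_le_tsum (Finset.range N) fun j _ => by positivity)
  rw [Finset.sum_range]
  refine Finset.sum_congr rfl fun j _ => ?_
  have := hlam j
  rw [sobWeight, coordZ, rpow_two_mul_eq]
  field_simp

end Model

/-! ### The chain on `X^N` in rescaled coordinates -/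

section Bridge

variable {H : Type*} [NormedAddCommGroup H] [InnerProductSpace ℝ H] [CompleteSpace H]
variable {φ : HilbertBasis ℕ ℝ H} {s κ : ℝ} {C : H →L[ℝ] H} {lam : ℕ → ℝ}
  {Ψ : SobolevSpace φ s → ℝ}

theorem inner_gradient_PsiN (hΨ : Differentiable ℝ Ψ) {N : ℕ} (x : H) (j : Fin N) :
    inner ℝ (φ j) (gradient (PsiN φ s Ψ N) x) = fderiv ℝ Ψ (projS φ s N x) (basisVec φ s j) := by
  have h1 : HasFDerivAt (PsiN φ s Ψ N) ((fderiv ℝ Ψ (projS φ s N x)).comp (projS φ s N)) x :=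
    (hΨ (projS φ s N x)).hasFDerivAt.comp x (projS φ s N).hasFDerivAt
  rw [real_inner_comm, ← InnerProductSpace.toDual_apply_apply (𝕜 := ℝ), toDual_gradient, h1.fderiv,
    ContinuousLinearMap.comp_apply, projS_basis]

theorem drift_embZ (h : StandingAssumption φ s C lam κ Ψ) {N : ℕ} (z : Fin N → ℝ) :
    drift φ s C Ψ N (embZ φ lam N z) = -embZ φ lam N (z + gradZ φ s lam N Ψ z) := by
  rw [drift, covN_apply h.eigen, map_add]
  congr 2
  rw [embZ_apply _ _ _ (gradZ _ _ _ _ _ _)]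
  refine Finset.sum_congr rfl fun j _ => ?_
  rw [inner_gradient_PsiN h.differentiable, projS_embZ, gradZ, smul_smul]
  congr 1
  ring

theorem proposal_embZ (h : StandingAssumption φ s C lam κ Ψ) (ℓ : ℝ) {N : ℕ} (z ξ : Fin N → ℝ) :
    proposal φ s C lam Ψ ℓ N (embZ φ lam N z) ξ
      = embZ φ lam N (propZ (step ℓ N) (gradZ φ s lam N Ψ) z ξ) := by
  rw [proposal, drift_embZ h, sqrtCovN_sum, ← map_neg, ← map_smul, ← map_smul, ← map_add,
    ← map_add]
  congr 1
  ext j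
  simp only [propZ, Pi.add_apply, Pi.smul_apply, Pi.neg_apply, smul_eq_mul]
  ring

/-- In coordinates the acceptance probability is `1 ∧ exp (logRatio …)`. Expanding the squares, the
term `‖y - z‖² / (4δ)` is symmetric and cancels, and the cross terms absorb the Gaussian part of the
target. -/
theorem acceptProb_embZ (h : StandingAssumption φ s C lam κ Ψ) {ℓ : ℝ} {N : ℕ}
    (hδ : 0 < step ℓ N) (z y : Fin N → ℝ) :
    acceptProb φ s C lam Ψ ℓ N (embZ φ lam N z) (embZ φ lam N y)
      = accZ (step ℓ N) (potZ φ s lam N Ψ) (gradZ φ s lam N Ψ) z y := by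
  have hlam : ∀ j, lam j ≠ 0 := fun j => (h.lam_pos j).ne'
  have hpot : ∀ w, PsiN φ s Ψ N (embZ φ lam N w) = potZ φ s lam N Ψ w := fun w => by
    rw [PsiN, projS_embZ, potZ]
  have hq : ∀ a b, normSqCN φ lam N (embZ φ lam N b - embZ φ lam N a
      - step ℓ N • drift φ s C Ψ N (embZ φ lam N a))
      = sqNorm (b - a + step ℓ N • (a + gradZ φ s lam N Ψ a)) := fun a b => by
    rw [drift_embZ h, smul_neg, sub_neg_eq_add, ← map_smul, ← map_sub, ← map_add,
      normSqCN_embZ _ _ hlam]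
  rw [acceptProb, accZ]
  congr 1
  simp only [targetDensity, proposalDensity, hpot, hq, normSqCN_embZ _ _ hlam]
  rw [← Real.exp_add, ← Real.exp_add, ← Real.exp_add, ← Real.exp_add, ← Real.exp_sub]
  congr 1
  set δ := step ℓ N
  set v := gradZ φ s lam N Ψ
  have hexp : ∀ a b : Fin N → ℝ, sqNorm (b - a + δ • (a + v a))
      = sqNorm (b - a) + 2 * δ * ∑ j, (b j - a j) * (a j + v a j)
        + δ ^ 2 * sqNorm (a + v a) := by
    intro a b
    simp only [sqNorm, Finset.mul_sum, ← Finset.sum_add_distrib]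
    refine Finset.sum_congr rfl fun j _ => ?_
    simp only [Pi.add_apply, Pi.sub_apply, Pi.smul_apply, smul_eq_mul]
    ring
  have hsymm : sqNorm (z - y) = sqNorm (y - z) :=
    Finset.sum_congr rfl fun j _ => by simp only [Pi.sub_apply]; ring
  -- The symmetric part of the proposal cancels the Gaussian part of the target.
  have hcancel : ∑ j, (y j - z j) * (z j + v z j) - ∑ j, (z j - y j) * (y j + v y j)
      = sqNorm y - sqNorm z + ∑ j, (y j - z j) * (v z j + v y j) := by
    simp only [sqNorm, ← Finset.sum_add_distrib, ← Finset.sum_sub_distrib]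
    exact Finset.sum_congr rfl fun j _ => by ring
  rw [hexp, hexp, hsymm, logRatio]
  have hne := hδ.ne'
  field_simp
  linear_combination (4 * δ) * hcancel

theorem chain_eq_embZ (h : StandingAssumption φ s C lam κ Ψ) {ℓ : ℝ} {N : ℕ}
    (hδ : 0 < step ℓ N) (x₀ : H) (ξ : ℕ → Fin N → ℝ) (U : ℕ → ℝ) (k : ℕ) :
    chain φ s C lam Ψ ℓ N x₀ ξ U k = embZ φ lam N (chainZ (step ℓ N) (potZ φ s lam N Ψ)
      (gradZ φ s lam N Ψ) (coordZ φ lam N x₀) ξ U k) := by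
  induction k with
  | zero =>
    simp only [chain, chainZ]
    rw [embZ_coordZ _ _ fun j => (h.lam_pos j).ne']
  | succ k ih =>
    simp only [chain, chainZ]
    rw [ih, proposal_embZ h, acceptProb_embZ h hδ]
    split_ifs <;> rfl

theorem chainS_eq (h : StandingAssumption φ s C lam κ Ψ) {ℓ : ℝ} {N : ℕ}
    (hδ : 0 < step ℓ N) (x₀ : H) (ξ : ℕ → Fin N → ℝ) (U : ℕ → ℝ) (k : ℕ) :
    chainS φ s C lam Ψ ℓ N x₀ ξ U k = 1 / (N : ℝ) * sqNorm (chainZ (step ℓ N) (potZ φ s lam N Ψ)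
      (gradZ φ s lam N Ψ) (coordZ φ lam N x₀) ξ U k) := by
  rw [chainS, chain_eq_embZ h hδ, meanSq, normSqCN_embZ _ _ fun j => (h.lam_pos j).ne']

end Bridge

/-! ### Convergence of the interpolated chain -/

theorem tendsto_inv_sqrt_sqrt : Tendsto (fun N : ℕ => (√√(N : ℝ))⁻¹) atTop (𝓝 0) :=
  tendsto_inv_atTop_zero.comp (Real.tendsto_sqrt_atTop.comp
    (Real.tendsto_sqrt_atTop.comp tendsto_natCast_atTop_atTop))

theorem inv_sqrt_sqrt_sq (N : ℕ) : (√√(N : ℝ))⁻¹ ^ 2 = (√(N : ℝ))⁻¹ := by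
  rw [inv_pow, Real.sq_sqrt (Real.sqrt_nonneg _)]

theorem inv_sqrt_sqrt_pow_four (N : ℕ) : (√√(N : ℝ))⁻¹ ^ 4 = 1 / (N : ℝ) := by
  rw [show (4 : ℕ) = 2 * 2 from rfl, pow_mul, inv_sqrt_sqrt_sq, inv_pow,
    Real.sq_sqrt (Nat.cast_nonneg N), one_div]

/-- The order in which the small parameters are chosen in the final estimate: the threshold `η` is
fixed first, and `N` is then taken large depending on `η`. -/
theorem exists_pos_eventually_lt {F : ℝ × ℝ × ℝ → ℝ} (hF : Continuous F) (hF0 : F (0, 0, 0) = 0)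
    {p q : ℕ → ℝ} (hp : Tendsto p atTop (𝓝 0)) (hq : Tendsto q atTop (𝓝 0)) {ε : ℝ}
    (hε : 0 < ε) : ∃ η > 0, ∀ᶠ N in atTop, F (p N, q N, η) < ε := by
  have hc : Continuous fun θ : ℝ => F (0, 0, θ) := by fun_prop
  have h1 : ∀ᶠ θ in 𝓝[>] (0 : ℝ), F (0, 0, θ) < ε :=
    (hc.continuousAt.eventually_lt_const (by simpa only [hF0] using hε)).filter_mono
      nhdsWithin_le_nhds
  obtain ⟨η, hη, hη0⟩ := (h1.and self_mem_nhdsWithin).exists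
  have hlim : Tendsto (fun N => F (p N, q N, η)) atTop (𝓝 (F (0, 0, η))) :=
    (hF.tendsto (0, 0, η)).comp (hp.prodMk_nhds (hq.prodMk_nhds tendsto_const_nhds))
  exact ⟨η, hη0, hlim.eventually_lt_const hη⟩

section Convergence

variable {H : Type*} [NormedAddCommGroup H] [InnerProductSpace ℝ H] [CompleteSpace H]
variable {φ : HilbertBasis ℕ ℝ H} {s κ : ℝ} {C : H →L[ℝ] H} {lam : ℕ → ℝ}
  {Ψ : SobolevSpace φ s → ℝ}
variable {Ω : Type*} [MeasurableSpace Ω] {P : Measure Ω} [IsProbabilityMeasure P]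

theorem tendstoInMeasure_interpolant (h : StandingAssumption φ s C lam κ Ψ) {ℓ : ℝ} (hℓ : 0 < ℓ)
    {x₀ : SobolevSpace φ s} {S₀ : ℝ}
    (hS₀ : Tendsto (fun N : ℕ => meanSq φ lam N (SobolevSpace.toH φ s x₀)) atTop (𝓝 S₀))
    {T : ℝ} (hT : 0 < T) {σ : ℝ → ℝ} (hσ0 : σ 0 = S₀)
    (hσ : ∀ t ∈ Set.Icc 0 (T + 1), HasDerivWithinAt σ (bLim ℓ (σ t)) (Set.Icc 0 (T + 1)) t)
    {S : C(Set.Icc (0 : ℝ) T, ℝ)} (hS : ∀ t, S t = σ t)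
    {ξ : (N : ℕ) → ℕ → Fin N → Ω → ℝ} {U : ℕ → ℕ → Ω → ℝ}
    (hnoise : ∀ N : ℕ, IsNoise P N (ξ N) (U N)) (hξ : ∀ N k j, Measurable (ξ N k j))
    (hU : ∀ N k, Measurable (U N k)) :
    TendstoInMeasure P (fun (N : ℕ) (ω : Ω) => interpolant N T
      (chainS φ s C lam Ψ ℓ N (SobolevSpace.toH φ s x₀) (fun k j => ξ N k j ω)
        (fun k => U N k ω))) atTop (fun _ => S) := by
  obtain ⟨K, B, hK, hB, hmod⟩ := h.exists_isCoordModel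
  obtain ⟨D, hD, hlip, heuler⟩ := exists_euler_error hℓ hσ
  obtain ⟨Q, hQ⟩ := hS₀.bddAbove_range
  have hQ' : ∀ N, meanSq φ lam N (SobolevSpace.toH φ s x₀) ≤ Q := fun N => hQ ⟨N, rfl⟩
  have hQ0 : 0 ≤ Q := by
    have := hQ' 0
    simpa [meanSq] using this
  have hT1 : 0 ≤ T + 1 := by linarith
  obtain ⟨Ce, hCe, herr⟩ := exists_integral_error_le (P := P) (Λ := 1 + Q + ‖x₀‖ ^ 2) hℓ hK hB
    (by positivity) hT1
  set r : ℕ → ℝ := fun N => (√√(N : ℝ))⁻¹ with hr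
  have hr0 : Tendsto r atTop (𝓝 0) := tendsto_inv_sqrt_sqrt
  have hr2 : ∀ N, r N ^ 2 = (√(N : ℝ))⁻¹ := inv_sqrt_sqrt_sq
  have hr20 : Tendsto (fun N => r N ^ 2) atTop (𝓝 0) := by simpa using hr0.pow 2
  have hstep : ∀ N, step ℓ N = ℓ * r N ^ 2 := fun N => by rw [hr2, step, div_eq_mul_inv]
  set n : ℕ → ℕ := fun N => ⌊(T + 1) / r N ^ 2⌋₊ with hn
  set a : ℕ → ℕ → Ω → ℝ := fun N k ω => chainS φ s C lam Ψ ℓ N (SobolevSpace.toH φ s x₀)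
    (fun k j => ξ N k j ω) (fun k => U N k ω) k with ha
  set Θ : ℕ → Ω → ℝ := fun N ω => ∑ k ∈ Finset.range (n N),
    (r N ^ 2 * |∑ i ∈ Finset.range k, mart ℓ (r N) (a N i ω) (U N i ω)|
      + |remainder ℓ (r N) (a N k ω) (a N (k + 1) ω) (U N k ω)|) with hΘ
  have hlarge : ∀ᶠ N : ℕ in atTop, 0 < N ∧ r N ≤ 1 ∧ ℓ * r N ^ 2 ≤ 1 := by
    have h1 : ∀ᶠ N : ℕ in atTop, r N < 1 := hr0.eventually_lt_const one_pos
    have h2 : Tendsto (fun N => ℓ * r N ^ 2) atTop (𝓝 0) := by simpa using hr20.const_mul ℓ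
    filter_upwards [eventually_gt_atTop 0, h1, h2.eventually_lt_const one_pos] with N h3 h4 h5
    exact ⟨h3, h4.le, h5.le⟩
  have hrpos : ∀ {N : ℕ}, 0 < N → 0 < r N := fun hN => by
    have : (0 : ℝ) < _ := Nat.cast_pos.2 hN
    simp only [hr]; positivity
  have hnle : ∀ {N : ℕ}, 0 < N → n N * r N ^ 2 ≤ T + 1 := fun {N} hN => by
    have := hrpos hN
    rw [← le_div_iff₀ (by positivity)]
    exact Nat.floor_le (by positivity)
  have ha' : ∀ {N : ℕ}, 0 < N → ∀ k ω, a N k ω = r N ^ 4 * sqNorm (chainZ (ℓ * r N ^ 2)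
      (potZ φ s lam N Ψ) (gradZ φ s lam N Ψ) (coordZ φ lam N (SobolevSpace.toH φ s x₀))
      (fun i j => ξ N i j ω) (fun i => U N i ω) k) := fun {N} hN k ω => by
    have := hrpos hN
    have hδ : 0 < step ℓ N := by rw [hstep]; positivity
    rw [ha]
    simp only
    rw [chainS_eq h hδ, hstep]
    congr 1
    exact (inv_sqrt_sqrt_pow_four N).symm
  have ha0 : ∀ N ω, a N 0 ω = meanSq φ lam N (SobolevSpace.toH φ s x₀) := fun N ω => by
    simp only [ha, chainS, chain, meanSq, normSqCN]
    congr 1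
    refine Finset.sum_congr rfl fun j hj => ?_
    rw [proj_apply, inner_sum]
    congr 2
    have : ∀ i : Fin N, inner ℝ (φ j) (inner ℝ (φ i) (SobolevSpace.toH φ s x₀) • φ i)
        = if i = ⟨j, Finset.mem_range.1 hj⟩ then inner ℝ (φ j) (SobolevSpace.toH φ s x₀)
          else 0 := fun i => by
      rw [inner_smul_right, inner_basis]
      by_cases hij : i = ⟨j, Finset.mem_range.1 hj⟩
      · simp [hij]
      · have : j ≠ i := fun hji => hij (Fin.ext hji.symm)
        simp [hij, this]
    simp [this]
  have hΘ' : ∀ N ω, Θ N ω = ∑ k ∈ Finset.range (n N),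
      (r N ^ 2 * |∑ i ∈ Finset.range k, mart ℓ (r N) (a N i ω) (U N i ω)|
        + |remainder ℓ (r N) (a N k ω) (a N (k + 1) ω) (U N k ω)|) := fun _ _ => rfl
  have hΘ0 : ∀ N ω, 0 ≤ Θ N ω := fun N ω => by simp only [hΘ]; positivity
  have hinterp : ∀ N ω t, interpolant N T (chainS φ s C lam Ψ ℓ N (SobolevSpace.toH φ s x₀)
      (fun k j => ξ N k j ω) (fun k => U N k ω)) t
      = linInterp (fun k => a N k ω) ((r N ^ 2)⁻¹ * t) := fun N ω t => by
    rw [hr2, inv_inv]; rfl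
  have hnfloor : ∀ {N : ℕ}, 0 < N → ∀ k : ℕ, k * r N ^ 2 ≤ T + 1 → k ≤ n N := fun {N} hN k hk => by
    have := hrpos hN
    exact Nat.le_floor (by rw [le_div_iff₀ (by positivity)]; exact hk)
  have hr4 : ∀ N, r N ^ 4 = 1 / (N : ℝ) := inv_sqrt_sqrt_pow_four
  clear_value a Θ n r
  refine tendstoInMeasure_of_control (Θ := Θ) (x := fun N => Ce * r N)
    (by simpa using hr0.const_mul Ce) hΘ0 ?_ ?_
  · filter_upwards [hlarge] with N hN
    obtain ⟨hN, hr1, hδ⟩ := hN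
    have hrp := hrpos hN
    have hN' : (N : ℝ) ≠ 0 := by exact_mod_cast hN.ne'
    have hr4N : r N ^ 4 * N = 1 := by rw [hr4]; field_simp
    have hΘN : Θ N = _ := funext (hΘ' N)
    rw [hΘN]
    refine herr (hmod N) (r N) hrp hr1 hr4N hδ (coordZ φ lam N (SobolevSpace.toH φ s x₀)) ?_
      (hnoise N) (hξ N) (hU N) (a N) (ha' hN) (n N) (hnle hN)
    have h1 := hQ' N
    rw [meanSq_eq_coordZ, ← hr4] at h1
    have h2 := wSq_coordZ_le (φ := φ) (fun j => (h.lam_pos j).ne') N x₀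
    have h3 : r N ^ 2 * wSq (sobWeight s lam N) (coordZ φ lam N (SobolevSpace.toH φ s x₀))
        ≤ 1 * ‖x₀‖ ^ 2 := by
      gcongr
      · exact wSq_nonneg _ _
      · exact pow_le_one₀ hrp.le hr1
    unfold lyap
    linarith
  · intro ε hε
    -- The error bound, as a function of the initial error, the time step and `Θ`.
    obtain ⟨η, hη, hηε⟩ := exists_pos_eventually_lt (F := fun p : ℝ × ℝ × ℝ =>
      Real.exp (2 * ℓ * (T + 1)) * (p.1 + (2 * ℓ + 1) * p.2.2 + (T + 1) * (2 * ℓ * D) * p.2.1)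
        + √(4 * ℓ * p.2.2 + 4 * ℓ ^ 2 * (T + 1) * p.2.1) + D * p.2.1) (by fun_prop) (by simp)
      (p := fun N => |meanSq φ lam N (SobolevSpace.toH φ s x₀) - S₀|)
      (by simpa using (hS₀.sub_const S₀).abs) hr20 hε
    refine ⟨η, hη, ?_⟩
    filter_upwards [hlarge, hηε] with N hN hNε
    obtain ⟨hN, hr1, hδ⟩ := hN
    have hrp := hrpos hN
    filter_upwards [(hnoise N).ae_unif_le_one] with ω hω hΘη
    rw [ContinuousMap.dist_lt_iff hε]
    intro t
    have hm : ∀ k, |mart ℓ (r N) (a N k ω) (U N k ω)| ≤ 2 * ℓ * r N ^ 2 := fun k => by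
      refine abs_mart_le hℓ ?_ (hω k)
      rw [ha' hN]
      exact mul_nonneg (by positivity) (sqNorm_nonneg _)
    have key := abs_linInterp_sub_solution_le hℓ hrp hr1 hD hlip heuler (S := fun k => a N k ω)
      (U := fun k => U N k ω) hm (hnle hN)
      (hnfloor hN) (hΘ' N ω).symm t.2
    rw [Real.dist_eq, hinterp, hS]
    refine (key.trans ?_).trans_lt hNε
    rw [ha0, hσ0]
    gcongr

end Convergence

end

end MALA

theorem theorem5p1
    {H : Type*} [NormedAddCommGroup H] [InnerProductSpace ℝ H] [CompleteSpace H]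
    (φ : HilbertBasis ℕ ℝ H) (C : H →L[ℝ] H) (lam : ℕ → ℝ) (κ s : ℝ)
    (Ψ : MALA.SobolevSpace φ s → ℝ)
    (hass : MALA.StandingAssumption φ s C lam κ Ψ)
    (ℓ : ℝ) (hℓ : 0 < ℓ)
    (x₀ : MALA.SobolevSpace φ s) (hx₀ : x₀ ∈ MALA.sobolevCap φ s lam)
    (T : ℝ) (hT : 0 < T)
    {Ω : Type*} [MeasurableSpace Ω] (P : Measure Ω) [IsProbabilityMeasure P]
    (ξ : (N : ℕ) → ℕ → Fin N → Ω → ℝ) (U : ℕ → ℕ → Ω → ℝ)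
    (hnoise : ∀ N : ℕ, MALA.IsNoise P N (ξ N) (U N)) :
    ∃ S₀ : ℝ,
      Tendsto (fun N : ℕ => MALA.meanSq φ lam N (MALA.SobolevSpace.toH φ s x₀)) atTop (𝓝 S₀) ∧
      ∃ S : C(Set.Icc (0 : ℝ) T, ℝ),
        (∀ R : C(Set.Icc (0 : ℝ) T, ℝ), MALA.IsODESolution ℓ hT S₀ R ↔ R = S) ∧
        TendstoInMeasure P
          (fun (N : ℕ) (ω : Ω) => MALA.interpolant N T
            (MALA.chainS φ s C lam Ψ ℓ N (MALA.SobolevSpace.toH φ s x₀)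
              (fun k j => ξ N k j ω) (fun k => U N k ω)))
          atTop (fun _ => S) := by
  obtain ⟨S₀, hS₀⟩ := hx₀
  refine ⟨S₀, hS₀, ?_⟩
  -- The solution is taken on a longer interval because the last linear piece of the interpolant
  -- may end after time `T`.
  obtain ⟨σ, hσ0, hσ⟩ := MALA.exists_solution hℓ S₀ (τ := T + 1) (by linarith)
  have hcont : ContinuousOn σ (Set.Icc 0 (T + 1)) := fun t ht => (hσ t ht).continuousWithinAt
  let S : C(Set.Icc (0 : ℝ) T, ℝ) := ⟨fun t => σ t,
    hcont.comp_continuous continuous_subtype_val fun t => ⟨t.2.1, by linarith [t.2.2]⟩⟩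
  have hsol : MALA.IsODESolution ℓ hT S₀ S :=
    MALA.isODESolution_restrict hT (by linarith) hσ0 hσ S fun _ => rfl
  refine ⟨S, fun R => ⟨fun hR => MALA.isODESolution_eq hℓ hT hR hsol, fun hR => hR ▸ hsol⟩, ?_⟩
  -- The noise is only almost everywhere measurable; measurable versions give the same chain almost
  -- surely.
  have hξae : ∀ N k j, AEMeasurable (ξ N k j) P := fun N k j =>
    ((hnoise N).gaussian k j).aemeasurable
  have hUae : ∀ N k, AEMeasurable (U N k) P := fun N k => ((hnoise N).uniform k).aemeasurable
  have hnoise' : ∀ N, MALA.IsNoise P N (fun k j => (hξae N k j).mk) (fun k => (hUae N k).mk) :=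
    fun N => by
      refine ⟨fun k j => ((hnoise N).gaussian k j).congr (hξae N k j).ae_eq_mk.symm,
        fun k => ((hnoise N).uniform k).congr (hUae N k).ae_eq_mk.symm,
        (hnoise N).indep.congr fun i => ?_⟩
      rcases i with ⟨k, j⟩ | k
      · exact (hξae N k j).ae_eq_mk
      · exact (hUae N k).ae_eq_mk
  refine (MALA.tendstoInMeasure_interpolant hass hℓ hS₀ hT hσ0 hσ (S := S) (fun _ => rfl) hnoise'
    (fun N k j => (hξae N k j).measurable_mk) (fun N k => (hUae N k).measurable_mk)).congr_left
    fun N => ?_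
  have h1 : ∀ᵐ ω ∂P, ∀ k j, ξ N k j ω = (hξae N k j).mk _ ω :=
    ae_all_iff.2 fun k => ae_all_iff.2 fun j => (hξae N k j).ae_eq_mk
  have h2 : ∀ᵐ ω ∂P, ∀ k, U N k ω = (hUae N k).mk _ ω :=
    ae_all_iff.2 fun k => (hUae N k).ae_eq_mk
  filter_upwards [h1, h2] with ω hω1 hω2
  simp only [hω1, hω2]
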